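/- Let $d\in\mathbb N$, let $I_1,\dots,I_d\subset\mathbb R$ be intervals (bounded or unbounded) and $\mathbf I=I_1\times\dots\times I_d$, and let $n_1,\dots,n_d\ge 1$ be integers, $\mathbf n=(n_1,\dots,n_d)$. For pairwise distinct points, the divided differences of a function $f$ of one variable are $[x_0;f]=f(x_0)$ and $$[x_0,\dots,x_{m};f]=\frac{[x_1,\dots,x_{m};f]-[x_0,\dots,x_{m-1};f]}{x_{m}-x_0}.$$ A function $f$ on an interval is called $m$-convex (resp. $m$-concave) if $[x_0,\dots,x_{m+1};f]\ge 0$ (resp. $\le 0$) for all pairwise distinct $x_0,\dots,x_{m+1}$ in it. A function $f\colon\mathbf I\to\mathbb R$ is called box-$\mathbf n$-convex if, for all $(x_{i0},\dots,x_{in_i})\in I_i^{n_i+1}$ with pairwise distinct coordinates $(i=1,\dots,d)$, the number obtained from $f$ by taking the divided difference $[x_{i0},\dots,x_{in_i};\,\cdot\,]$ in the $i$-th variable successively for $i=1,\dots,d$ is nonnegative. For a finite signed Borel measure $\gamma$ on an interval $I$ write $\gamma\ge_{m\text{-cx}}0$ (resp. $\gamma\ge_{m\text{-cv}}0$) if $\int_I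 f\,d\gamma\ge 0$ for every $m$-convex (resp. $m$-concave) function $f\colon I\to\mathbb R$ that is integrable with respect to $|\gamma|$. Put $(y)_+^k=y^k$ for $y\ge 0$ and $(y)_+^k=0$ for $y<0$, with $0^0=1$. **Theorem.** For $i=1,\dots,d$ let $\gamma_i$ be a nonzero finite signed Borel measure on $I_i$ with $\int_{I_i}|x|^{n_i-1}\,d|\gamma_i|(x)<\infty$. The following three conditions are equivalent. 1. $\displaystyle\int_{\mathbf I} f\,d(\gamma_1\otimes\dots\otimes\gamma_d)\ge 0$ for every continuous box-$\mathbf n$-convex function $f\colon\mathbf I\to\mathbb R$ that is integrable with respect to $|\gamma_1\otimes\dots\otimes\gamma_d|$. 2. (a) For every $j=1,\dots,d$, either $\gamma_j\ge_{(n_j-1)\text{-cx}}0$ or $\gamma_j\ge_{(n_j-1)\text{-cv}}0$; and (b) the number of those $j$ for which $\gamma_j\ge_{(n_j-1)\text{-cv}}0$ is even. 3. (a) $\displaystyle\int_{I_i}x^k\,d\gamma_i(x)=0$ for all $i=1,\dots,d$ and $k=0,1,\dots,n_i-1$; and (b) $\displaystyle\prod_{j=1}^d\int_{I_j}\frac{(x-u_j)_+^{n_j-1}}{(n_j-1)!}\,d\gamma_j(x)\ge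 0$ for all $(u_1,\dots,u_d)\in\mathbf I$. -/

import Mathlib

open MeasureTheory

namespace BoxConvexity

/-- The divided difference `[x₀, …, xₙ; f]` of a function `f` on `I ⊆ ℝ`
(meaningful for pairwise distinct nodes). -/
noncomputable def dividedDiff {I : Set ℝ} (f : I → ℝ) : (n : ℕ) → (Fin (n + 1) → I) → ℝ
  | 0, x => f (x 0)
  | n + 1, x =>
      (dividedDiff f n (fun k => x k.succ) - dividedDiff f n (fun k => x k.castSucc)) /
        ((x (Fin.last (n + 1)) : ℝ) - (x 0 : ℝ))

/-- `f` is `n`-convex: all divided differences on `n + 2` distinct points are nonnegative. -/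
def IsNConvex {I : Set ℝ} (n : ℕ) (f : I → ℝ) : Prop :=
  ∀ x : Fin (n + 2) → I, Function.Injective x → 0 ≤ dividedDiff f (n + 1) x

/-- `f` is `n`-concave: all divided differences on `n + 2` distinct points are nonpositive. -/
def IsNConcave {I : Set ℝ} (n : ℕ) (f : I → ℝ) : Prop :=
  ∀ x : Fin (n + 2) → I, Function.Injective x → dividedDiff f (n + 1) x ≤ 0

/-- The multiple divided difference of order `(n₁, …, n_d)` of a function on `I₁ × ⋯ × I_d`:
the one-dimensional divided differences are applied to the successive variables. -/
noncomputable def multiDividedDiff : {d : ℕ} → (I : Fin d → Set ℝ) → (n : Fin d → ℕ) →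
    ((i : Fin d) → Fin (n i + 1) → I i) → (((i : Fin d) → I i) → ℝ) → ℝ
  | 0, _, _, _, f => f (fun i => i.elim0)
  | d + 1, I, n, x, f =>
      dividedDiff (I := I (Fin.last d))
        (fun t => multiDividedDiff (fun i : Fin d => I i.castSucc) (fun i => n i.castSucc)
          (fun i => x i.castSucc)
          (fun y => f (Fin.snoc (α := fun i => I i) y t)))
        (n (Fin.last d)) (x (Fin.last d))

/-- `f` is box-`(n₁, …, n_d)`-convex on `I₁ × ⋯ × I_d`. -/
def IsBoxConvex {d : ℕ} (I : Fin d → Set ℝ) (n : Fin d → ℕ)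
    (f : ((i : Fin d) → I i) → ℝ) : Prop :=
  ∀ x : (i : Fin d) → Fin (n i + 1) → I i, (∀ i, Function.Injective (x i)) →
    0 ≤ multiDividedDiff I n x f

/-- `γ ≥ 0` in the `n`-convex order. -/
def CxNonneg {I : Set ℝ} (n : ℕ) (γ : SignedMeasure I) : Prop :=
  ∀ f : I → ℝ, IsNConvex n f → γ.Integrable f → 0 ≤ ∫ᵛ x, f x ∂•γ

/-- `γ ≥ 0` in the `n`-concave order. -/
def CvNonneg {I : Set ℝ} (n : ℕ) (γ : SignedMeasure I) : Prop :=
  ∀ f : I → ℝ, IsNConcave n f → γ.Integrable f → 0 ≤ ∫ᵛ x, f x ∂•γ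

/-- The truncated power `y₊ᵏ`, with `0⁰ = 1` and with value `0` for `y < 0` (also if `k = 0`). -/
noncomputable def truncPow (k : ℕ) (y : ℝ) : ℝ := if 0 ≤ y then y ^ k else 0

/-- For `s ⊆ {1, …, d}`, the product of the negative parts `γᵢ⁻` (`i ∈ s`) and the positive
parts `γᵢ⁺` (`i ∉ s`) of the Jordan decompositions. -/
noncomputable def partsPi {d : ℕ} {X : Fin d → Type*} [∀ i, MeasurableSpace (X i)]
    (γ : (i : Fin d) → SignedMeasure (X i)) (s : Finset (Fin d)) : Measure ((i : Fin d) → X i) :=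
  Measure.pi fun i => if i ∈ s then (γ i).toJordanDecomposition.negPart
    else (γ i).toJordanDecomposition.posPart

instance isFiniteMeasure_part {d : ℕ} {X : Fin d → Type*} [∀ i, MeasurableSpace (X i)]
    (γ : (i : Fin d) → SignedMeasure (X i)) (s : Finset (Fin d)) (i : Fin d) :
    IsFiniteMeasure (if i ∈ s then (γ i).toJordanDecomposition.negPart
      else (γ i).toJordanDecomposition.posPart) := by
  split <;> infer_instance

instance isFiniteMeasure_partsPi {d : ℕ} {X : Fin d → Type*} [∀ i, MeasurableSpace (X i)]
    (γ : (i : Fin d) → SignedMeasure (X i)) (s : Finset (Fin d)) :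
    IsFiniteMeasure (partsPi γ s) := by
  unfold partsPi; infer_instance

/-- The product signed measure `γ₁ ⊗ ⋯ ⊗ γ_d`, obtained by multiplying out the Jordan
decompositions `γᵢ = γᵢ⁺ - γᵢ⁻`. -/
noncomputable def signedPi {d : ℕ} {X : Fin d → Type*} [∀ i, MeasurableSpace (X i)]
    (γ : (i : Fin d) → SignedMeasure (X i)) : SignedMeasure ((i : Fin d) → X i) :=
  ∑ s : Finset (Fin d), (-1 : ℝ) ^ s.card • (partsPi γ s).toSignedMeasure

/-- `signedPi γ` is the product measure: it has the right values on measurable boxes. -/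
theorem signedPi_apply_pi {d : ℕ} {X : Fin d → Type*} [∀ i, MeasurableSpace (X i)]
    (γ : (i : Fin d) → SignedMeasure (X i)) (t : (i : Fin d) → Set (X i))
    (ht : ∀ i, MeasurableSet (t i)) :
    signedPi γ (Set.univ.pi t) = ∏ i, γ i (t i) := by
  have hm : MeasurableSet (Set.univ.pi t) := MeasurableSet.univ_pi ht
  simp_rw [fun i => (γ i).apply_eq_posPart_real_sub_negPart_real (ht i)]
  rw [Finset.prod_sub, Finset.powerset_univ, signedPi, FunLike.coe_sum, Finset.sum_apply]
  refine Finset.sum_congr rfl fun s _ => ?_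
  rw [FunLike.coe_smul, Pi.smul_apply, smul_eq_mul,
    Measure.toSignedMeasure_apply_measurable hm, mul_assoc]
  congr 1
  rw [measureReal_def, partsPi, Measure.pi_pi, ENNReal.toReal_prod, mul_comm,
    ← Finset.prod_mul_prod_compl s, Finset.compl_eq_univ_sdiff]
  congr 1
  · exact Finset.prod_congr rfl fun i hi => by rw [if_pos hi, measureReal_def]
  · exact Finset.prod_congr rfl fun i hi => by
      rw [if_neg (Finset.mem_sdiff.1 hi).2, measureReal_def]

end BoxConvexity

/-! Write `m i = n i - 1`. The implications run 1 ⇒ 3 ⇒ 2 ⇒ 1.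

For 1 ⇒ 3, test with products of one-variable functions, whose multiple divided differences factor.
Multiples `±xᵏ` in one slot and suitable continuous functions in the others force the moments to
vanish; continuous approximations of truncated powers give the product inequality.

For 3 ⇒ 2, let `H_j(u)` be the integral of `(x - u)₊^(m j)` against `γ j`. Vanishing moments
together with `H_j = 0` would force `γ j = 0` (`NonnegDensity.measure_eq_zero`), so `H_j(w_j) ≠ 0`
for some `w_j`. Varying one coordinate of `w` in the product inequality shows that each `H_j` has
constant sign, and the inequality at `w` makes the number of negative signs even. A constant sign of
`H_j` yields the one-dimensional order by `NonnegDensity.integral_nonneg`.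

The hard part is 2 ⇒ 1. An even number of sign changes does not alter the product, so every `γ i`
may be taken nonnegative in the convex order. As its moments up to order `m i` vanish, subtracting
from `f` a Lagrange interpolant in `x i` changes neither the integral nor the multiple divided
differences. Hence `f` may be assumed to vanish whenever some `x i` lies in a set `C i` of `m i + 1`
nodes. The divided difference at `C i ∪ {y i}` in all but the last variable then sees only the point
`y`, so each section `f(y, ·)` is `m`-convex up to sign, with known zeros
(`IsBoxConvex.mconvexUpToSign`). Such sections obey bounds with constants independent of `y`.

These bounds justify replacing `f` in the last variable by its Bernstein polynomial on a segment
`[a, b]`, continued outside by Taylor polynomials of degree `m`. For an `m`-convex function this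
approximant is a polynomial of degree at most `m` plus a nonnegative mixture of truncated powers, so
its integral is nonnegative. It uses only finitely many values, so integration in the last variable
is approximated by a finite functional that is nonnegative on `m`-convex functions
(`exists_discrete_approx`). Applied to `f`, this functional leaves a continuous box-convex function
of one variable fewer, and induction on `d` finishes the proof. -/

namespace BoxConvexity

/-! ### Divided differences in Lagrange form -/

section DividedDifferences

variable {ι : Type*} [DecidableEq ι]

/-- The divided difference of `f` at the nodes `v i`, `i ∈ s`, in Lagrange form. -/
noncomputable def dd (v : ι → ℝ) (s : Finset ι) (f : ι → ℝ) : ℝ :=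
  ∑ i ∈ s, Lagrange.nodalWeight s v i * f i

variable {v : ι → ℝ} {s : Finset ι} {f g : ι → ℝ}

theorem dd_add : dd v s (fun i => f i + g i) = dd v s f + dd v s g := by
  simp [dd, mul_add, Finset.sum_add_distrib]

theorem dd_sub : dd v s (fun i => f i - g i) = dd v s f - dd v s g := by
  simp [dd, mul_sub, Finset.sum_sub_distrib]

theorem dd_const_mul (c : ℝ) : dd v s (fun i => c * f i) = c * dd v s f := by
  simp only [dd, Finset.mul_sum]
  exact Finset.sum_congr rfl fun i _ => by ring

theorem dd_neg : dd v s (fun i => -f i) = -dd v s f := by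
  simp [dd]

theorem dd_sum {β : Type*} (t : Finset β) (F : β → ι → ℝ) :
    dd v s (fun i => ∑ b ∈ t, F b i) = ∑ b ∈ t, dd v s (F b) := by
  simp only [dd, Finset.mul_sum]
  exact Finset.sum_comm

theorem dd_congr (h : ∀ i ∈ s, f i = g i) : dd v s f = dd v s g :=
  Finset.sum_congr rfl fun i hi => by rw [h i hi]

theorem dd_singleton (a : ι) : dd v {a} f = f a := by
  simp [dd, Lagrange.nodalWeight]

theorem nodalWeight_insert_of_mem {a i : ι} (ha : a ∉ s) (hi : i ∈ s) :
    Lagrange.nodalWeight (insert a s) v i = (v i - v a)⁻¹ * Lagrange.nodalWeight s v i := by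
  have hia : i ≠ a := fun h => ha (h ▸ hi)
  rw [Lagrange.nodalWeight, Finset.erase_insert_of_ne hia.symm, Finset.prod_insert, Lagrange.nodalWeight]
  exact fun h => ha (Finset.mem_of_mem_erase h)

theorem nodalWeight_insert_self {a : ι} (ha : a ∉ s) :
    Lagrange.nodalWeight (insert a s) v a = ∏ j ∈ s, (v a - v j)⁻¹ := by
  rw [Lagrange.nodalWeight, Finset.erase_insert ha]

theorem dd_insert {a : ι} (ha : a ∉ s) :
    dd v (insert a s) f = (∏ j ∈ s, (v a - v j)⁻¹) * f a +
      ∑ i ∈ s, (v i - v a)⁻¹ * Lagrange.nodalWeight s v i * f i := by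
  rw [dd, Finset.sum_insert ha, nodalWeight_insert_self ha]
  congr 1
  exact Finset.sum_congr rfl fun i hi => by rw [nodalWeight_insert_of_mem ha hi]

theorem dd_insert_of_eq_zero {a : ι} (ha : a ∉ s) (hf : ∀ i ∈ s, f i = 0) :
    dd v (insert a s) f = (∏ j ∈ s, (v a - v j))⁻¹ * f a := by
  rw [dd_insert ha, Finset.sum_eq_zero, add_zero, Finset.prod_inv_distrib]
  exact fun i hi => by rw [hf i hi, mul_zero]

/-- Partial fractions: on the common nodes, `1 / ((x - a) (x - b))` times `a - b` is a difference of
the two weights. This is the defining recursion, now free of any ordering of the nodes. -/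
theorem dd_insert_insert (hv : Function.Injective v) {a b : ι} (hab : a ≠ b) (ha : a ∉ s)
    (hb : b ∉ s) :
    (v a - v b) * dd v (insert a (insert b s)) f = dd v (insert a s) f - dd v (insert b s) f := by
  have ha' : a ∉ insert b s := by simp [hab, ha]
  have h1 : v a - v b ≠ 0 := sub_ne_zero.2 (hv.ne hab)
  have h2 : v b - v a ≠ 0 := sub_ne_zero.2 (hv.ne hab.symm)
  rw [dd_insert ha', dd_insert ha, dd_insert hb, Finset.prod_insert hb, Finset.sum_insert hb,
    nodalWeight_insert_self hb]
  have key : ∑ i ∈ s, (v i - v a)⁻¹ * Lagrange.nodalWeight (insert b s) v i * f i * (v a - v b) =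
      ∑ i ∈ s, (v i - v a)⁻¹ * Lagrange.nodalWeight s v i * f i -
      ∑ i ∈ s, (v i - v b)⁻¹ * Lagrange.nodalWeight s v i * f i := by
    rw [← Finset.sum_sub_distrib]
    refine Finset.sum_congr rfl fun i hi => ?_
    rw [nodalWeight_insert_of_mem hb hi]
    have h3 : v i - v a ≠ 0 := sub_ne_zero.2 (hv.ne fun h => ha (h ▸ hi))
    have h4 : v i - v b ≠ 0 := sub_ne_zero.2 (hv.ne fun h => hb (h ▸ hi))
    field_simp
    ring
  rw [← Finset.sum_mul] at key
  linear_combination key + (∏ j ∈ s, (v a - v j)⁻¹) * f a * mul_inv_cancel₀ h1 +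
    (∏ j ∈ s, (v b - v j)⁻¹) * f b * (-1) * (mul_inv_cancel₀ h2)

theorem dd_erase_sub_erase (hv : Function.Injective v) {a b : ι} (hab : a ≠ b) (ha : a ∈ s)
    (hb : b ∈ s) : (v a - v b) * dd v s f = dd v (s.erase b) f - dd v (s.erase a) f := by
  have h := dd_insert_insert (f := f) (s := (s.erase a).erase b) hv hab (by simp) (by simp)
  rw [Finset.insert_erase (Finset.mem_erase.2 ⟨hab.symm, hb⟩), Finset.insert_erase ha,
    Finset.erase_right_comm, Finset.insert_erase (Finset.mem_erase.2 ⟨hab, ha⟩)] at h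
  exact h

/-- A divided difference on `s` is the coefficient of degree `s.card - 1` of the interpolating
polynomial, and `P` interpolates itself. -/
theorem dd_eval_eq_zero (hv : Function.Injective v) {P : Polynomial ℝ}
    (hP : P.natDegree + 1 < s.card) : dd v s (fun i => P.eval (v i)) = 0 := by
  have hdeg : P.degree < s.card := by
    refine lt_of_le_of_lt Polynomial.degree_le_natDegree ?_
    exact_mod_cast Nat.lt_of_succ_lt hP
  have h := Lagrange.coeff_eq_sum (hv.injOn (s := (s : Set ι))) hdeg
  rw [Polynomial.coeff_eq_zero_of_natDegree_lt (by omega)] at h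
  rw [h, dd]
  refine Finset.sum_congr rfl fun i hi => ?_
  rw [Lagrange.nodalWeight, Finset.prod_inv_distrib, div_eq_inv_mul]

theorem dd_pow_eq_zero (hv : Function.Injective v) {k : ℕ} (hk : k + 1 < s.card) :
    dd v s (fun i => v i ^ k) = 0 := by
  have := dd_eval_eq_zero (s := s) hv (P := Polynomial.X ^ k) (by simpa using hk)
  simpa using this

theorem dd_neg_nodes : dd (fun i => -v i) s f = (-1) ^ (s.card - 1) * dd v s f := by
  rw [dd, dd, Finset.mul_sum]
  refine Finset.sum_congr rfl fun i hi => ?_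
  rw [← mul_assoc, Lagrange.nodalWeight, Lagrange.nodalWeight, ← Finset.card_erase_of_mem hi,
    ← Finset.prod_const, ← Finset.prod_mul_distrib]
  congr 1
  refine Finset.prod_congr rfl fun j _ => ?_
  rw [neg_one_mul, ← inv_neg]
  congr 1
  ring

/-- `f` is `m`-convex as a function of `v i`. -/
def MConvex (v : ι → ℝ) (m : ℕ) (f : ι → ℝ) : Prop :=
  ∀ s : Finset ι, s.card = m + 2 → 0 ≤ dd v s f

end DividedDifferences

/-! ### Recursive divided differences agree with the Lagrange form -/

section Subtype

variable {I : Set ℝ}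

/-- The two lower-order differences share the interior nodes `M`, so the recursion is an instance of
`dd_insert_insert`. Afterwards only the set of nodes matters. -/
theorem dividedDiff_eq_dd (f : I → ℝ) (n : ℕ) (x : Fin (n + 1) → I) (hx : Function.Injective x) :
    dividedDiff f n x = dd (fun t : I => (t : ℝ)) (Finset.univ.image x) f := by
  induction n with
  | zero => simp [dividedDiff, dd_singleton]
  | succ n ih =>
    rw [dividedDiff, ih (fun k => x k.succ) (hx.comp (Fin.succ_injective _)),
      ih (fun k => x k.castSucc) (hx.comp (Fin.castSucc_injective _))]
    set M : Finset I := Finset.univ.image fun k : Fin n => x k.succ.castSucc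
    have h0 : x 0 ∉ M := by
      simp only [M, Finset.mem_image, Finset.mem_univ, true_and, not_exists]
      intro k hk
      have := hx hk
      simp [Fin.ext_iff] at this
    have h1 : x (Fin.last (n + 1)) ∉ M := by
      simp only [M, Finset.mem_image, Finset.mem_univ, true_and, not_exists]
      intro k hk
      have := hx hk
      simp [Fin.ext_iff] at this
      omega
    have h01 : x (Fin.last (n + 1)) ≠ x 0 := hx.ne (by simp [Fin.ext_iff])
    have e1 : Finset.univ.image (fun k : Fin (n + 1) => x k.succ) =
        insert (x (Fin.last (n + 1))) M := by
      ext t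
      simp only [Finset.mem_image, Finset.mem_univ, true_and, Finset.mem_insert, M,
        Fin.exists_fin_succ', Fin.succ_last, Fin.succ_castSucc]
      grind
    have e2 : Finset.univ.image (fun k : Fin (n + 1) => x k.castSucc) = insert (x 0) M := by
      ext t
      simp only [Finset.mem_image, Finset.mem_univ, true_and, Finset.mem_insert, M,
        Fin.exists_fin_succ, Fin.castSucc_zero]
      grind
    have e3 : Finset.univ.image x = insert (x (Fin.last (n + 1))) (insert (x 0) M) := by
      rw [← e2]
      ext t
      simp only [Finset.mem_image, Finset.mem_univ, true_and, Finset.mem_insert,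
        Fin.exists_fin_succ' (n := n + 1)]
      grind
    rw [e1, e2, e3, ← dd_insert_insert Subtype.val_injective h01 h1 h0, mul_div_cancel_left₀]
    exact sub_ne_zero.2 (Subtype.val_injective.ne h01)

theorem exists_image_eq {α : Type*} [DecidableEq α] (s : Finset α) {n : ℕ} (hs : s.card = n) :
    ∃ x : Fin n → α, Function.Injective x ∧ Finset.univ.image x = s := by
  subst hs
  refine ⟨fun k => s.equivFin.symm k, fun a b h => ?_, ?_⟩
  · exact s.equivFin.symm.injective (Subtype.ext h)
  · ext t
    simp only [Finset.mem_image, Finset.mem_univ, true_and]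
    constructor
    · rintro ⟨k, rfl⟩
      exact (s.equivFin.symm k).2
    · exact fun ht => ⟨s.equivFin ⟨t, ht⟩, by simp⟩

theorem isNConvex_iff (m : ℕ) (f : I → ℝ) :
    IsNConvex m f ↔ MConvex (fun t : I => (t : ℝ)) m f := by
  constructor
  · intro h s hs
    obtain ⟨x, hx, rfl⟩ := exists_image_eq s hs
    rw [← dividedDiff_eq_dd f (m + 1) x hx]
    exact h x hx
  · intro h x hx
    rw [dividedDiff_eq_dd f (m + 1) x hx]
    exact h _ (by rw [Finset.card_image_of_injective _ hx, Finset.card_fin])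

theorem isNConcave_iff (m : ℕ) (f : I → ℝ) :
    IsNConcave m f ↔ MConvex (fun t : I => (t : ℝ)) m (fun t => -f t) := by
  constructor
  · intro h s hs
    obtain ⟨x, hx, rfl⟩ := exists_image_eq s hs
    rw [dd_neg, ← dividedDiff_eq_dd f (m + 1) x hx]
    exact neg_nonneg.2 (h x hx)
  · intro h x hx
    have := h (Finset.univ.image x) (by rw [Finset.card_image_of_injective _ hx, Finset.card_fin])
    rw [dd_neg, ← dividedDiff_eq_dd f (m + 1) x hx] at this
    exact neg_nonneg.1 this

end Subtype

/-! ### Bounds for `m`-convex functions with `m + 1` prescribed zeros -/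

section Vanishing

variable {ι : Type*} [DecidableEq ι] {v : ι → ℝ} {m : ℕ} {f : ι → ℝ} {C : Finset ι}

/-- Transfers estimates to the right of the zeros to estimates on their left. -/
theorem MConvex.reflect (h : MConvex v m f) :
    MConvex (fun i => -v i) m (fun i => (-1) ^ (m + 1) * f i) := by
  intro s hs
  rw [dd_const_mul, dd_neg_nodes, hs, ← mul_assoc, show m + 2 - 1 = m + 1 by omega, ← mul_pow]
  simpa using h s hs

/-- Divided differences of order at most `m + 1` with some nodes in `C` and the others to the right
of `C` are nonnegative. -/
theorem dd_union_nonneg (hv : Function.Injective v) (hf : MConvex v m f) (hC : C.card = m + 1)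
    (h0 : ∀ c ∈ C, f c = 0) (r : ℕ) : ∀ s D : Finset ι, D ⊆ C → (∀ x ∈ s, ∀ c ∈ C, v c < v x) →
    s.card + D.card ≤ m + 2 → (m + 2 - (s.card + D.card)) + s.card = r →
    0 ≤ dd v (s ∪ D) f := by
  induction r with
  | zero =>
    intro s D hD hs hle hr
    obtain rfl : s = ∅ := Finset.card_eq_zero.1 (by omega)
    rw [Finset.empty_union, dd, Finset.sum_eq_zero]
    exact fun i hi => by rw [h0 i (hD hi), mul_zero]
  | succ r ih =>
    intro s D hD hs hle hr
    have hsC : ∀ x ∈ s, x ∉ C := fun x hx hxC => lt_irrefl _ (hs x hx x hxC)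
    rcases s.eq_empty_or_nonempty with rfl | ⟨x, hx⟩
    · rw [Finset.empty_union, dd, Finset.sum_eq_zero]
      exact fun i hi => by rw [h0 i (hD hi), mul_zero]
    rcases hle.eq_or_lt with heq | hlt
    · apply hf
      rw [Finset.card_union_of_disjoint, heq]
      exact Finset.disjoint_left.2 fun i hi hi' => hsC i hi (hD hi')
    · have hpos : 0 < s.card := Finset.card_pos.2 ⟨x, hx⟩
      obtain ⟨c, hcC, hcD⟩ : ∃ c ∈ C, c ∉ D :=
        Finset.exists_mem_notMem_of_card_lt_card (by omega)
      have hxc := hs x hx c hcC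
      have hcs : c ∉ s := fun h => hsC c h hcC
      have hxD : x ∉ D := fun h => hsC x hx (hD h)
      -- Trade `x` for an unused zero `c`: the difference on `s ∪ D` is a nonnegative multiple of
      -- one with an extra node plus one with `x` replaced by `c`. Both have a smaller value of the
      -- induction measure.
      have e := dd_insert_insert (f := f) (s := s.erase x ∪ D) (a := x) (b := c) hv
        (fun h => hsC x hx (h ▸ hcC)) (by simp [hxD]) (by simp [hcD, hcs])
      have e1 : insert x (s.erase x ∪ D) = s ∪ D := by
        rw [← Finset.insert_union, Finset.insert_erase hx]
      have e2 : insert c (s.erase x ∪ D) = s.erase x ∪ insert c D := by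
        rw [Finset.union_insert]
      have e3 : insert x (insert c (s.erase x ∪ D)) = s ∪ insert c D := by
        rw [e2, ← Finset.insert_union, Finset.insert_erase hx]
      rw [e1, e3, e2] at e
      have hcard : (insert c D).card = D.card + 1 := Finset.card_insert_of_notMem hcD
      have hcard' : (s.erase x).card = s.card - 1 := Finset.card_erase_of_mem hx
      have i1 := ih s (insert c D) (Finset.insert_subset hcC hD) hs (by omega) (by omega)
      have i2 := ih (s.erase x) (insert c D) (Finset.insert_subset hcC hD)
        (fun y hy => hs y (Finset.mem_of_mem_erase hy)) (by omega) (by omega)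
      have := mul_nonneg (sub_nonneg.2 hxc.le) i1
      linarith

theorem dd_nonneg_of_right (hv : Function.Injective v) (hf : MConvex v m f) (hC : C.card = m + 1)
    (h0 : ∀ c ∈ C, f c = 0) {s : Finset ι} (hs : ∀ x ∈ s, ∀ c ∈ C, v c < v x)
    (hcard : s.card ≤ m + 2) : 0 ≤ dd v s f := by
  have := dd_union_nonneg hv hf hC h0 _ s ∅ (Finset.empty_subset _) hs (by simpa using hcard) rfl
  rwa [Finset.union_empty] at this

theorem nonneg_of_right (hv : Function.Injective v) (hf : MConvex v m f) (hC : C.card = m + 1)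
    (h0 : ∀ c ∈ C, f c = 0) {t : ι} (ht : ∀ c ∈ C, v c < v t) : 0 ≤ f t := by
  rw [← dd_singleton (v := v) (f := f) t]
  exact dd_nonneg_of_right hv hf hC h0 (by simpa using ht) (by simp)

theorem le_of_right (hv : Function.Injective v) (hf : MConvex v m f) (hC : C.card = m + 1)
    (h0 : ∀ c ∈ C, f c = 0) {t b : ι} (ht : ∀ c ∈ C, v c < v t) (htb : v t ≤ v b) :
    f t ≤ f b := by
  rcases htb.eq_or_lt with h | h
  · rw [hv h]
  have hne : b ≠ t := fun h' => by simp [h'] at h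
  have e := dd_insert_insert (f := f) (s := ∅) hv hne (by simp) (by simp)
  simp only [insert_empty_eq, dd_singleton] at e
  have : 0 ≤ dd v {b, t} f := by
    refine dd_nonneg_of_right hv hf hC h0 ?_ ?_
    · simp only [Finset.mem_insert, Finset.mem_singleton, forall_eq_or_imp, forall_eq]
      exact ⟨fun c hc => (ht c hc).trans h, ht⟩
    · exact Finset.card_le_two.trans (by omega)
  have := mul_nonneg (sub_nonneg.2 h.le) this
  linarith

theorem abs_eq_dd_mul_prod (hv : Function.Injective v) {t : ι} (ht : t ∉ C)
    (h0 : ∀ c ∈ C, f c = 0) :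
    |f t| = |dd v (insert t C) f| * ∏ c ∈ C, |v t - v c| := by
  have hp : ∏ c ∈ C, (v t - v c) ≠ 0 :=
    Finset.prod_ne_zero_iff.2 fun c hc => sub_ne_zero.2 (hv.ne fun h => ht (h ▸ hc))
  rw [dd_insert_of_eq_zero ht h0, ← Finset.abs_prod, ← abs_mul, mul_comm, ← mul_assoc,
    mul_inv_cancel₀ hp, one_mul]

/-- Between a point `a` to the left of the zeros and the largest zero `c₁`, an `m`-convex function
is bounded by a multiple of its value at `a`. -/
theorem abs_mul_prod_le (hv : Function.Injective v) (hf : MConvex v m f) (hC : C.card = m + 1)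
    (h0 : ∀ c ∈ C, f c = 0) {a t c₁ : ι} (hc₁ : c₁ ∈ C) (hmax : ∀ c ∈ C, v c ≤ v c₁)
    (ha : ∀ c ∈ C, v a < v c) (hat : v a ≤ v t) (htc : v t ≤ v c₁) :
    |f t| * ∏ c ∈ C, |v a - v c| ≤ |f a| * (v c₁ - v a) ^ (m + 1) := by
  have hL : 0 < v c₁ - v a := sub_pos.2 (ha c₁ hc₁)
  by_cases htC : t ∈ C
  · rw [h0 t htC, abs_zero, zero_mul]
    positivity
  have haC : a ∉ C := fun h => lt_irrefl _ (ha a h)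
  rcases hat.eq_or_lt with hat | hat
  · rw [hv hat, ← hC]
    rw [← Finset.prod_const]
    refine mul_le_mul_of_nonneg_left (Finset.prod_le_prod (fun _ _ => abs_nonneg _)
      fun c hc => ?_) (abs_nonneg _)
    rw [abs_le, ← hat]
    constructor <;> linarith [ha c hc, hmax c hc]
  have htc' : v t < v c₁ := lt_of_le_of_ne htc fun h => htC (hv h ▸ hc₁)
  have hne : a ≠ t := fun h => by simp [h] at hat
  set Z := insert a (insert t C) with hZ
  have hcZ : c₁ ∈ Z := by simp [hZ, hc₁]
  have haZ : a ∈ Z := by simp [hZ]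
  have htZ : t ∈ Z := by simp [hZ]
  have ea : Z.erase a = insert t C := Finset.erase_insert (by simp [hne, haC])
  have et : Z.erase t = insert a C := by
    rw [hZ, Finset.insert_comm, Finset.erase_insert (by simp [hne.symm, htC])]
  have cZ : Z.card = m + 3 := by
    rw [hZ, Finset.card_insert_of_notMem (by simp [hne, haC]), Finset.card_insert_of_notMem htC, hC]
  have hE : 0 ≤ dd v (Z.erase c₁) f := hf _ (by rw [Finset.card_erase_of_mem hcZ, cZ]; rfl)
  have h1 := dd_erase_sub_erase (f := f) hv (a := a) (b := c₁) (fun h => haC (h ▸ hc₁)) haZ hcZ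
  have h2 := dd_erase_sub_erase (f := f) hv (a := t) (b := c₁) (fun h => htC (h ▸ hc₁)) htZ hcZ
  rw [ea] at h1
  rw [et] at h2
  have hDt : 0 ≤ dd v (insert t C) f := hf _ (by rw [Finset.card_insert_of_notMem htC, hC])
  have hDa : 0 ≤ dd v (insert a C) f := hf _ (by rw [Finset.card_insert_of_notMem haC, hC])
  -- Eliminating the difference on `Z` from `h1` and `h2` leaves a comparison through the single
  -- nonnegative difference on `Z.erase c₁`.
  have hmain : dd v (insert t C) f * (v c₁ - v t) ≤ dd v (insert a C) f * (v c₁ - v a) := by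
    have : dd v (Z.erase c₁) f * (v c₁ - v t) ≤ dd v (Z.erase c₁) f * (v c₁ - v a) :=
      mul_le_mul_of_nonneg_left (by linarith) hE
    linear_combination this + (v c₁ - v t) * h1 - (v c₁ - v a) * h2
  have hbound : ∀ c ∈ C, |v t - v c| ≤ v c₁ - v a := fun c hc => by
    rw [abs_le]
    constructor <;> linarith [ha c hc, hmax c hc]
  -- The factor belonging to `c₁` is kept exactly, because `hmain` supplies the matching `v c₁ - v
  -- t`; the other `m` factors are bounded crudely.
  have hprod : ∏ c ∈ C, |v t - v c| ≤ (v c₁ - v t) * (v c₁ - v a) ^ m := by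
    rw [← Finset.mul_prod_erase _ _ hc₁, abs_sub_comm, abs_of_pos (sub_pos.2 htc')]
    refine mul_le_mul_of_nonneg_left ?_ (sub_pos.2 htc').le
    refine (Finset.prod_le_prod (fun _ _ => abs_nonneg _)
      fun c hc => hbound c (Finset.mem_of_mem_erase hc)).trans ?_
    rw [Finset.prod_const, Finset.card_erase_of_mem hc₁, hC, Nat.add_sub_cancel]
  rw [abs_eq_dd_mul_prod hv htC h0, abs_eq_dd_mul_prod hv haC h0, abs_of_nonneg hDt,
    abs_of_nonneg hDa]
  set Q := ∏ c ∈ C, |v a - v c|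
  have hQ : 0 ≤ Q := Finset.prod_nonneg fun _ _ => abs_nonneg _
  calc dd v (insert t C) f * (∏ c ∈ C, |v t - v c|) * Q
      ≤ dd v (insert t C) f * ((v c₁ - v t) * (v c₁ - v a) ^ m) * Q := by gcongr
    _ = dd v (insert t C) f * (v c₁ - v t) * ((v c₁ - v a) ^ m * Q) := by ring
    _ ≤ dd v (insert a C) f * (v c₁ - v a) * ((v c₁ - v a) ^ m * Q) := by gcongr
    _ = dd v (insert a C) f * Q * (v c₁ - v a) ^ (m + 1) := by ring

/-- To the right of its zeros an `m`-convex function dominates its damped Taylor-like polynomials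
built from nodes to the left of the argument. -/
theorem newton_bound (hv : Function.Injective v) (hf : MConvex v m f) (hC : C.card = m + 1)
    (h0 : ∀ c ∈ C, f c = 0) (x : ℕ → ι) (hxi : Set.InjOn x (Set.Iic m)) {b t : ι}
    (hxC : ∀ k ≤ m, ∀ c ∈ C, v c < v (x k)) (hxb : ∀ k ≤ m, v (x k) ≤ v b) (hbt : v b < v t)
    (lam : ℕ → ℝ) (hl0 : ∀ k ≤ m, 0 ≤ lam k) (hl1 : ∀ k ≤ m, lam k ≤ 1) :
    0 ≤ ∑ k ∈ Finset.range (m + 1), lam k * dd v ((Finset.range (k + 1)).image x) f *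
        (v t - v b) ^ k ∧
    ∑ k ∈ Finset.range (m + 1), lam k * dd v ((Finset.range (k + 1)).image x) f *
        (v t - v b) ^ k ≤ f t := by
  have hd : ∀ k ≤ m, 0 ≤ dd v ((Finset.range (k + 1)).image x) f := by
    intro k hk
    refine dd_nonneg_of_right hv hf hC h0 ?_ ?_
    · intro y hy
      obtain ⟨l, hl, rfl⟩ := Finset.mem_image.1 hy
      exact hxC l (by have := Finset.mem_range.1 hl; omega)
    · refine Finset.card_image_le.trans ?_
      rw [Finset.card_range]; omega
  have htb : 0 ≤ v t - v b := (sub_pos.2 hbt).le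
  -- Newton's interpolation formula with remainder, at the nodes `x 0, …, x (r - 1)`.
  have hsum : ∀ r ≤ m + 1, f t = ∑ k ∈ Finset.range r, dd v ((Finset.range (k + 1)).image x) f *
        ∏ l ∈ Finset.range k, (v t - v (x l)) +
      dd v (insert t ((Finset.range r).image x)) f * ∏ l ∈ Finset.range r, (v t - v (x l)) := by
    intro r hr
    induction r with
    | zero => simp [dd_singleton]
    | succ r ih =>
      rw [Finset.sum_range_succ, Finset.prod_range_succ]
      have hrt : t ≠ x r := fun h => by
        have := hxb r (by omega); rw [← h] at this; linarith
      have h1 : t ∉ (Finset.range r).image x := by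
        simp only [Finset.mem_image, not_exists, not_and, Finset.mem_range]
        intro k hk h
        have := hxb k (by omega); rw [h] at this; linarith
      have h2 : x r ∉ (Finset.range r).image x := by
        simp only [Finset.mem_image, not_exists, not_and, Finset.mem_range]
        exact fun k hk h => hk.ne (hxi (by simp; omega) (by simp; omega) h)
      have e := dd_insert_insert (f := f) hv hrt h1 h2
      rw [Finset.range_add_one, Finset.image_insert]
      rw [ih (by omega)]
      linear_combination (-(∏ l ∈ Finset.range r, (v t - v (x l)))) * e
  constructor
  · refine Finset.sum_nonneg fun k hk => ?_
    have hk' : k ≤ m := by have := Finset.mem_range.1 hk; omega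
    exact mul_nonneg (mul_nonneg (hl0 k hk') (hd k hk')) (pow_nonneg htb _)
  · rw [hsum (m + 1) le_rfl]
    have hfac : ∀ l ≤ m, v t - v b ≤ v t - v (x l) := fun l hl => by linarith [hxb l hl]
    have hrem : 0 ≤ dd v (insert t ((Finset.range (m + 1)).image x)) f *
        ∏ l ∈ Finset.range (m + 1), (v t - v (x l)) := by
      refine mul_nonneg (dd_nonneg_of_right hv hf hC h0 ?_ ?_) (Finset.prod_nonneg fun l hl => ?_)
      · intro y hy c hc
        rcases Finset.mem_insert.1 hy with rfl | hy
        · exact (hxC 0 (by omega) c hc).trans_le ((hxb 0 (by omega)).trans hbt.le)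
        · obtain ⟨l, hl, rfl⟩ := Finset.mem_image.1 hy
          exact hxC l (by have := Finset.mem_range.1 hl; omega) c hc
      · refine (Finset.card_insert_le _ _).trans ?_
        have := Finset.card_image_le (s := Finset.range (m + 1)) (f := x)
        rw [Finset.card_range] at this; omega
      · exact htb.trans (hfac l (by have := Finset.mem_range.1 hl; omega))
    -- All the divided differences are nonnegative, so damping the coefficients and lowering each
    -- factor `v t - v (x l)` to `v t - v b` only decreases the Newton sum.
    have : ∑ k ∈ Finset.range (m + 1), lam k * dd v ((Finset.range (k + 1)).image x) f *
        (v t - v b) ^ k ≤ ∑ k ∈ Finset.range (m + 1), dd v ((Finset.range (k + 1)).image x) f *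
        ∏ l ∈ Finset.range k, (v t - v (x l)) := by
      refine Finset.sum_le_sum fun k hk => ?_
      have hk' : k ≤ m := by have := Finset.mem_range.1 hk; omega
      have hp : (v t - v b) ^ k ≤ ∏ l ∈ Finset.range k, (v t - v (x l)) := by
        rw [← Finset.card_range k, ← Finset.prod_const, Finset.card_range]
        refine Finset.prod_le_prod (fun _ _ => htb) fun l hl => hfac l ?_
        have := Finset.mem_range.1 hl; omega
      refine mul_le_mul ?_ hp (pow_nonneg htb _) (hd k hk')
      exact mul_le_of_le_one_left (hd k hk') (hl1 k hk')
    linarith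

end Vanishing

/-! ### Bernstein polynomials and their Taylor extensions -/

section Bernstein

open Polynomial

/-- The Bernstein polynomial of degree `N` with coefficients `c`. -/
noncomputable def bern (N : ℕ) (c : ℕ → ℝ) : ℝ[X] :=
  ∑ k ∈ Finset.range (N + 1), C (c k) * bernsteinPolynomial ℝ N k

theorem derivative_bern (N : ℕ) (c : ℕ → ℝ) :
    derivative (bern (N + 1) c) = C ((N : ℝ) + 1) * bern N ((fwdDiff 1) c) := by
  have h1 : derivative (bern (N + 1) c) = ((N : ℝ[X]) + 1) *
      (∑ k ∈ Finset.range (N + 1), C (c (k + 1)) * bernsteinPolynomial ℝ N k -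
      (∑ k ∈ Finset.range (N + 1), C (c (k + 1)) * bernsteinPolynomial ℝ N (k + 1) +
        C (c 0) * bernsteinPolynomial ℝ N 0)) := by
    rw [bern, derivative_sum, Finset.sum_range_succ']
    simp only [derivative_C_mul, bernsteinPolynomial.derivative_succ_aux,
      bernsteinPolynomial.derivative_zero, Nat.add_sub_cancel]
    rw [mul_sub, mul_add, Finset.mul_sum, Finset.mul_sum]
    simp only [mul_sub, Finset.sum_sub_distrib]
    push_cast
    have e : ∀ (a : ℕ → ℝ[X]) , ∑ x ∈ Finset.range (N + 1), C (c (x + 1)) * (((N : ℝ[X]) + 1) * a x) =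
        ∑ x ∈ Finset.range (N + 1), ((N : ℝ[X]) + 1) * (C (c (x + 1)) * a x) := fun a =>
      Finset.sum_congr rfl fun x _ => by ring
    rw [e, e]
    ring
  have h2 : ∑ k ∈ Finset.range (N + 1), C (c (k + 1)) * bernsteinPolynomial ℝ N (k + 1) +
        C (c 0) * bernsteinPolynomial ℝ N 0 =
        ∑ k ∈ Finset.range (N + 1), C (c k) * bernsteinPolynomial ℝ N k := by
    rw [← Finset.sum_range_succ' (fun k => C (c k) * bernsteinPolynomial ℝ N k),
      Finset.sum_range_succ, bernsteinPolynomial.eq_zero_of_lt ℝ (Nat.lt_succ_self N), mul_zero,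
      add_zero]
  rw [h1, h2, ← Finset.sum_sub_distrib, bern]
  simp [fwdDiff, sub_mul]

theorem iterate_derivative_bern (r N : ℕ) (c : ℕ → ℝ) (hr : r ≤ N) :
    derivative^[r] (bern N c) = C ((N.descFactorial r : ℕ) : ℝ) * bern (N - r) ((fwdDiff 1)^[r] c) := by
  induction r with
  | zero => simp
  | succ r ih =>
    rw [Function.iterate_succ_apply', ih (by omega), derivative_C_mul]
    obtain ⟨M, hM⟩ : ∃ M, N - r = M + 1 := ⟨N - r - 1, by omega⟩
    rw [hM, derivative_bern, ← mul_assoc, ← C_mul, Function.iterate_succ_apply',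
      show N - (r + 1) = M by omega, Nat.descFactorial_succ, hM]
    push_cast
    ring_nf

theorem bern_eval_zero (N : ℕ) (c : ℕ → ℝ) : (bern N c).eval 0 = c 0 := by
  simp only [bern, eval_finsetSum, eval_mul, eval_C, bernsteinPolynomial.eval_at_0]
  rw [Finset.sum_eq_single 0] <;> simp +contextual

theorem bern_eval_one (N : ℕ) (c : ℕ → ℝ) : (bern N c).eval 1 = c N := by
  simp only [bern, eval_finsetSum, eval_mul, eval_C, bernsteinPolynomial.eval_at_1]
  rw [Finset.sum_eq_single N] <;> simp +contextual

theorem bernsteinPolynomial_eval_nonneg (N k : ℕ) {s : ℝ} (h0 : 0 ≤ s) (h1 : s ≤ 1) :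
    0 ≤ (bernsteinPolynomial ℝ N k).eval s := by
  have : 0 ≤ 1 - s := sub_nonneg.2 h1
  simp only [bernsteinPolynomial, eval_mul, eval_natCast, eval_pow, eval_X, eval_sub, eval_one]
  positivity

theorem bern_eval_nonneg (N : ℕ) (c : ℕ → ℝ) (hc : ∀ k ≤ N, 0 ≤ c k) {s : ℝ} (h0 : 0 ≤ s)
    (h1 : s ≤ 1) : 0 ≤ (bern N c).eval s := by
  simp only [bern, eval_finsetSum, eval_mul, eval_C]
  exact Finset.sum_nonneg fun k hk => mul_nonneg (hc k (by have := Finset.mem_range.1 hk; omega))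
    (bernsteinPolynomial_eval_nonneg N k h0 h1)

theorem sum_bernstein_eval (N : ℕ) (s : ℝ) :
    ∑ k ∈ Finset.range (N + 1), (bernsteinPolynomial ℝ N k).eval s = 1 := by
  rw [← eval_finsetSum, bernsteinPolynomial.sum, eval_one]

theorem abs_bern_eval_le (N : ℕ) (c : ℕ → ℝ) {K s : ℝ} (hc : ∀ k ≤ N, |c k| ≤ K) (h0 : 0 ≤ s)
    (h1 : s ≤ 1) : |(bern N c).eval s| ≤ K := by
  simp only [bern, eval_finsetSum, eval_mul, eval_C]
  refine (Finset.abs_sum_le_sum_abs _ _).trans ?_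
  calc _ ≤ ∑ k ∈ Finset.range (N + 1), K * (bernsteinPolynomial ℝ N k).eval s := by
        refine Finset.sum_le_sum fun k hk => ?_
        rw [abs_mul, abs_of_nonneg (bernsteinPolynomial_eval_nonneg N k h0 h1)]
        exact mul_le_mul_of_nonneg_right (hc k (by have := Finset.mem_range.1 hk; omega))
          (bernsteinPolynomial_eval_nonneg N k h0 h1)
    _ = K := by rw [← Finset.mul_sum, sum_bernstein_eval, mul_one]

theorem bernstein_variance_eval {N : ℕ} (hN : N ≠ 0) (s : ℝ) :
    ∑ k ∈ Finset.range (N + 1), ((k : ℝ) / N - s) ^ 2 * (bernsteinPolynomial ℝ N k).eval s =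
      s * (1 - s) / N := by
  have h := congrArg (Polynomial.eval s) (bernsteinPolynomial.variance ℝ N)
  simp only [eval_finsetSum, eval_mul, eval_pow, eval_sub, eval_X, eval_natCast,
    eval_one, nsmul_eq_mul] at h
  have hN' : (N : ℝ) ≠ 0 := Nat.cast_ne_zero.2 hN
  have : ∀ k : ℕ, ((k : ℝ) / N - s) ^ 2 = (N * s - k) ^ 2 / (N : ℝ) ^ 2 := fun k => by
    field_simp
    ring
  simp only [this, div_mul_eq_mul_div]
  rw [← Finset.sum_div, h]
  field_simp

/-- Bernstein approximants of a bounded function converge at every point of continuity. -/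
theorem tendsto_bern_eval (g : ℝ → ℝ) {K s : ℝ} (hK : ∀ t ∈ Set.Icc (0 : ℝ) 1, |g t| ≤ K)
    (hs : s ∈ Set.Icc (0 : ℝ) 1) (hc : ContinuousWithinAt g (Set.Icc 0 1) s) :
    Filter.Tendsto (fun N : ℕ => (bern N fun k => g (k / N)).eval s) Filter.atTop
      (nhds (g s)) := by
  rw [Metric.tendsto_atTop]
  intro ε hε
  obtain ⟨δ, hδ, hδ'⟩ := Metric.continuousWithinAt_iff.1 hc (ε / 2) (half_pos hε)
  have hK0 : 0 ≤ K := (abs_nonneg _).trans (hK s hs)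
  set A := 2 * K / δ ^ 2
  have hA : 0 ≤ A := by positivity
  -- Continuity controls `t` near `s`, and the bound `K` is absorbed by a parabola elsewhere;
  -- averaging with Bernstein weights turns the parabola into the variance, which is `O(1 / N)`.
  have hquad : ∀ t ∈ Set.Icc (0 : ℝ) 1, |g t - g s| ≤ ε / 2 + A * (t - s) ^ 2 := by
    intro t ht
    by_cases htd : |t - s| < δ
    · have := hδ' ht (by rwa [Real.dist_eq])
      rw [Real.dist_eq] at this
      have : 0 ≤ A * (t - s) ^ 2 := by positivity
      linarith
    · have h1 : δ ^ 2 ≤ (t - s) ^ 2 := by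
        rw [← sq_abs (t - s)]
        exact pow_le_pow_left₀ hδ.le (not_lt.1 htd) 2
      have h2 : 2 * K ≤ A * (t - s) ^ 2 := by
        calc 2 * K = A * δ ^ 2 := by simp only [A]; field_simp
          _ ≤ _ := mul_le_mul_of_nonneg_left h1 hA
      have h3 : |g t - g s| ≤ |g t| + |g s| := abs_sub _ _
      linarith [hK t ht, hK s hs]
  obtain ⟨N₀, hN₀⟩ := exists_nat_gt (2 * A / ε)
  refine ⟨N₀ + 1, fun N hN => ?_⟩
  have hN0 : N ≠ 0 := by omega
  have hNpos : (0 : ℝ) < N := Nat.cast_pos.2 (by omega)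
  rw [Real.dist_eq]
  have e : (bern N fun k => g (k / N)).eval s - g s =
      ∑ k ∈ Finset.range (N + 1), (g (k / N) - g s) * (bernsteinPolynomial ℝ N k).eval s := by
    simp only [bern, eval_finsetSum, eval_mul, eval_C, sub_mul, Finset.sum_sub_distrib]
    rw [← Finset.mul_sum, sum_bernstein_eval, mul_one]
  rw [e]
  refine (Finset.abs_sum_le_sum_abs _ _).trans_lt ?_
  have hle : ∑ k ∈ Finset.range (N + 1),
      |(g (k / N) - g s) * (bernsteinPolynomial ℝ N k).eval s| ≤
      ε / 2 + A * (s * (1 - s) / N) := by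
    rw [← bernstein_variance_eval hN0, Finset.mul_sum, ← mul_one (ε / 2), ← sum_bernstein_eval N s,
      Finset.mul_sum, ← Finset.sum_add_distrib]
    refine Finset.sum_le_sum fun k hk => ?_
    have hb := bernsteinPolynomial_eval_nonneg N k hs.1 hs.2
    rw [abs_mul, abs_of_nonneg hb, ← mul_assoc, ← add_mul]
    refine mul_le_mul_of_nonneg_right (hquad _ ⟨by positivity, ?_⟩) hb
    rw [div_le_one hNpos]
    exact_mod_cast Nat.lt_succ_iff.1 (Finset.mem_range.1 hk)
  refine hle.trans_lt ?_
  have h1 : s * (1 - s) ≤ 1 := by nlinarith [hs.1, hs.2]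
  have h2 : A * (s * (1 - s) / N) ≤ A / N := by
    rw [← mul_div_assoc]
    gcongr
    exact mul_le_of_le_one_right hA h1
  have h3 : A / N < ε / 2 := by
    rw [div_lt_iff₀ hNpos]
    have : 2 * A / ε < N := hN₀.trans (by exact_mod_cast (by omega : N₀ < N))
    rw [div_lt_iff₀ hε] at this
    linarith
  linarith

/-- Taylor's formula with integral remainder for polynomials. -/
theorem polynomial_taylor (P : ℝ[X]) (x₀ s : ℝ) (m : ℕ) :
    P.eval s = ∑ j ∈ Finset.range (m + 1), (derivative^[j] P).eval x₀ / j.factorial * (s - x₀) ^ j +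
      ∫ u in x₀..s, (s - u) ^ m / m.factorial * (derivative^[m + 1] P).eval u := by
  induction m with
  | zero =>
    have : ∫ u in x₀..s, (derivative P).eval u = P.eval s - P.eval x₀ :=
      intervalIntegral.integral_eq_sub_of_hasDerivAt (fun u _ => P.hasDerivAt u)
        ((derivative P).continuous.intervalIntegrable _ _)
    simp [this]
  | succ m ih =>
    rw [ih, Finset.sum_range_succ _ (m + 1), add_assoc]
    congr 1
    have key := intervalIntegral.integral_mul_deriv_eq_deriv_mul
      (a := x₀) (b := s) (u := fun u => (s - u) ^ (m + 1) / ((m + 1).factorial : ℝ))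
      (u' := fun u => -((s - u) ^ m / (m.factorial : ℝ)))
      (v := fun u => (derivative^[m + 1] P).eval u)
      (v' := fun u => (derivative^[m + 1 + 1] P).eval u) ?_ ?_ ?_ ?_
    · rw [key]
      simp only [sub_self, neg_mul, intervalIntegral.integral_neg]
      rw [zero_pow (by omega)]
      ring
    · intro u _
      have h1 : HasDerivAt (fun u : ℝ => s - u) (-1) u := by
        simpa using (hasDerivAt_id u).const_sub s
      have h2 := (h1.fun_pow (m + 1)).div_const ((m + 1).factorial : ℝ)
      convert! h2 using 1
      rw [Nat.factorial_succ]
      have : (m.factorial : ℝ) ≠ 0 := Nat.cast_ne_zero.2 (Nat.factorial_ne_zero m)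
      have : (m : ℝ) + 1 ≠ 0 := by positivity
      push_cast
      field_simp
    · intro u _
      rw [Function.iterate_succ_apply' _ (m + 1)]
      exact Polynomial.hasDerivAt _ u
    · exact Continuous.intervalIntegrable (by fun_prop) _ _
    · exact Continuous.intervalIntegrable (Polynomial.continuous _) _ _

/-- The Bernstein polynomial with coefficients `c` on `[0, 1]`, extended outside by its Taylor
polynomials of degree `m` at `0` and `1`. -/
noncomputable def bernExt (N m : ℕ) (c : ℕ → ℝ) (s : ℝ) : ℝ :=
  if s < 0 then ∑ j ∈ Finset.range (m + 1), (N.choose j : ℝ) * ((fwdDiff 1)^[j] c) 0 * s ^ j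
  else if s ≤ 1 then (bern N c).eval s
  else ∑ j ∈ Finset.range (m + 1), (N.choose j : ℝ) * ((fwdDiff 1)^[j] c) (N - j) * (s - 1) ^ j

theorem iterate_derivative_bern_eval_div {N j : ℕ} (hj : j ≤ N) (c : ℕ → ℝ) (s : ℝ) :
    (derivative^[j] (bern N c)).eval s / j.factorial =
      (N.choose j : ℝ) * (bern (N - j) ((fwdDiff 1)^[j] c)).eval s := by
  rw [iterate_derivative_bern j N c hj, Nat.descFactorial_eq_factorial_mul_choose, eval_mul, eval_C]
  have : (j.factorial : ℝ) ≠ 0 := Nat.cast_ne_zero.2 (Nat.factorial_ne_zero j)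
  push_cast
  field_simp

/-- Taylor continuation of degree `m` makes no jump in the first `m` derivatives and contributes
nothing to the next one outside `[0, 1]`. Hence the extension is a polynomial plus a mixture of
truncated powers with knots in `[0, 1]`, weighted by the derivative of order `m + 1` of the
Bernstein polynomial. -/
theorem bernExt_eq {N m : ℕ} (hm : m ≤ N) (c : ℕ → ℝ) (s : ℝ) :
    bernExt N m c s =
      ∑ j ∈ Finset.range (m + 1), (N.choose j : ℝ) * ((fwdDiff 1)^[j] c) 0 * s ^ j +
      ∫ u in (0 : ℝ)..1, truncPow m (s - u) / m.factorial *
        (derivative^[m + 1] (bern N c)).eval u := by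
  have hT0 : ∑ j ∈ Finset.range (m + 1), (N.choose j : ℝ) * ((fwdDiff 1)^[j] c) 0 * s ^ j =
      ∑ j ∈ Finset.range (m + 1), (derivative^[j] (bern N c)).eval 0 / j.factorial *
        (s - 0) ^ j := by
    refine Finset.sum_congr rfl fun j hj => ?_
    have := Finset.mem_range.1 hj
    rw [iterate_derivative_bern_eval_div (by omega), bern_eval_zero, sub_zero]
  have hT1 : ∑ j ∈ Finset.range (m + 1), (N.choose j : ℝ) * ((fwdDiff 1)^[j] c) (N - j) * (s - 1) ^ j =
      ∑ j ∈ Finset.range (m + 1), (derivative^[j] (bern N c)).eval 1 / j.factorial *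
        (s - 1) ^ j := by
    refine Finset.sum_congr rfl fun j hj => ?_
    have := Finset.mem_range.1 hj
    rw [iterate_derivative_bern_eval_div (by omega), bern_eval_one]
  have hcont : Continuous fun u : ℝ => (s - u) ^ m / m.factorial *
      (derivative^[m + 1] (bern N c)).eval u := by
    have := Polynomial.continuous (derivative^[m + 1] (bern N c))
    fun_prop
  unfold bernExt
  split_ifs with h0 h1
  · rw [left_eq_add]
    rw [intervalIntegral.integral_congr (g := fun _ => 0), intervalIntegral.integral_zero]
    intro u hu
    rw [Set.uIcc_of_le zero_le_one] at hu
    simp only [truncPow]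
    rw [if_neg (by linarith [hu.1]), zero_div, zero_mul]
  · rw [hT0, polynomial_taylor (bern N c) 0 s m]
    congr 1
    have hs0 := not_lt.1 h0
    have e1 : ∫ u in (0 : ℝ)..s, truncPow m (s - u) / m.factorial *
        (derivative^[m + 1] (bern N c)).eval u = ∫ u in (0 : ℝ)..s, (s - u) ^ m / m.factorial *
        (derivative^[m + 1] (bern N c)).eval u := by
      refine intervalIntegral.integral_congr fun u hu => ?_
      rw [Set.uIcc_of_le hs0] at hu
      simp only [truncPow]
      rw [if_pos (by linarith [hu.2])]
    have e2 : ∫ u in s..1, truncPow m (s - u) / m.factorial *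
        (derivative^[m + 1] (bern N c)).eval u = 0 := by
      rw [intervalIntegral.integral_congr_ae (g := fun _ => 0), intervalIntegral.integral_zero]
      refine Filter.Eventually.of_forall fun u hu => ?_
      rw [Set.uIoc_of_le h1] at hu
      simp only [truncPow]
      rw [if_neg (by linarith [hu.1]), zero_div, zero_mul]
    have i1 : IntervalIntegrable (fun u : ℝ => truncPow m (s - u) / m.factorial *
        (derivative^[m + 1] (bern N c)).eval u) volume 0 s := by
      refine (hcont.intervalIntegrable 0 s).congr ?_
      intro u hu
      rw [Set.uIoc_of_le hs0] at hu
      simp only [truncPow]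
      rw [if_pos (by linarith [hu.2])]
    have i2 : IntervalIntegrable (fun u : ℝ => truncPow m (s - u) / m.factorial *
        (derivative^[m + 1] (bern N c)).eval u) volume s 1 := by
      refine (intervalIntegrable_const (c := (0 : ℝ))).congr ?_
      intro u hu
      rw [Set.uIoc_of_le h1] at hu
      simp only [truncPow]
      rw [if_neg (by linarith [hu.1]), zero_div, zero_mul]
    rw [← intervalIntegral.integral_add_adjacent_intervals i1 i2, e1, e2, add_zero]
  · have hs := not_le.1 h1
    have e1 : ∫ u in (0 : ℝ)..1, truncPow m (s - u) / m.factorial *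
        (derivative^[m + 1] (bern N c)).eval u = ∫ u in (0 : ℝ)..1, (s - u) ^ m / m.factorial *
        (derivative^[m + 1] (bern N c)).eval u := by
      refine intervalIntegral.integral_congr fun u hu => ?_
      rw [Set.uIcc_of_le zero_le_one] at hu
      simp only [truncPow]
      rw [if_pos (by linarith [hu.2])]
    rw [e1, hT0, hT1]
    -- Subtracting the Taylor formulas at `0` and at `1` leaves the remainder integral over `[0, 1]`
    -- alone.
    have h2 := polynomial_taylor (bern N c) 0 s m
    have h3 := polynomial_taylor (bern N c) 1 s m
    have h4 := intervalIntegral.integral_add_adjacent_intervals (μ := volume)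
      (hcont.intervalIntegrable 0 1) (hcont.intervalIntegrable 1 s)
    linarith

end Bernstein

/-! ### Linearity and growth of the extension -/

section BernExt

theorem fwdDiff_iter_congr {N j i : ℕ} {c c' : ℕ → ℝ} (h : ∀ k ≤ N, c k = c' k) (hi : i + j ≤ N) :
    (fwdDiff 1)^[j] c i = (fwdDiff 1)^[j] c' i := by
  rw [fwdDiff_iter_eq_sum_shift, fwdDiff_iter_eq_sum_shift]
  refine Finset.sum_congr rfl fun k hk => ?_
  rw [h]
  have := Finset.mem_range.1 hk
  simp only [smul_eq_mul, mul_one]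
  omega

theorem bernExt_congr {N m : ℕ} (hm : m ≤ N) {c c' : ℕ → ℝ} (h : ∀ k ≤ N, c k = c' k) (s : ℝ) :
    bernExt N m c s = bernExt N m c' s := by
  unfold bernExt
  split_ifs
  · refine Finset.sum_congr rfl fun j hj => ?_
    have := Finset.mem_range.1 hj
    rw [fwdDiff_iter_congr h (by omega)]
  · rw [bern, bern]
    congr 1
    refine Finset.sum_congr rfl fun k hk => ?_
    have := Finset.mem_range.1 hk
    rw [h k (by omega)]
  · refine Finset.sum_congr rfl fun j hj => ?_
    have := Finset.mem_range.1 hj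
    rw [fwdDiff_iter_congr h (by omega)]

theorem bernExt_const_mul (N m : ℕ) (a : ℝ) (c : ℕ → ℝ) (s : ℝ) :
    bernExt N m (fun k => a * c k) s = a * bernExt N m c s := by
  have e : ∀ j : ℕ, (fwdDiff 1)^[j] (fun k => a * c k) = a • (fwdDiff 1)^[j] c := fun j =>
    fwdDiff_iter_const_smul (h := 1) a c j
  unfold bernExt
  split_ifs
  · rw [Finset.mul_sum]
    refine Finset.sum_congr rfl fun j _ => ?_
    rw [e, Pi.smul_apply, smul_eq_mul]; ring
  · simp only [bern, Polynomial.eval_finsetSum, Polynomial.eval_mul, Polynomial.eval_C,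
      Finset.mul_sum, mul_assoc]
  · rw [Finset.mul_sum]
    refine Finset.sum_congr rfl fun j _ => ?_
    rw [e, Pi.smul_apply, smul_eq_mul]; ring

theorem bernExt_sum {β : Type*} (N m : ℕ) (S : Finset β) (c : β → ℕ → ℝ) (s : ℝ) :
    bernExt N m (fun k => ∑ b ∈ S, c b k) s = ∑ b ∈ S, bernExt N m (c b) s := by
  have e0 : (fun k => ∑ b ∈ S, c b k) = ∑ b ∈ S, c b := by ext k; simp
  have e : ∀ j : ℕ, (fwdDiff 1)^[j] (fun k => ∑ b ∈ S, c b k) =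
      ∑ b ∈ S, (fwdDiff 1)^[j] (c b) := fun j => by
    rw [e0]
    exact fwdDiff_iter_finsetSum (h := 1) S c j
  unfold bernExt
  split_ifs
  · rw [Finset.sum_comm]
    refine Finset.sum_congr rfl fun j _ => ?_
    rw [e, Finset.sum_apply, Finset.mul_sum, Finset.sum_mul]
  · simp only [bern, Polynomial.eval_finsetSum, Polynomial.eval_mul, Polynomial.eval_C,
      Finset.sum_mul]
    rw [Finset.sum_comm]
  · rw [Finset.sum_comm]
    refine Finset.sum_congr rfl fun j _ => ?_
    rw [e, Finset.sum_apply, Finset.mul_sum, Finset.sum_mul]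

/-- Linearity in the coefficients exhibits the approximant as a finite combination of sampled
values; this is what makes the limiting functional discrete. -/
theorem bernExt_eq_sum {N m : ℕ} (hm : m ≤ N) (c : ℕ → ℝ) (s : ℝ) :
    bernExt N m c s =
      ∑ k ∈ Finset.range (N + 1), c k * bernExt N m (fun l => if l = k then 1 else 0) s := by
  simp only [← bernExt_const_mul]
  rw [← bernExt_sum]
  refine bernExt_congr hm (fun k hk => ?_) s
  simp [Nat.lt_succ_iff.2 hk]

theorem measurable_bernExt (N m : ℕ) (c : ℕ → ℝ) : Measurable (bernExt N m c) := by
  unfold bernExt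
  refine Measurable.ite measurableSet_Iio ?_ (Measurable.ite measurableSet_Iic ?_ ?_)
  · fun_prop
  · exact (Polynomial.continuous _).measurable
  · fun_prop

theorem exists_abs_bernExt_le (N m : ℕ) (c : ℕ → ℝ) :
    ∃ K, ∀ s, |bernExt N m c s| ≤ K * (1 + |s|) ^ m := by
  have hsum : ∀ (A : ℕ → ℝ) (s r : ℝ), |r| ≤ 1 + |s| →
      |∑ j ∈ Finset.range (m + 1), A j * r ^ j| ≤
        (∑ j ∈ Finset.range (m + 1), |A j|) * (1 + |s|) ^ m := by
    intro A s r hr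
    refine (Finset.abs_sum_le_sum_abs _ _).trans ?_
    rw [Finset.sum_mul]
    refine Finset.sum_le_sum fun j hj => ?_
    have := Finset.mem_range.1 hj
    rw [abs_mul, abs_pow]
    refine mul_le_mul_of_nonneg_left ?_ (abs_nonneg _)
    exact (pow_le_pow_left₀ (abs_nonneg _) hr _).trans
      (pow_le_pow_right₀ (by linarith [abs_nonneg s]) (by omega))
  set K1 := ∑ j ∈ Finset.range (m + 1), |(N.choose j : ℝ) * ((fwdDiff 1)^[j] c) 0|
  set K2 := ∑ k ∈ Finset.range (N + 1), |c k|
  set K3 := ∑ j ∈ Finset.range (m + 1), |(N.choose j : ℝ) * ((fwdDiff 1)^[j] c) (N - j)|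
  have h1 : 0 ≤ K1 := Finset.sum_nonneg fun _ _ => abs_nonneg _
  have h2 : 0 ≤ K2 := Finset.sum_nonneg fun _ _ => abs_nonneg _
  have h3 : 0 ≤ K3 := Finset.sum_nonneg fun _ _ => abs_nonneg _
  refine ⟨K1 + K2 + K3, fun s => ?_⟩
  have hs : (1 : ℝ) ≤ (1 + |s|) ^ m := one_le_pow₀ (by linarith [abs_nonneg s])
  have hs0 : (0 : ℝ) ≤ (1 + |s|) ^ m := by linarith
  unfold bernExt
  split_ifs with h h'
  · refine (hsum _ s s (by linarith)).trans ?_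
    exact mul_le_mul_of_nonneg_right (by linarith) hs0
  · have : |(bern N c).eval s| ≤ K2 := abs_bern_eval_le N c (fun k hk =>
      Finset.single_le_sum (f := fun k => |c k|) (fun _ _ => abs_nonneg _)
        (Finset.mem_range.2 (Nat.lt_succ_iff.2 hk))) (not_lt.1 h) h'
    nlinarith
  · refine (hsum _ s (s - 1) ?_).trans ?_
    · rw [abs_le]; constructor <;> linarith [neg_abs_le s, le_abs_self s]
    · exact mul_le_mul_of_nonneg_right (by linarith) hs0

end BernExt

/-! ### Equispaced nodes: domination outside the segment -/

section Grid

variable {ι : Type*} [DecidableEq ι] {v : ι → ℝ} {f : ι → ℝ}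

/-- In the recursion the outer nodes are `(r + 1) * h` apart, and these gaps accumulate to `r! * h ^
r`. -/
theorem image_Icc_dd_equispaced (hv : Function.Injective v) {N : ℕ} {α h : ℝ} (hh : 0 < h)
    (x : ℕ → ι) (hx : ∀ k ≤ N, v (x k) = α + k * h) (r : ℕ) : ∀ k, k + r ≤ N →
    (fwdDiff 1)^[r] (fun l => f (x l)) k =
      r.factorial * h ^ r * dd v ((Finset.Icc k (k + r)).image x) f := by
  have hinj : ∀ k ≤ N, ∀ l ≤ N, x k = x l → k = l := by
    intro k hk l hl h'
    have := congrArg v h'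
    rw [hx k hk, hx l hl] at this
    have h2 : ((k : ℝ) - l) * h = 0 := by linarith
    rcases mul_eq_zero.1 h2 with h3 | h3
    · exact_mod_cast sub_eq_zero.1 h3
    · exact absurd h3 hh.ne'
  induction r with
  | zero => intro k _; simp [dd_singleton]
  | succ r ih =>
    intro k hk
    rw [Function.iterate_succ_apply', fwdDiff, ih (k + 1) (by omega), ih k (by omega)]
    set M : Finset ι := (Finset.Icc (k + 1) (k + r)).image x
    have hmem : ∀ l ≤ N, l ∉ Finset.Icc (k + 1) (k + r) → x l ∉ M := by
      intro l hl hl' hM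
      obtain ⟨l', hl'', he⟩ := Finset.mem_image.1 hM
      have := Finset.mem_Icc.1 hl''
      exact hl' (hinj l' (by omega) l hl he ▸ hl'')
    have e1 : (Finset.Icc (k + 1) (k + 1 + r)).image x = insert (x (k + (r + 1))) M := by
      rw [← Finset.image_insert]
      congr 1
      ext l; simp only [Finset.mem_Icc, Finset.mem_insert]; omega
    have e2 : (Finset.Icc k (k + r)).image x = insert (x k) M := by
      rw [← Finset.image_insert]
      congr 1
      ext l; simp only [Finset.mem_Icc, Finset.mem_insert]; omega
    have e3 : (Finset.Icc k (k + (r + 1))).image x = insert (x (k + (r + 1))) (insert (x k) M) := by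
      rw [← Finset.image_insert, ← Finset.image_insert]
      congr 1
      ext l; simp only [Finset.mem_Icc, Finset.mem_insert]; omega
    have key := dd_insert_insert (f := f) hv (a := x (k + (r + 1))) (b := x k) (s := M)
      (fun h' => by have := hinj _ (by omega) _ (by omega) h'; omega)
      (hmem _ (by omega) (by simp)) (hmem _ (by omega) (by simp))
    rw [e1, e2, e3, ← mul_sub, ← key, hx _ (by omega), hx _ (by omega), Nat.factorial_succ]
    push_cast
    ring

theorem MConvex.fwdDiff_nonneg {m : ℕ} (hf : MConvex v m f) (hv : Function.Injective v) {N : ℕ}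
    {α h : ℝ} (hh : 0 < h) (x : ℕ → ι) (hx : ∀ k ≤ N, v (x k) = α + k * h) {k : ℕ}
    (hk : k + (m + 1) ≤ N) : 0 ≤ (fwdDiff 1)^[m + 1] (fun l => f (x l)) k := by
  rw [image_Icc_dd_equispaced hv hh x hx (m + 1) k hk]
  refine mul_nonneg (by positivity) (hf _ ?_)
  rw [Finset.card_image_of_injOn, Nat.card_Icc]
  · omega
  · intro a ha b hb hab
    simp only [Finset.coe_Icc, Set.mem_Icc] at ha hb
    have := congrArg v hab
    rw [hx _ (by omega), hx _ (by omega)] at this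
    have h2 : ((a : ℝ) - b) * h = 0 := by linarith
    rcases mul_eq_zero.1 h2 with h3 | h3
    · exact_mod_cast sub_eq_zero.1 h3
    · exact absurd h3 hh.ne'

variable {m : ℕ} {C : Finset ι}

theorem descFactorial_div_pow_le_one (N k : ℕ) :
    (N.descFactorial k : ℝ) / (N : ℝ) ^ k ≤ 1 :=
  div_le_one_of_le₀ (by exact_mod_cast Nat.descFactorial_le_pow N k) (by positivity)

/-- To the right of the interval carrying the nodes, `bernExt` is dominated by the function. -/
theorem abs_bernExt_le_right (hv : Function.Injective v) (hf : MConvex v m f)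
    (hC : C.card = m + 1) (h0 : ∀ c ∈ C, f c = 0) {N : ℕ} (hmN : m ≤ N) (hN : N ≠ 0) {a b t : ι}
    (hab : v a < v b) (x : ℕ → ι) (hx : ∀ k ≤ N, v (x k) = v a + k / N * (v b - v a))
    (hxC : ∀ c ∈ C, v c < v b - m / N * (v b - v a)) (hbt : v b < v t) :
    |bernExt N m (fun k => f (x k)) ((v t - v a) / (v b - v a))| ≤ |f t| := by
  have hL : 0 < v b - v a := sub_pos.2 hab
  have hNpos : (0 : ℝ) < N := Nat.cast_pos.2 (Nat.pos_of_ne_zero hN)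
  set h := (v b - v a) / N with hh
  have hhpos : 0 < h := by positivity
  have hx' : ∀ k ≤ N, v (x k) = v a + k * h := fun k hk => by rw [hx k hk, hh]; ring
  have hxs : ∀ k ≤ m, v (x (N - k)) = v b - k / N * (v b - v a) := fun k hk => by
    rw [hx _ (Nat.sub_le _ _), Nat.cast_sub (hk.trans hmN)]
    field_simp
    ring
  have hkN : ∀ k ≤ m, (k : ℝ) / N * (v b - v a) ≤ m / N * (v b - v a) := fun k hk => by
    have : (k : ℝ) ≤ m := Nat.cast_le.2 hk
    gcongr
  have hs : 1 < (v t - v a) / (v b - v a) := by rw [one_lt_div hL]; linarith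
  -- The Taylor coefficient of order `k` at `b` is a difference over the last `k + 1` grid points.
  -- The ratio `N.descFactorial k / N ^ k` comes from `N.choose k * k!` and the mesh `(v b - v a) /
  -- N`; it is the damping in `newton_bound`, with the nodes listed from right to left.
  have hval : bernExt N m (fun k => f (x k)) ((v t - v a) / (v b - v a)) =
      ∑ k ∈ Finset.range (m + 1), (N.descFactorial k : ℝ) / (N : ℝ) ^ k *
        dd v ((Finset.range (k + 1)).image fun l => x (N - l)) f * (v t - v b) ^ k := by
    rw [bernExt, if_neg (by linarith), if_neg (by linarith)]
    refine Finset.sum_congr rfl fun k hk => ?_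
    have hk' : k ≤ m := by have := Finset.mem_range.1 hk; omega
    rw [image_Icc_dd_equispaced hv hhpos x hx' k (N - k) (by omega)]
    have e : (Finset.Icc (N - k) (N - k + k)).image x =
        (Finset.range (k + 1)).image fun l => x (N - l) := by
      rw [show (fun l => x (N - l)) = x ∘ fun l => N - l from rfl, ← Finset.image_image]
      congr 1
      ext l
      simp only [Finset.mem_Icc, Finset.mem_image, Finset.mem_range]
      constructor
      · exact fun hl => ⟨N - l, by omega, by omega⟩
      · rintro ⟨l', hl', rfl⟩; omega
    have e2 : (v t - v a) / (v b - v a) - 1 = (v t - v b) / (v b - v a) := by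
      field_simp; ring
    rw [e, e2, hh, Nat.descFactorial_eq_factorial_mul_choose, div_pow, div_pow]
    push_cast
    field_simp
  have hb := newton_bound hv hf hC h0 (fun l => x (N - l)) (b := b) (t := t) ?_ ?_ ?_ hbt
    (fun k => (N.descFactorial k : ℝ) / (N : ℝ) ^ k) (fun k _ => by positivity)
    (fun k _ => descFactorial_div_pow_le_one N k)
  · rw [hval, abs_of_nonneg hb.1]
    exact hb.2.trans (le_abs_self _)
  · intro k hk l hl hkl
    have h1 := congrArg v hkl
    simp only [Set.mem_Iic] at hk hl
    simp only at h1
    rw [hxs k hk, hxs l hl] at h1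
    have h2 : ((k : ℝ) - l) * ((v b - v a) / N) = 0 := by
      linear_combination (-1 : ℝ) * h1
    rcases mul_eq_zero.1 h2 with h3 | h3
    · exact_mod_cast sub_eq_zero.1 h3
    · exact absurd h3 hhpos.ne'
  · intro k hk c hc
    rw [hxs k hk]
    linarith [hxC c hc, hkN k hk]
  · intro k hk
    rw [hxs k hk]
    have : 0 ≤ (k : ℝ) / N * (v b - v a) := by positivity
    linarith

/-- To the left of the interval carrying the nodes, `bernExt` is dominated by the function. -/
theorem abs_bernExt_le_left (hv : Function.Injective v) (hf : MConvex v m f)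
    (hC : C.card = m + 1) (h0 : ∀ c ∈ C, f c = 0) {N : ℕ} (hmN : m ≤ N) (hN : N ≠ 0) {a b t : ι}
    (hab : v a < v b) (x : ℕ → ι) (hx : ∀ k ≤ N, v (x k) = v a + k / N * (v b - v a))
    (hxC : ∀ c ∈ C, v a + m / N * (v b - v a) < v c) (hta : v t < v a) :
    |bernExt N m (fun k => f (x k)) ((v t - v a) / (v b - v a))| ≤ |f t| := by
  have hL : 0 < v b - v a := sub_pos.2 hab
  have hNpos : (0 : ℝ) < N := Nat.cast_pos.2 (Nat.pos_of_ne_zero hN)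
  set h := (v b - v a) / N with hh
  have hhpos : 0 < h := by positivity
  have hx' : ∀ k ≤ N, v (x k) = v a + k * h := fun k hk => by rw [hx k hk, hh]; ring
  have hkN : ∀ k ≤ m, (k : ℝ) / N * (v b - v a) ≤ m / N * (v b - v a) := fun k hk => by
    have : (k : ℝ) ≤ m := Nat.cast_le.2 hk
    gcongr
  have hs : (v t - v a) / (v b - v a) < 0 := div_neg_of_neg_of_pos (by linarith) hL
  have hinj : ∀ k ≤ N, ∀ l ≤ N, x k = x l → k = l := by
    intro k hk l hl h'
    have := congrArg v h'
    rw [hx' k hk, hx' l hl] at this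
    have h2 : ((k : ℝ) - l) * h = 0 := by linarith
    rcases mul_eq_zero.1 h2 with h3 | h3
    · exact_mod_cast sub_eq_zero.1 h3
    · exact absurd h3 hhpos.ne'
  have hval : bernExt N m (fun k => f (x k)) ((v t - v a) / (v b - v a)) = (-1) ^ (m + 1) *
      ∑ k ∈ Finset.range (m + 1), (N.descFactorial k : ℝ) / (N : ℝ) ^ k *
        dd (fun i => -v i) ((Finset.range (k + 1)).image x) (fun i => (-1) ^ (m + 1) * f i) *
          (-v t - -v a) ^ k := by
    rw [bernExt, if_pos hs, Finset.mul_sum]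
    refine Finset.sum_congr rfl fun k hk => ?_
    have hk' : k ≤ m := by have := Finset.mem_range.1 hk; omega
    rw [image_Icc_dd_equispaced hv hhpos x hx' k 0 (by omega)]
    have e : Finset.Icc 0 (0 + k) = Finset.range (k + 1) := by
      ext l; simp only [Finset.mem_Icc, Finset.mem_range]; omega
    have ecard : ((Finset.range (k + 1)).image x).card = k + 1 := by
      rw [Finset.card_image_of_injOn, Finset.card_range]
      intro i hi j hj hij
      simp only [Finset.coe_range, Set.mem_Iio] at hi hj
      exact hinj i (by omega) j (by omega) hij
    rw [e, dd_const_mul, dd_neg_nodes, ecard, Nat.add_sub_cancel, hh,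
      Nat.descFactorial_eq_factorial_mul_choose, show -v t - -v a = (-1) * (v t - v a) by ring,
      mul_pow (-1 : ℝ)]
    have h1 : ((-1 : ℝ) ^ (m + 1)) * (-1) ^ (m + 1) = 1 := by rw [← mul_pow]; simp
    have h2 : ((-1 : ℝ) ^ k) * (-1) ^ k = 1 := by rw [← mul_pow]; simp
    set D := dd v ((Finset.range (k + 1)).image x) f
    have h3 : ∀ A X : ℝ, (-1) ^ (m + 1) * (A * ((-1) ^ (m + 1) * ((-1) ^ k * D)) * ((-1) ^ k * X)) =
        ((-1) ^ (m + 1) * (-1) ^ (m + 1)) * ((-1) ^ k * (-1) ^ k) * (A * D * X) := fun A X => by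
      ring
    rw [h3, h1, h2]
    push_cast
    rw [div_pow, div_pow]
    field_simp
  -- After reflection the points left of `a` lie to the right, and the first grid points already
  -- come in the required order.
  have hb := newton_bound (v := fun i => -v i) (fun i j hij => hv (neg_injective hij)) hf.reflect hC
    (fun c hc => by rw [h0 c hc, mul_zero]) x (b := a) (t := t) ?_ ?_ ?_ (neg_lt_neg hta)
    (fun k => (N.descFactorial k : ℝ) / (N : ℝ) ^ k) (fun k _ => by positivity)
    (fun k _ => descFactorial_div_pow_le_one N k)
  · rw [hval, abs_mul, abs_pow, abs_neg, abs_one, one_pow, one_mul, abs_of_nonneg hb.1]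
    refine hb.2.trans ((le_abs_self _).trans ?_)
    rw [abs_mul, abs_pow, abs_neg, abs_one, one_pow, one_mul]
  · intro k hk l hl hkl
    simp only [Set.mem_Iic] at hk hl
    exact hinj k (by omega) l (by omega) hkl
  · intro k hk c hc
    have := hx k (by omega)
    linarith [hxC c hc, hkN k hk]
  · intro k hk
    have := hx k (by omega)
    have h3 : 0 ≤ (k : ℝ) / N * (v b - v a) := by positivity
    linarith

end Grid

theorem measurable_truncPow (m : ℕ) : Measurable (truncPow m) := by
  unfold truncPow
  exact Measurable.ite measurableSet_Ici (by fun_prop) measurable_const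

theorem abs_truncPow_le (m : ℕ) (y : ℝ) : |truncPow m y| ≤ |y| ^ m := by
  unfold truncPow
  split_ifs
  · rw [abs_pow]
  · rw [abs_zero]; positivity

theorem truncPow_div {m : ℕ} {y L : ℝ} (hL : 0 < L) : truncPow m (y / L) = truncPow m y / L ^ m := by
  unfold truncPow
  by_cases h : 0 ≤ y
  · rw [if_pos h, if_pos (div_nonneg h hL.le), div_pow]
  · rw [if_neg h, if_neg (not_le.2 (div_neg_of_neg_of_pos (not_le.1 h) hL)), zero_div]

/-! ### Densities that are nonnegative on truncated powers -/

section Density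

variable {I : Set ℝ}

/-- The signed measure `σ • τ` has finite moments of order `m`, vanishing moments up to order `m`
and nonnegative integrals against the truncated powers `(x - u)₊ᵐ`. -/
structure NonnegDensity (τ : Measure I) (σ : I → ℝ) (m : ℕ) : Prop where
  measurable : Measurable σ
  abs_eq_one : ∀ t, |σ t| = 1
  integrable_pow : Integrable (fun t : I => |(t : ℝ)| ^ m) τ
  moment : ∀ k ≤ m, ∫ t, (t : ℝ) ^ k * σ t ∂τ = 0
  truncPow_nonneg : ∀ u : I, 0 ≤ ∫ t, truncPow m ((t : ℝ) - u) * σ t ∂τ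

variable {τ : Measure I} [IsFiniteMeasure τ] {σ : I → ℝ} {m : ℕ}

theorem integrable_one_add_abs_pow (h : Integrable (fun t : I => |(t : ℝ)| ^ m) τ) :
    Integrable (fun t : I => (1 + |(t : ℝ)|) ^ m) τ := by
  refine Integrable.mono' (((integrable_const (1 : ℝ)).add h).const_mul (2 ^ (m - 1))) ?_ ?_
  · exact Measurable.aestronglyMeasurable (by fun_prop)
  · refine Filter.Eventually.of_forall fun t => ?_
    have := add_pow_le (zero_le_one' ℝ) (abs_nonneg (t : ℝ)) m
    rw [Real.norm_of_nonneg (by positivity)]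
    simpa using this

/-- Functions of polynomial growth of order `m` are integrable. -/
theorem integrable_of_growth (h : Integrable (fun t : I => |(t : ℝ)| ^ m) τ) {g : I → ℝ}
    (hg : AEStronglyMeasurable g τ) {K : ℝ} (hK : ∀ t, |g t| ≤ K * (1 + |(t : ℝ)|) ^ m) :
    Integrable g τ :=
  Integrable.mono' ((integrable_one_add_abs_pow h).const_mul K) hg
    (Filter.Eventually.of_forall hK)

theorem pow_growth {k : ℕ} (hk : k ≤ m) (t : ℝ) : |t| ^ k ≤ (1 + |t|) ^ m :=
  (pow_le_pow_left₀ (abs_nonneg _) (by linarith) k).trans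
    (pow_le_pow_right₀ (by linarith [abs_nonneg t]) hk)

theorem integrable_pow_of_le (h : Integrable (fun t : I => |(t : ℝ)| ^ m) τ) {k : ℕ} (hk : k ≤ m) :
    Integrable (fun t : I => (t : ℝ) ^ k) τ :=
  integrable_of_growth (K := 1) h (Measurable.aestronglyMeasurable (by fun_prop)) fun t => by
    rw [abs_pow, one_mul]
    exact pow_growth hk t

theorem integrable_truncPow (h : Integrable (fun t : I => |(t : ℝ)| ^ m) τ) {k : ℕ} (hk : k ≤ m)
    (u : ℝ) : Integrable (fun t : I => truncPow k ((t : ℝ) - u)) τ := by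
  refine integrable_of_growth (K := (1 + |u|) ^ m) h
    ((measurable_truncPow k).comp (by fun_prop)).aestronglyMeasurable fun t => ?_
  refine (abs_truncPow_le k _).trans ?_
  rw [← mul_pow]
  refine (pow_growth hk _).trans (pow_le_pow_left₀ (by positivity) ?_ m)
  have := abs_sub (t : ℝ) u
  nlinarith [abs_nonneg u, abs_nonneg (t : ℝ)]

theorem _root_.MeasureTheory.Integrable.mul_sign {X : Type*} [MeasurableSpace X] {ρ : Measure X}
    {s g : X → ℝ}
    (hg : Integrable g ρ) (hs : Measurable s) (h1 : ∀ t, |s t| = 1) :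
    Integrable (fun t => g t * s t) ρ :=
  hg.mul_bdd (c := 1) hs.aestronglyMeasurable
    (Filter.Eventually.of_forall fun t => (h1 t).le)

namespace NonnegDensity

variable (h : NonnegDensity τ σ m)

include h

theorem integral_eval_eq_zero (P : Polynomial ℝ) (hP : P.natDegree ≤ m) :
    ∫ t : I, P.eval (t : ℝ) * σ t ∂τ = 0 := by
  simp only [Polynomial.eval_eq_sum_range, Finset.sum_mul, mul_assoc]
  rw [integral_finsetSum]
  · refine Finset.sum_eq_zero fun k hk => ?_
    rw [integral_const_mul, h.moment k (by have := Finset.mem_range.1 hk; omega), mul_zero]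
  · intro k hk
    exact ((integrable_pow_of_le h.integrable_pow
      (by have := Finset.mem_range.1 hk; omega)).mul_sign h.measurable h.abs_eq_one).const_mul _

theorem integrable_bernExt (N : ℕ) (c : ℕ → ℝ) {a b : ℝ} (hab : a < b) :
    Integrable (fun t : I => bernExt N m c (((t : ℝ) - a) / (b - a))) τ := by
  obtain ⟨K, hK⟩ := exists_abs_bernExt_le N m c
  have hK0 : 0 ≤ K := by
    have := (abs_nonneg _).trans (hK 0)
    simpa using this
  have hL : 0 < b - a := sub_pos.2 hab
  refine integrable_of_growth (K := K * (1 + (1 + |a|) / (b - a)) ^ m) h.integrable_pow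
    ((measurable_bernExt N m c).comp (by fun_prop)).aestronglyMeasurable fun t => ?_
  refine (hK _).trans ?_
  rw [mul_assoc, ← mul_pow]
  refine mul_le_mul_of_nonneg_left (pow_le_pow_left₀ (by positivity) ?_ m) hK0
  rw [abs_div, abs_of_pos hL]
  have h1 := abs_sub (t : ℝ) a
  have h2 : |(t : ℝ) - a| / (b - a) ≤ (1 + |a|) / (b - a) * (1 + |(t : ℝ)|) := by
    rw [div_mul_eq_mul_div]
    gcongr
    nlinarith [abs_nonneg a, abs_nonneg (t : ℝ)]
  nlinarith [abs_nonneg (t : ℝ)]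

/-- By `bernExt_eq` and Fubini: the polynomial part dies by the moment conditions, the weight is
nonnegative because the forward differences of order `m + 1` are, and each truncated power has a
nonnegative integral. -/
theorem integral_bernExt_nonneg (hI : I.OrdConnected) {N : ℕ} (hN : m + 1 ≤ N) {c : ℕ → ℝ}
    (hc : ∀ k, k + (m + 1) ≤ N → 0 ≤ (fwdDiff 1)^[m + 1] c k) {a b : I} (hab : (a : ℝ) < b) :
    0 ≤ ∫ t : I, bernExt N m c (((t : ℝ) - a) / (b - a)) * σ t ∂τ := by
  have hL : 0 < (b : ℝ) - a := sub_pos.2 hab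
  set q : ℝ → ℝ := fun u => (Polynomial.derivative^[m + 1] (bern N c)).eval u with hq
  have hqc : Continuous q := Polynomial.continuous _
  have hq0 : ∀ u, 0 ≤ u → u ≤ 1 → 0 ≤ q u := by
    intro u h0 h1
    simp only [hq]
    rw [iterate_derivative_bern _ _ _ hN, Polynomial.eval_mul, Polynomial.eval_C]
    exact mul_nonneg (Nat.cast_nonneg _)
      (bern_eval_nonneg _ _ (fun k hk => hc k (by omega)) h0 h1)
  set ν : Measure ℝ := volume.restrict (Set.Ioc 0 1)
  set Φ : I × ℝ → ℝ := fun p =>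
    truncPow m (((p.1 : ℝ) - a) / (b - a) - p.2) / m.factorial * q p.2 * σ p.1 with hΦ
  have hΦm : Measurable Φ := by
    have h1 : Measurable fun p : I × ℝ => truncPow m (((p.1 : ℝ) - a) / (b - a) - p.2) :=
      (measurable_truncPow m).comp (by fun_prop)
    have h2 : Measurable fun p : I × ℝ => σ p.1 := h.measurable.comp measurable_fst
    have h3 : Measurable fun p : I × ℝ => q p.2 := hqc.measurable.comp measurable_snd
    exact ((h1.div_const _).mul h3).mul h2
  obtain ⟨B, hB⟩ := isCompact_Icc.exists_bound_of_continuousOn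
    (hqc.continuousOn (s := Set.Icc (0 : ℝ) 1))
  have hB0 : 0 ≤ B := (norm_nonneg _).trans (hB 0 (by simp))
  have hgrow : Integrable (fun t : I => (1 + |((t : ℝ) - a) / (b - a)|) ^ m) τ := by
    refine integrable_of_growth (K := (1 + (1 + |(a : ℝ)|) / (b - a)) ^ m) h.integrable_pow
      (Measurable.aestronglyMeasurable (by fun_prop)) fun t => ?_
    rw [abs_of_nonneg (by positivity), ← mul_pow]
    refine pow_le_pow_left₀ (by positivity) ?_ m
    rw [abs_div, abs_of_pos hL]
    have h1 := abs_sub (t : ℝ) a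
    have h2 : |(t : ℝ) - a| / (b - a) ≤ (1 + |(a : ℝ)|) / (b - a) * (1 + |(t : ℝ)|) := by
      rw [div_mul_eq_mul_div]
      gcongr
      nlinarith [abs_nonneg (a : ℝ), abs_nonneg (t : ℝ)]
    nlinarith [abs_nonneg (t : ℝ)]
  have hΦi : Integrable Φ (τ.prod ν) := by
    refine Integrable.mono' ((hgrow.mul_prod (integrable_const (μ := ν) B))) hΦm.aestronglyMeasurable ?_
    have hae : ∀ᵐ p ∂τ.prod ν, p.2 ∈ Set.Ioc (0 : ℝ) 1 := by
      have : ∀ᵐ u ∂ν, u ∈ Set.Ioc (0 : ℝ) 1 := ae_restrict_mem measurableSet_Ioc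
      exact Measure.quasiMeasurePreserving_snd.ae this
    filter_upwards [hae] with p hp
    rw [Real.norm_eq_abs, hΦ, abs_mul, abs_mul, abs_div, h.abs_eq_one, mul_one, Nat.abs_cast]
    refine mul_le_mul ?_ (hB p.2 ⟨hp.1.le, hp.2⟩) (abs_nonneg _) (by positivity)
    refine (div_le_self (abs_nonneg _) ?_).trans ((abs_truncPow_le m _).trans ?_)
    · exact_mod_cast Nat.one_le_iff_ne_zero.2 (Nat.factorial_ne_zero m)
    · refine pow_le_pow_left₀ (abs_nonneg _) ?_ m
      refine (abs_sub _ _).trans ?_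
      rw [abs_of_pos hp.1]
      linarith [hp.2]
  set P : Polynomial ℝ := ∑ j ∈ Finset.range (m + 1),
    Polynomial.C ((N.choose j : ℝ) * ((fwdDiff 1)^[j] c) 0) *
      (Polynomial.C (1 / ((b : ℝ) - a)) * (Polynomial.X - Polynomial.C (a : ℝ))) ^ j with hP
  have hPdeg : P.natDegree ≤ m := by
    refine Polynomial.natDegree_sum_le_of_forall_le _ _ fun j hj => ?_
    have := Finset.mem_range.1 hj
    refine (Polynomial.natDegree_C_mul_le _ _).trans (Polynomial.natDegree_pow_le.trans ?_)
    have h2 : (Polynomial.C (1 / ((b : ℝ) - a)) *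
        (Polynomial.X - Polynomial.C (a : ℝ))).natDegree ≤ 1 :=
      (Polynomial.natDegree_C_mul_le _ _).trans (Polynomial.natDegree_X_sub_C_le _)
    calc j * _ ≤ j * 1 := Nat.mul_le_mul_left _ h2
      _ ≤ m := by omega
  have hrepr : ∀ t : I, bernExt N m c (((t : ℝ) - a) / (b - a)) * σ t =
      P.eval (t : ℝ) * σ t + ∫ u, Φ (t, u) ∂ν := by
    intro t
    rw [bernExt_eq (by omega), add_mul]
    congr 1
    · congr 1
      rw [hP, Polynomial.eval_finsetSum]
      refine Finset.sum_congr rfl fun j _ => ?_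
      simp only [Polynomial.eval_mul, Polynomial.eval_C, Polynomial.eval_pow, Polynomial.eval_sub,
        Polynomial.eval_X]
      congr 2
      ring
    · rw [intervalIntegral.integral_of_le zero_le_one, ← integral_mul_const]
  have hI1 : Integrable (fun t : I => ∫ u, Φ (t, u) ∂ν) τ := hΦi.integral_prod_left
  have hI2 : Integrable (fun t : I => P.eval (t : ℝ) * σ t) τ := by
    have h1 := ((h.integrable_bernExt N c hab).mul_sign h.measurable h.abs_eq_one).sub hI1
    refine h1.congr (Filter.Eventually.of_forall fun t => ?_)
    simp [hrepr t]
  simp only [hrepr]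
  rw [integral_add hI2 hI1, h.integral_eval_eq_zero P hPdeg, zero_add, integral_integral_swap hΦi]
  refine integral_nonneg_of_ae ?_
  filter_upwards [ae_restrict_mem measurableSet_Ioc] with u hu
  -- In the original variable the knot `u` becomes a point of `I`, where the truncated-power
  -- hypothesis applies.
  have hmem : (a : ℝ) + u * (b - a) ∈ I :=
    hI.out a.2 b.2 ⟨by nlinarith [hu.1], by nlinarith [hu.2]⟩
  have e : ∀ t : I, Φ (t, u) = q u / (m.factorial * ((b : ℝ) - a) ^ m) *
      (truncPow m ((t : ℝ) - (⟨(a : ℝ) + u * (b - a), hmem⟩ : I)) * σ t) := by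
    intro t
    simp only [hΦ]
    rw [show ((t : ℝ) - a) / (b - a) - u = ((t : ℝ) - (a + u * (b - a))) / (b - a) by
      field_simp; ring, truncPow_div hL]
    field_simp
  simp only [Pi.zero_apply, e]
  rw [integral_const_mul]
  exact mul_nonneg (div_nonneg (hq0 u hu.1.le hu.2) (by positivity)) (h.truncPow_nonneg ⟨_, hmem⟩)

end NonnegDensity

end Density

/-- A largest element gives a constant sequence; otherwise a dense sequence in `S` is already
cofinal, and partial suprema make it monotone. -/
theorem exists_monotone_cofinal_seq {S : Set ℝ} (hS : S.Nonempty) :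
    ∃ u : ℕ → ℝ, (∀ k, u k ∈ S) ∧ Monotone u ∧ ∀ s ∈ S, ∃ k, s ≤ u k := by
  obtain ⟨u, hu, hu'⟩ : ∃ u : ℕ → ℝ, (∀ k, u k ∈ S) ∧ ∀ s ∈ S, ∃ k, s ≤ u k := by
    by_cases hmax : ∃ x ∈ S, ∀ s ∈ S, s ≤ x
    · obtain ⟨x, hx, hxm⟩ := hmax
      exact ⟨fun _ => x, fun _ => hx, fun s hs => ⟨0, hxm s hs⟩⟩
    · push Not at hmax
      have : Nonempty S := hS.to_subtype
      refine ⟨fun k => (TopologicalSpace.denseSeq S k : ℝ), fun k => Subtype.property _,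
        fun s hs => ?_⟩
      obtain ⟨s', hs', hlt⟩ := hmax s hs
      obtain ⟨k, hk⟩ := (TopologicalSpace.denseRange_denseSeq S).exists_mem_open
        (isOpen_lt (continuous_const (y := s)) continuous_subtype_val) ⟨⟨s', hs'⟩, hlt⟩
      exact ⟨k, le_of_lt hk⟩
  refine ⟨fun k => partialSups u k, fun k => ?_, (partialSups u).monotone, fun s hs => ?_⟩
  · obtain ⟨j, -, hj⟩ := exists_partialSups_eq u k
    show partialSups u k ∈ S
    rw [hj]; exact hu j
  · obtain ⟨k, hk⟩ := hu' s hs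
    exact ⟨k, hk.trans (le_partialSups u k)⟩

/-- Continuity from above along a cofinal sequence: the tails decrease to the points beyond all of
`S`, a null set. -/
theorem exists_mem_measure_gt_le {X : Type*} [MeasurableSpace X] (ρ : Measure X) [IsFiniteMeasure ρ]
    {v : X → ℝ} (hv : Measurable v) {S : Set X} (hS : S.Nonempty)
    (h0 : ρ {t | ∀ s ∈ S, v s < v t} = 0) {δ : ENNReal} (hδ : 0 < δ) :
    ∃ b ∈ S, ρ {t | v b < v t} < δ := by
  obtain ⟨u, hu, hmono, hcof⟩ := exists_monotone_cofinal_seq (hS.image v)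
  have hanti : Antitone fun k => {t | u k < v t} := fun i j hij t ht =>
    lt_of_le_of_lt (hmono hij) ht
  have hlim := tendsto_measure_iInter_atTop (μ := ρ)
    (fun k => (measurableSet_lt measurable_const hv : MeasurableSet {t | u k < v t}).nullMeasurableSet)
    hanti ⟨0, measure_ne_top _ _⟩
  have hsub : (⋂ k, {t | u k < v t}) ⊆ {t | ∀ s ∈ S, v s < v t} := by
    intro t ht s hs
    obtain ⟨k, hk⟩ := hcof (v s) ⟨s, hs, rfl⟩
    exact hk.trans_lt (Set.mem_iInter.1 ht k)
  rw [measure_mono_null hsub h0] at hlim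
  obtain ⟨k, hk⟩ := (hlim.eventually (gt_mem_nhds hδ)).exists
  obtain ⟨b, hb, hbk⟩ := hu k
  refine ⟨b, hb, ?_⟩
  rw [hbk]
  exact hk

/-! ### Segments in an interval -/

section Segment

variable {I : Set ℝ}

open Classical in
/-- The affine parametrization of the segment from `a` to `b`. -/
noncomputable def seg (a b : I) (r : ℝ) : I :=
  if h : (a : ℝ) + r * (b - a) ∈ I then ⟨(a : ℝ) + r * (b - a), h⟩ else a

theorem coe_seg (hI : I.OrdConnected) {a b : I} (hab : (a : ℝ) ≤ b) {r : ℝ}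
    (hr : r ∈ Set.Icc (0 : ℝ) 1) : (seg a b r : ℝ) = a + r * (b - a) := by
  have : (a : ℝ) + r * (b - a) ∈ I := hI.out a.2 b.2
    ⟨by nlinarith [hr.1], by nlinarith [hr.2]⟩
  rw [seg, dif_pos this]

theorem continuousOn_seg (hI : I.OrdConnected) {a b : I} (hab : (a : ℝ) ≤ b) :
    ContinuousOn (seg a b) (Set.Icc 0 1) := by
  rw [Topology.IsInducing.subtypeVal.continuousOn_iff]
  have : ContinuousOn (fun r : ℝ => (a : ℝ) + r * (b - a)) (Set.Icc 0 1) := by fun_prop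
  exact this.congr fun r hr => coe_seg hI hab hr

theorem seg_mem_Icc (hI : I.OrdConnected) {a b : I} (hab : (a : ℝ) ≤ b) {r : ℝ}
    (hr : r ∈ Set.Icc (0 : ℝ) 1) : (a : ℝ) ≤ seg a b r ∧ (seg a b r : ℝ) ≤ b := by
  rw [coe_seg hI hab hr]
  exact ⟨by nlinarith [hr.1], by nlinarith [hr.2]⟩

theorem div_mem_Icc {k N : ℕ} (hk : k ≤ N) : (k : ℝ) / N ∈ Set.Icc (0 : ℝ) 1 :=
  ⟨by positivity, div_le_one_of_le₀ (by exact_mod_cast hk) (by positivity)⟩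

end Segment

/-! ### A uniform bound on a segment -/

section OneVariable

variable {I : Set ℝ} {m : ℕ} {C : Finset I} {f : I → ℝ}

/-- `f` or `-f` is `m`-convex. -/
def MConvexUpToSign (m : ℕ) (f : I → ℝ) : Prop :=
  MConvex (fun t : I => (t : ℝ)) m f ∨ MConvex (fun t : I => (t : ℝ)) m fun t => -f t

theorem MConvexUpToSign.le_of_forall (hf : MConvexUpToSign m f) (h0 : ∀ c ∈ C, f c = 0)
    {P : (I → ℝ) → Prop} (hP : ∀ g : I → ℝ, MConvex (fun t : I => (t : ℝ)) m g →
      (∀ c ∈ C, g c = 0) → P g) (hneg : P (fun t => -f t) → P f) : P f := by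
  rcases hf with h | h
  · exact hP f h h0
  · exact hneg (hP _ h fun c hc => by rw [h0 c hc, neg_zero])

/-- `K` does not depend on `f`, so in a family of sections it yields a dominating function built
from two slices. Up to the largest zero this is `abs_mul_prod_le`; beyond it, an `m`-convex function
is nonnegative and increasing, which accounts for the `+ 1`. -/
theorem exists_bound_on_segment (hC : C.card = m + 1) {a b c₁ : I} (hc₁ : c₁ ∈ C)
    (hmax : ∀ c ∈ C, (c : ℝ) ≤ c₁) (ha : ∀ c ∈ C, (a : ℝ) < c) :
    ∃ K : ℝ, 0 ≤ K ∧ ∀ f : I → ℝ, MConvexUpToSign m f → (∀ c ∈ C, f c = 0) →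
      ∀ t : I, (a : ℝ) ≤ t → (t : ℝ) ≤ b → |f t| ≤ K * (|f a| + |f b|) := by
  set Q := ∏ c ∈ C, |(a : ℝ) - c|
  have hQ : 0 < Q := Finset.prod_pos fun c hc => abs_pos.2 (by linarith [ha c hc])
  have hac : 0 ≤ (c₁ : ℝ) - a := by linarith [ha c₁ hc₁]
  refine ⟨((c₁ : ℝ) - a) ^ (m + 1) / Q + 1, by positivity, fun f hf h0 t hat htb => ?_⟩
  refine MConvexUpToSign.le_of_forall hf h0
    (P := fun f => |f t| ≤ (((c₁ : ℝ) - a) ^ (m + 1) / Q + 1) * (|f a| + |f b|))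
    (fun g hg hg0 => ?_) (by simp)
  have hr : 0 ≤ ((c₁ : ℝ) - a) ^ (m + 1) / Q := by positivity
  rcases le_or_gt (t : ℝ) c₁ with htc | htc
  · have := abs_mul_prod_le Subtype.val_injective hg hC hg0 hc₁ hmax ha hat htc
    have h1 : |g t| ≤ |g a| * (((c₁ : ℝ) - a) ^ (m + 1) / Q) := by
      rw [← mul_div_assoc, le_div_iff₀ hQ]
      exact this
    nlinarith [abs_nonneg (g a), abs_nonneg (g b), mul_nonneg hr (abs_nonneg (g b))]
  · have ht : ∀ c ∈ C, (c : ℝ) < t := fun c hc => (hmax c hc).trans_lt htc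
    have h1 := nonneg_of_right Subtype.val_injective hg hC hg0 ht
    have h2 := le_of_right Subtype.val_injective hg hC hg0 ht htb
    rw [abs_of_nonneg h1]
    have := le_abs_self (g b)
    nlinarith [abs_nonneg (g a), abs_nonneg (g b), mul_nonneg hr (abs_nonneg (g b)),
      mul_nonneg hr (abs_nonneg (g a))]

end OneVariable

/-! ### Bernstein approximation in one variable -/

section Step

variable {I : Set ℝ} {m : ℕ} {C : Finset I}

/-- The Bernstein operator on the segment from `a` to `b`, extended by Taylor polynomials. -/
noncomputable def bernOp (m N : ℕ) (a b : I) (f : I → ℝ) (t : ℝ) : ℝ :=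
  bernExt N m (fun k => f (seg a b ((k : ℝ) / N))) ((t - a) / (b - a))

theorem bernOp_neg (N : ℕ) (a b : I) (f : I → ℝ) (t : ℝ) :
    bernOp m N a b (fun s => -f s) t = -bernOp m N a b f t := by
  have := bernExt_const_mul N m (-1) (fun k => f (seg a b ((k : ℝ) / N))) ((t - a) / (b - a))
  simpa [bernOp] using this

theorem bernOp_eq_eval {N : ℕ} {a b : I} (hab : (a : ℝ) < b) (f : I → ℝ) {t : ℝ} (hat : (a : ℝ) ≤ t)
    (htb : t ≤ b) : bernOp m N a b f t =
      (bern N fun k => f (seg a b ((k : ℝ) / N))).eval ((t - a) / (b - a)) := by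
  have hL : 0 < (b : ℝ) - a := sub_pos.2 hab
  rw [bernOp, bernExt, if_neg (not_lt.2 (div_nonneg (by linarith) hL.le)),
    if_pos ((div_le_one hL).2 (by linarith))]

/-- An endpoint of `I` lying in the segment must be `a` or `b`, where Bernstein polynomials
interpolate; continuity is needed only elsewhere. -/
theorem tendsto_bernOp (hI : I.OrdConnected) {a b : I} (hab : (a : ℝ) < b) {f : I → ℝ} {B : ℝ}
    (hB : ∀ t : I, (a : ℝ) ≤ t → (t : ℝ) ≤ b → |f t| ≤ B) {t : I} (hat : (a : ℝ) ≤ t)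
    (htb : (t : ℝ) ≤ b) (hc : ContinuousAt f t ∨ (∀ s : I, s ≤ t) ∨ ∀ s : I, t ≤ s) :
    Filter.Tendsto (fun N => bernOp m N a b f t) Filter.atTop (nhds (f t)) := by
  have hL : 0 < (b : ℝ) - a := sub_pos.2 hab
  simp only [fun N => bernOp_eq_eval (m := m) (N := N) hab f hat htb]
  have hs : ((t : ℝ) - a) / (b - a) ∈ Set.Icc (0 : ℝ) 1 :=
    ⟨div_nonneg (by linarith) hL.le, (div_le_one hL).2 (by linarith)⟩
  have hseg : seg a b (((t : ℝ) - a) / (b - a)) = t := by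
    apply Subtype.ext
    rw [coe_seg hI hab.le hs]
    field_simp
    ring
  by_cases hcont : ContinuousAt f t
  · have := tendsto_bern_eval (fun r => f (seg a b r)) (K := B)
      (fun r hr => hB _ (seg_mem_Icc hI hab.le hr).1 (seg_mem_Icc hI hab.le hr).2) hs ?_
    · simpa only [hseg] using this
    · refine ContinuousAt.comp_continuousWithinAt ?_ (continuousOn_seg hI hab.le _ hs)
      rwa [hseg]
  · have hend : t = a ∨ t = b := by
      rcases hc.resolve_left hcont with h | h
      · exact Or.inr (le_antisymm htb (h b))
      · exact Or.inl (le_antisymm (h a) hat)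
    rcases hend with rfl | rfl
    · rw [sub_self, zero_div]
      refine tendsto_const_nhds.congr fun N => ?_
      rw [bern_eval_zero]
      congr 1
      apply Subtype.ext
      rw [coe_seg hI hab.le] <;> simp
    · rw [div_self hL.ne']
      refine tendsto_const_nhds.congr' ?_
      filter_upwards [Filter.eventually_gt_atTop 0] with N hN
      have hN' : (N : ℝ) ≠ 0 := Nat.cast_ne_zero.2 (by omega)
      rw [bern_eval_one]
      congr 1
      apply Subtype.ext
      rw [div_self hN', coe_seg hI hab.le] <;> simp

theorem abs_bernOp_le (hI : I.OrdConnected) {a b : I} (hab : (a : ℝ) < b) {f : I → ℝ} {B : ℝ}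
    (hB : ∀ t : I, (a : ℝ) ≤ t → (t : ℝ) ≤ b → |f t| ≤ B) {t : ℝ} (hat : (a : ℝ) ≤ t)
    (htb : t ≤ b) (N : ℕ) : |bernOp m N a b f t| ≤ B := by
  have hL : 0 < (b : ℝ) - a := sub_pos.2 hab
  rw [bernOp_eq_eval hab f hat htb]
  refine abs_bern_eval_le N _ (fun k hk => ?_) (div_nonneg (by linarith) hL.le)
    ((div_le_one hL).2 (by linarith))
  have := seg_mem_Icc hI hab.le (div_mem_Icc hk)
  exact hB _ this.1 this.2

/-- The comparison needs the `m + 1` grid points nearest the relevant end to lie beyond the zeros.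
They occupy a length `m / N * (b - a)`, so one `N₀` serves all functions with zeros on `C`. -/
theorem abs_bernOp_le_of_outside (hI : I.OrdConnected) (hC : C.card = m + 1) {a b : I}
    (hab : (a : ℝ) < b) (ha : ∀ c ∈ C, (a : ℝ) < c) : ∃ N₀, ∀ N ≥ N₀, ∀ f : I → ℝ,
      MConvexUpToSign m f → (∀ c ∈ C, f c = 0) → ∀ t : I,
      ((t : ℝ) < a ∨ (b : ℝ) < t ∧ ∀ c ∈ C, (c : ℝ) < b) → |bernOp m N a b f t| ≤ |f t| := by
  have hL : 0 < (b : ℝ) - a := sub_pos.2 hab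
  have hlim : Filter.Tendsto (fun N : ℕ => (m : ℝ) / N * (b - a)) Filter.atTop (nhds 0) := by
    simpa using (tendsto_const_div_atTop_nhds_zero_nat (m : ℝ)).mul_const ((b : ℝ) - a)
  have h1 : ∀ᶠ N : ℕ in Filter.atTop, ∀ c ∈ C, (m : ℝ) / N * (b - a) < c - a := by
    rw [Filter.eventually_all_finset]
    exact fun c hc => hlim.eventually (gt_mem_nhds (sub_pos.2 (ha c hc)))
  have h2 : ∀ᶠ N : ℕ in Filter.atTop, ∀ c ∈ C, (c : ℝ) < b → (m : ℝ) / N * (b - a) < b - c := by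
    rw [Filter.eventually_all_finset]
    intro c hc
    by_cases hcb : (c : ℝ) < b
    · filter_upwards [hlim.eventually (gt_mem_nhds (sub_pos.2 hcb))] with N hN _ using hN
    · exact Filter.Eventually.of_forall fun N h => absurd h hcb
  obtain ⟨N₀, hN₀⟩ := Filter.eventually_atTop.1
    (h1.and (h2.and ((Filter.eventually_ge_atTop m).and (Filter.eventually_ne_atTop 0))))
  refine ⟨N₀, fun N hN f hf h0 t ht => ?_⟩
  obtain ⟨hN1, hN2, hmN, hN0⟩ := hN₀ N hN
  refine MConvexUpToSign.le_of_forall hf h0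
    (P := fun f => |bernOp m N a b f t| ≤ |f t|) (fun g hg hg0 => ?_) (by simp [bernOp_neg])
  have hx : ∀ k ≤ N, ((seg a b ((k : ℝ) / N) : I) : ℝ) = a + k / N * (b - a) := fun k hk =>
    coe_seg hI hab.le (div_mem_Icc hk)
  rcases ht with ht | ⟨ht, hCb⟩
  · exact abs_bernExt_le_left Subtype.val_injective hg hC hg0 hmN hN0 hab _ hx
      (fun c hc => by linarith [hN1 c hc]) ht
  · exact abs_bernExt_le_right Subtype.val_injective hg hC hg0 hmN hN0 hab _ hx
      (fun c hc => by linarith [hN2 c hc (hCb c hc)]) ht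

theorem bernOp_eq_sum {N : ℕ} (hm : m ≤ N) (a b : I) (f : I → ℝ) (t : ℝ) :
    bernOp m N a b f t = ∑ k ∈ Finset.range (N + 1), f (seg a b ((k : ℝ) / N)) *
      bernExt N m (fun l => if l = k then 1 else 0) ((t - a) / (b - a)) :=
  bernExt_eq_sum hm _ _

theorem integral_bernOp_nonneg {τ : Measure I} [IsFiniteMeasure τ] {σ : I → ℝ}
    (h : NonnegDensity τ σ m) (hI : I.OrdConnected) {N : ℕ} (hN : m + 1 ≤ N) {a b : I}
    (hab : (a : ℝ) < b) {g : I → ℝ} (hg : MConvex (fun t : I => (t : ℝ)) m g) :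
    0 ≤ ∫ t : I, bernOp m N a b g t * σ t ∂τ := by
  have hNpos : (0 : ℝ) < N := Nat.cast_pos.2 (by omega)
  have hL : 0 < (b : ℝ) - a := sub_pos.2 hab
  refine h.integral_bernExt_nonneg hI hN (fun k hk => ?_) hab
  refine hg.fwdDiff_nonneg Subtype.val_injective (α := a) (h := ((b : ℝ) - a) / N) (by positivity)
    (fun k => seg a b ((k : ℝ) / N)) (fun k hk => ?_) hk
  rw [coe_seg hI hab.le (div_mem_Icc hk)]
  ring

/-- Choice of a segment outside of which `ρ` has little mass. -/
theorem exists_segment {τ ρ : Measure I} [IsFiniteMeasure ρ] (hρ : ρ ≪ τ) (hC : C.Nonempty)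
    (hleft : τ {t | ∀ c ∈ C, t < c} ≠ 0) {G : Set I} (hG : ∀ᵐ t ∂τ, t ∈ G) (hCG : ∀ c ∈ C, c ∈ G)
    {δ : ENNReal} (hδ : 0 < δ) :
    ∃ a b : I, a ∈ G ∧ b ∈ G ∧ (∀ c ∈ C, (a : ℝ) < c) ∧ (∀ c ∈ C, (c : ℝ) ≤ b) ∧
      ρ {t | (t : ℝ) < a} < δ ∧ ρ {t | (b : ℝ) < t} < δ ∧
      ((∀ c ∈ C, (c : ℝ) < b) ∨ τ {t | (b : ℝ) < t} = 0) := by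
  have hne : ({t | t ∈ G ∧ ∀ c ∈ C, t < c} : Set I).Nonempty := by
    by_contra hempty
    rw [Set.not_nonempty_iff_eq_empty] at hempty
    apply hleft
    refine measure_mono_null (t := {t | t ∉ G}) (fun t ht htG => ?_) (ae_iff.1 hG)
    exact (Set.eq_empty_iff_forall_notMem.1 hempty t) ⟨htG, ht⟩
  have hL : ρ {t | ∀ s ∈ {t | t ∈ G ∧ ∀ c ∈ C, t < c}, -(s : ℝ) < -t} = 0 := by
    apply hρ
    refine measure_mono_null (t := {t | t ∉ G}) (fun t ht htG => ?_) (ae_iff.1 hG)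
    obtain ⟨s, hs⟩ := hne
    have h1 : (t : ℝ) < s := neg_lt_neg_iff.1 (ht s hs)
    exact lt_irrefl _ (ht t ⟨htG, fun c hc => lt_trans (show t < s from h1) (hs.2 c hc)⟩)
  obtain ⟨a, ⟨haG, haC⟩, ha⟩ := exists_mem_measure_gt_le ρ (v := fun t : I => -(t : ℝ))
    (by fun_prop) hne hL hδ
  obtain ⟨c₁, hc₁, hmax⟩ := C.exists_max_image id hC
  have key : ∃ b ∈ G, (∀ c ∈ C, (c : ℝ) ≤ b) ∧ ρ {t | (b : ℝ) < t} < δ ∧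
      ((∀ c ∈ C, (c : ℝ) < b) ∨ τ {t | (b : ℝ) < t} = 0) := by
    by_cases hne : ({t | t ∈ G ∧ c₁ < t} : Set I).Nonempty
    · have hU : ρ {t | ∀ s ∈ {t | t ∈ G ∧ c₁ < t}, (s : ℝ) < t} = 0 := by
        apply hρ
        refine measure_mono_null (t := {t | t ∉ G}) (fun t ht htG => ?_) (ae_iff.1 hG)
        obtain ⟨s, hs⟩ := hne
        have h1 : s < t := ht s hs
        exact lt_irrefl (t : ℝ) (ht t ⟨htG, hs.2.trans h1⟩)
      obtain ⟨b, ⟨hbG, hb⟩, hb'⟩ := exists_mem_measure_gt_le ρ (v := fun t : I => (t : ℝ))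
        (by fun_prop) hne hU hδ
      refine ⟨b, hbG, fun c hc => ?_, hb', Or.inl fun c hc => ?_⟩
      · exact_mod_cast (hmax c hc).trans hb.le
      · exact_mod_cast (hmax c hc).trans_lt hb
    · have h0 : τ {t | (c₁ : ℝ) < t} = 0 := by
        refine measure_mono_null (t := {t | t ∉ G}) (fun t ht htG => ?_) (ae_iff.1 hG)
        exact hne ⟨t, htG, ht⟩
      -- If no admissible point lies beyond the largest node, no mass of `τ` does either, and the
      -- segment may end at that node.
      exact ⟨c₁, hCG c₁ hc₁, fun c hc => hmax c hc, by rwa [hρ h0], Or.inr h0⟩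
  obtain ⟨b, h1, h2, h3, h4⟩ := key
  refine ⟨a, b, haG, h1, fun c hc => haC c hc, h2, ?_, h3, h4⟩
  simpa using ha

end Step

section Step

variable {I : Set ℝ} {m : ℕ} {C : Finset I} {τ : Measure I} [IsFiniteMeasure τ] {σ : I → ℝ}
  {Y : Type*} [MeasurableSpace Y] {μ : Measure Y} {F : Y → I → ℝ}

theorem NonnegDensity.integrable_bernOp (h : NonnegDensity τ σ m) {N : ℕ} (hN : m ≤ N) {a b : I}
    (hab : (a : ℝ) < b) (hF : ∀ k ≤ N, Integrable (fun y => F y (seg a b ((k : ℝ) / N))) μ) :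
    Integrable (fun p : Y × I => bernOp m N a b (F p.1) p.2) (μ.prod τ) := by
  simp only [bernOp_eq_sum hN]
  refine integrable_finsetSum _ fun k hk => ?_
  exact Integrable.mul_prod (hF k (by have := Finset.mem_range.1 hk; omega))
    (h.integrable_bernExt N _ hab)

/-- The operator is a finite sum of tensor products, so the variables separate; the resulting
coefficients are the weights of the discrete functional. -/
theorem NonnegDensity.integral_bernOp_mul [SFinite μ] (h : NonnegDensity τ σ m) {N : ℕ} (hN : m ≤ N) {a b : I}
    (hab : (a : ℝ) < b) (hF : ∀ k ≤ N, Integrable (fun y => F y (seg a b ((k : ℝ) / N))) μ)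
    {ψ : Y → ℝ} (hψ : Measurable ψ) (hψ1 : ∀ y, |ψ y| = 1) :
    ∫ p : Y × I, bernOp m N a b (F p.1) p.2 * (ψ p.1 * σ p.2) ∂(μ.prod τ) =
      ∫ y, (∑ k ∈ Finset.range (N + 1),
        (∫ t : I, bernExt N m (fun l => if l = k then 1 else 0) (((t : ℝ) - a) / (b - a)) * σ t ∂τ) *
          F y (seg a b ((k : ℝ) / N))) * ψ y ∂μ := by
  have e : ∀ p : Y × I, bernOp m N a b (F p.1) p.2 * (ψ p.1 * σ p.2) =
      ∑ k ∈ Finset.range (N + 1), (F p.1 (seg a b ((k : ℝ) / N)) * ψ p.1) *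
        (bernExt N m (fun l => if l = k then 1 else 0) (((p.2 : ℝ) - a) / (b - a)) * σ p.2) := by
    intro p
    rw [bernOp_eq_sum hN, Finset.sum_mul]
    exact Finset.sum_congr rfl fun k _ => by ring
  have hFψ : ∀ k ∈ Finset.range (N + 1),
      Integrable (fun y => F y (seg a b ((k : ℝ) / N)) * ψ y) μ := fun k hk =>
    (hF k (by have := Finset.mem_range.1 hk; omega)).mul_sign hψ hψ1
  simp only [e]
  rw [integral_finsetSum]
  · simp only [Finset.sum_mul]
    rw [integral_finsetSum]
    · refine Finset.sum_congr rfl fun k hk => ?_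
      rw [integral_prod_mul (fun y => F y (seg a b ((k : ℝ) / N)) * ψ y)
        (fun t : I => bernExt N m (fun l => if l = k then 1 else 0) (((t : ℝ) - a) / (b - a)) * σ t),
        mul_comm, ← integral_const_mul]
      exact integral_congr_ae (Filter.Eventually.of_forall fun y => by ring)
    · intro k hk
      refine ((hFψ k hk).const_mul (∫ t : I, bernExt N m (fun l => if l = k then 1 else 0)
        (((t : ℝ) - a) / (b - a)) * σ t ∂τ)).congr ?_
      exact Filter.Eventually.of_forall fun y => by ring
  · intro k hk
    exact (hFψ k hk).mul_prod
      ((h.integrable_bernExt N _ hab).mul_sign h.measurable h.abs_eq_one)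

/-- In one variable, the integral against `σ • τ` is approximated by finitely supported functionals
that are nonnegative on `m`-convex functions, for a family of functions that are `m`-convex up to
sign and vanish at `m + 1` common points. -/
theorem exists_discrete_approx [SFinite μ] (hI : I.OrdConnected) (h : NonnegDensity τ σ m)
    (hC : C.card = m + 1) (hleft : τ {t | ∀ c ∈ C, t < c} ≠ 0)
    (hconv : ∀ y, MConvexUpToSign m (F y)) (h0 : ∀ y, ∀ c ∈ C, F y c = 0)
    (hmeas : ∀ t, AEStronglyMeasurable (fun y => F y t) μ)
    (hint : Integrable (fun p : Y × I => F p.1 p.2) (μ.prod τ))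
    (hcont : ∀ y t, ContinuousAt (F y) t ∨ (∀ s : I, s ≤ t) ∨ ∀ s : I, t ≤ s)
    {ψ : Y → ℝ} (hψ : Measurable ψ) (hψ1 : ∀ y, |ψ y| = 1) {ε : ℝ} (hε : 0 < ε) :
    ∃ (S : Finset ℕ) (x : ℕ → I) (α : ℕ → ℝ),
      (∀ g : I → ℝ, MConvex (fun t : I => (t : ℝ)) m g → 0 ≤ ∑ k ∈ S, α k * g (x k)) ∧
      (∀ k ∈ S, Integrable (fun y => F y (x k)) μ) ∧
      |∫ p : Y × I, F p.1 p.2 * (ψ p.1 * σ p.2) ∂(μ.prod τ) -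
        ∫ y, (∑ k ∈ S, α k * F y (x k)) * ψ y ∂μ| ≤ ε := by
  have hCne : C.Nonempty := Finset.card_pos.1 (by omega)
  -- `ρ B` is the `L¹` mass of `F` over `Y × B`; making it small outside the segment makes the tails
  -- of `F` small uniformly in `N`.
  set ρ : Measure I := ((μ.prod τ).withDensity fun p => ‖F p.1 p.2‖ₑ).map Prod.snd with hρdef
  have hfin : IsFiniteMeasure ((μ.prod τ).withDensity fun p => ‖F p.1 p.2‖ₑ) :=
    isFiniteMeasure_withDensity hint.2.ne
  have hρ : ρ ≪ τ := by
    refine Measure.AbsolutelyContinuous.mk fun s hs hs0 => ?_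
    rw [hρdef, Measure.map_apply measurable_snd hs]
    refine withDensity_absolutelyContinuous _ _ ?_
    exact Measure.quasiMeasurePreserving_snd.preimage_null hs0
  have hG : ∀ᵐ t ∂τ, t ∈ {t | Integrable (fun y => F y t) μ} := hint.prod_left_ae
  -- The endpoints have integrable slices, as the dominating function requires, and two tails of
  -- mass `ε / 8` give the `ε / 4` below.
  obtain ⟨a, b, haG, hbG, haC, hCb, hρa, hρb, hb⟩ := exists_segment hρ hCne hleft hG
    (fun c hc => by
      simp only [Set.mem_ofPred_eq, h0 _ c hc]
      exact integrable_zero _ _ _) (δ := ENNReal.ofReal (ε / 8)) (by simpa using hε)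
  simp only [Set.mem_ofPred_eq] at haG hbG
  have hab : (a : ℝ) < b := by
    obtain ⟨c, hc⟩ := hCne
    exact (haC c hc).trans_le (hCb c hc)
  obtain ⟨c₁, hc₁, hmax⟩ := C.exists_max_image id hCne
  obtain ⟨K, hK0, hK⟩ := exists_bound_on_segment (m := m) (b := b) hC hc₁ (fun c hc => hmax c hc) haC
  have hKF : ∀ y (t : I), (a : ℝ) ≤ t → (t : ℝ) ≤ b → |F y t| ≤ K * (|F y a| + |F y b|) :=
    fun y t => hK (F y) (hconv y) (h0 y) t
  have hsegint : ∀ N k : ℕ, k ≤ N → Integrable (fun y => F y (seg a b ((k : ℝ) / N))) μ := by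
    intro N k hk
    refine Integrable.mono' ((haG.abs.add hbG.abs).const_mul K) (hmeas _)
      (Filter.Eventually.of_forall fun y => ?_)
    have := seg_mem_Icc hI hab.le (div_mem_Icc hk)
    exact hKF y _ this.1 this.2
  obtain ⟨N₀, hN₀⟩ := abs_bernOp_le_of_outside (m := m) hI hC hab haC
  set A : Set (Y × I) := {p | (a : ℝ) ≤ p.2 ∧ (p.2 : ℝ) ≤ b} with hA
  have hAm : MeasurableSet A := by
    apply MeasurableSet.inter
    · exact measurableSet_le measurable_const (measurable_subtype_coe.comp measurable_snd)
    · exact measurableSet_le (measurable_subtype_coe.comp measurable_snd) measurable_const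
  -- the part outside of the segment
  have hout : ∫ p in Aᶜ, |F p.1 p.2| ∂(μ.prod τ) ≤ ε / 4 := by
    have h1 : ENNReal.ofReal (∫ p in Aᶜ, |F p.1 p.2| ∂(μ.prod τ)) ≤
        ρ {t | (t : ℝ) < a} + ρ {t | (b : ℝ) < t} := by
      rw [ofReal_integral_eq_lintegral_ofReal hint.abs.integrableOn
        (Filter.Eventually.of_forall fun _ => abs_nonneg _)]
      have e : Aᶜ = Prod.snd ⁻¹' ({t : I | (t : ℝ) < a} ∪ {t : I | (b : ℝ) < t}) := by
        ext p
        simp only [hA, Set.mem_compl_iff, Set.mem_ofPred_eq, not_and_or, not_le, Set.mem_preimage,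
          Set.mem_union]
      have hm : MeasurableSet ({t : I | (t : ℝ) < a} ∪ {t : I | (b : ℝ) < t}) :=
        (measurableSet_lt (by fun_prop) measurable_const).union
          (measurableSet_lt measurable_const (by fun_prop))
      refine le_trans (le_of_eq ?_) (measure_union_le _ _)
      rw [hρdef, Measure.map_apply measurable_snd hm, e,
        withDensity_apply _ (measurable_snd hm)]
      exact lintegral_congr fun p => by rw [Real.enorm_eq_ofReal_abs]
    have h2 : ENNReal.ofReal (∫ p in Aᶜ, |F p.1 p.2| ∂(μ.prod τ)) ≤ ENNReal.ofReal (ε / 4) := by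
      refine h1.trans ((add_le_add hρa.le hρb.le).trans ?_)
      rw [← ENNReal.ofReal_add (by positivity) (by positivity)]
      exact ENNReal.ofReal_le_ofReal (by linarith)
    exact (ENNReal.ofReal_le_ofReal_iff (by positivity)).1 h2
  -- When the segment ends at a node, the domination to its right is unavailable but also not
  -- needed.
  have hbnull : ∀ᵐ p ∂(μ.prod τ), (b : ℝ) < p.2 → ∀ c ∈ C, (c : ℝ) < b := by
    rcases hb with hb | hb
    · exact Filter.Eventually.of_forall fun p _ => hb
    · have h1 : ∀ᵐ t : I ∂τ, ¬ (b : ℝ) < (t : ℝ) := measure_eq_zero_iff_ae_notMem.1 hb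
      filter_upwards [Measure.quasiMeasurePreserving_snd.ae h1] with p hp h'
      exact absurd h' hp
  -- the part inside of the segment
  set T : ℕ → Y × I → ℝ := fun N p => bernOp m N a b (F p.1) p.2 with hT
  have hTint : ∀ N, m ≤ N → Integrable (T N) (μ.prod τ) := fun N hN =>
    h.integrable_bernOp hN hab (hsegint N)
  have hlim : Filter.Tendsto (fun N => ∫ p, A.indicator (fun p => |F p.1 p.2 - T N p|) p ∂(μ.prod τ))
      Filter.atTop (nhds 0) := by
    have := tendsto_integral_filter_of_dominated_convergence (μ := μ.prod τ) (l := Filter.atTop)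
      (F := fun N p => A.indicator (fun p => |F p.1 p.2 - T N p|) p) (f := fun _ => (0 : ℝ))
      (fun p => 2 * (K * (|F p.1 a| + |F p.1 b|))) ?_ ?_ ?_ ?_
    · simpa using this
    · filter_upwards [Filter.eventually_ge_atTop m] with N hN
      exact ((hint.sub (hTint N hN)).abs.1).indicator hAm
    · refine Filter.Eventually.of_forall fun N => Filter.Eventually.of_forall fun p => ?_
      have hnn : 0 ≤ K * (|F p.1 a| + |F p.1 b|) := by positivity
      by_cases hp : p ∈ A
      · rw [Set.indicator_of_mem hp, Real.norm_eq_abs, abs_abs]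
        have h1 := hKF p.1 p.2 hp.1 hp.2
        have h2 := abs_bernOp_le (m := m) hI hab (hKF p.1) hp.1 hp.2 N
        have h3 := abs_sub (F p.1 p.2) (T N p)
        simp only [hT] at h3 ⊢
        linarith
      · rw [Set.indicator_of_notMem hp, norm_zero]
        linarith
    · exact (((haG.abs.add hbG.abs).const_mul K).const_mul 2).comp_fst τ
    · refine Filter.Eventually.of_forall fun p => ?_
      by_cases hp : p ∈ A
      · simp only [Set.indicator_of_mem hp]
        have h1 := tendsto_bernOp (m := m) hI hab (hKF p.1) hp.1 hp.2 (hcont p.1 p.2)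
        have h2 := (h1.const_sub (F p.1 p.2)).abs
        simpa using h2
      · simp only [Set.indicator_of_notMem hp]
        exact tendsto_const_nhds
  obtain ⟨N, hN1, hN2, hN3⟩ := ((hlim.eventually (gt_mem_nhds (half_pos hε))).and
    ((Filter.eventually_ge_atTop N₀).and (Filter.eventually_ge_atTop (m + 1)))).exists
  refine ⟨Finset.range (N + 1), fun k => seg a b ((k : ℝ) / N),
    fun k => ∫ t : I, bernExt N m (fun l => if l = k then 1 else 0) (((t : ℝ) - a) / (b - a)) * σ t ∂τ,
    fun g hg => ?_, fun k hk => hsegint N k (by have := Finset.mem_range.1 hk; omega), ?_⟩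
  · have e : ∫ t : I, bernOp m N a b g t * σ t ∂τ = ∑ k ∈ Finset.range (N + 1),
        (∫ t : I, bernExt N m (fun l => if l = k then 1 else 0) (((t : ℝ) - a) / (b - a)) *
          σ t ∂τ) * g (seg a b ((k : ℝ) / N)) := by
      simp only [bernOp_eq_sum (show m ≤ N by omega), Finset.sum_mul]
      rw [integral_finsetSum]
      · refine Finset.sum_congr rfl fun k _ => ?_
        rw [← integral_mul_const]
        exact integral_congr_ae (Filter.Eventually.of_forall fun t => by ring)
      · intro k _
        refine (((h.integrable_bernExt N _ hab).mul_sign h.measurable h.abs_eq_one).const_mul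
          (g (seg a b ((k : ℝ) / N)))).congr (Filter.Eventually.of_forall fun t => by ring)
    rw [← e]
    exact integral_bernOp_nonneg h hI hN3 hab hg
  · rw [← h.integral_bernOp_mul (show m ≤ N by omega) hab (hsegint N) hψ hψ1]
    have hm1 : ∀ g : Y × I → ℝ, Integrable g (μ.prod τ) →
        Integrable (fun p => g p * (ψ p.1 * σ p.2)) (μ.prod τ) := fun g hg =>
      hg.mul_sign ((hψ.comp measurable_fst).mul (h.measurable.comp measurable_snd)) fun p => by
        rw [abs_mul, hψ1, h.abs_eq_one, mul_one]
    have hTN := hTint N (by omega)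
    rw [← integral_sub (hm1 _ hint) (hm1 _ hTN)]
    have hdiff : Integrable (fun p => F p.1 p.2 - T N p) (μ.prod τ) := hint.sub hTN
    have hI1 : Integrable (A.indicator fun p => |F p.1 p.2 - T N p|) (μ.prod τ) :=
      hdiff.abs.indicator hAm
    have hI2 : Integrable (Aᶜ.indicator fun p => |F p.1 p.2|) (μ.prod τ) :=
      hint.abs.indicator hAm.compl
    refine abs_integral_le_integral_abs.trans ?_
    -- Inside, dominated convergence gives less than `ε / 2`; outside, the approximant is dominated
    -- by `F`, so the error is at most twice a tail of mass `ε / 4`.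
    refine (integral_mono_ae (g := fun p => A.indicator (fun p => |F p.1 p.2 - T N p|) p +
      2 * Aᶜ.indicator (fun p => |F p.1 p.2|) p) ?_ (hI1.add (hI2.const_mul 2)) ?_).trans ?_
    · exact ((hm1 _ hint).sub (hm1 _ hTN)).abs
    · filter_upwards [hbnull] with p hp
      have e : |F p.1 p.2 * (ψ p.1 * σ p.2) - T N p * (ψ p.1 * σ p.2)| = |F p.1 p.2 - T N p| := by
        rw [← sub_mul, abs_mul, abs_mul, hψ1, h.abs_eq_one, mul_one, mul_one]
      refine (le_of_eq e).trans ?_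
      by_cases hpA : p ∈ A
      · simp [hpA]
      · have hpA' : p ∈ Aᶜ := hpA
        simp only [Set.indicator_of_notMem hpA, Set.indicator_of_mem hpA', zero_add]
        have h1 : |T N p| ≤ |F p.1 p.2| := by
          refine hN₀ N hN2 (F p.1) (hconv p.1) (h0 p.1) p.2 ?_
          simp only [hA, Set.mem_ofPred_eq, not_and_or, not_le] at hpA
          exact hpA.imp_right fun h' => ⟨h', hp h'⟩
        linarith [abs_sub (F p.1 p.2) (T N p)]
    · rw [integral_add hI1 (hI2.const_mul 2), integral_const_mul, integral_indicator hAm.compl]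
      linarith

end Step

/-! ### Existence of interpolation nodes -/

section Nodes

variable {I : Set ℝ} {m : ℕ} {τ : Measure I} {σ : I → ℝ}

/-- On a support of at most `m + 1` points, a Lagrange basis polynomial has degree at most `m` and
isolates one atom, so the vanishing moments kill each atom. -/
theorem NonnegDensity.eq_zero_of_finite_support [IsFiniteMeasure τ] (h : NonnegDensity τ σ m) {D : Finset I}
    (hD : D.card ≤ m + 1) (hτ : ∀ᵐ t ∂τ, t ∈ D) : τ = 0 := by
  have hpt : ∀ d ∈ D, τ {d} = 0 := by
    intro d hd
    set P : Polynomial ℝ := Lagrange.basis D (fun t : I => (t : ℝ)) d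
    have hinj : Set.InjOn (fun t : I => (t : ℝ)) (D : Set I) := Subtype.val_injective.injOn
    have hdeg : P.natDegree ≤ m := by
      rw [show P.natDegree = D.card - 1 from Lagrange.natDegree_basis hinj hd]
      omega
    have h1 := h.integral_eval_eq_zero P hdeg
    have h2 : ∀ᵐ t : I ∂τ, P.eval (t : ℝ) * σ t = ({d} : Set I).indicator (fun _ => σ d) t := by
      filter_upwards [hτ] with t ht
      by_cases htd : t = d
      · subst htd
        rw [Set.indicator_of_mem (Set.mem_singleton t), Lagrange.eval_basis_self hinj hd, one_mul]
      · have := Lagrange.eval_basis_of_ne (v := fun t : I => (t : ℝ)) (Ne.symm htd) ht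
        rw [Set.indicator_of_notMem (by simpa using htd), this, zero_mul]
    rw [integral_congr_ae h2, integral_indicator (measurableSet_singleton d), setIntegral_const,
      smul_eq_mul, mul_eq_zero] at h1
    rcases h1 with h1 | h1
    · exact (measureReal_eq_zero_iff).1 h1
    · have := h.abs_eq_one d
      rw [h1] at this
      simp at this
  have h3 : τ (D : Set I) = 0 := by
    rw [← Set.biUnion_of_singleton (D : Set I)]
    exact (measure_biUnion_null_iff D.countable_toSet).2 hpt
  have h4 : τ (D : Set I)ᶜ = 0 := ae_iff.1 hτ
  rw [← Measure.measure_univ_eq_zero, ← Set.union_compl_self (D : Set I)]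
  exact measure_union_null h3 h4

/-- Points without mass to their left form an initial segment; countably many null rays `Set.Iio s`
cover it, except possibly for a largest element. -/
theorem exists_ae_eq_of_measure_Iio_eq_zero (hτ : τ ≠ 0) :
    ∃ d : I, ∀ᵐ t ∂τ, τ (Set.Iio t) = 0 → t = d := by
  set A : Set I := {t | τ (Set.Iio t) = 0}
  have hne : Nonempty I := by
    by_contra hempty
    rw [not_nonempty_iff] at hempty
    exact hτ (Measure.eq_zero_of_isEmpty τ)
  rcases A.eq_empty_or_nonempty with hA | hA
  · refine ⟨hne.some, Filter.Eventually.of_forall fun t ht => ?_⟩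
    exact absurd ht (Set.eq_empty_iff_forall_notMem.1 hA t)
  · obtain ⟨u, hu, -, hcof⟩ := exists_monotone_cofinal_seq (hA.image (fun t : I => (t : ℝ)))
    have h1 : ∀ᵐ t : I ∂τ, ∀ k, ¬ (t : ℝ) < u k := by
      rw [ae_all_iff]
      intro k
      obtain ⟨s, hs, hsk⟩ := hu k
      rw [← hsk]
      exact measure_eq_zero_iff_ae_notMem.1 (show τ (Set.Iio s) = 0 from hs)
    by_cases hd : ∃ d ∈ A, ∀ k, u k ≤ (d : ℝ)
    · obtain ⟨d, hdA, hd⟩ := hd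
      refine ⟨d, h1.mono fun t ht htA => Subtype.ext (le_antisymm ?_ ?_)⟩
      · obtain ⟨k, hk⟩ := hcof _ ⟨t, htA, rfl⟩
        exact hk.trans (hd k)
      · obtain ⟨k, hk⟩ := hcof _ ⟨d, hdA, rfl⟩
        exact hk.trans (not_lt.1 (ht k))
    · refine ⟨hne.some, h1.mono fun t ht htA => absurd ⟨t, htA, fun k => not_lt.1 (ht k)⟩ hd⟩

/-- Any set of full measure contains `m + 1` nodes with some mass strictly to their left. -/
theorem NonnegDensity.exists_nodes [IsFiniteMeasure τ] (h : NonnegDensity τ σ m) (hτ : τ ≠ 0) {G : Set I}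
    (hG : ∀ᵐ t ∂τ, t ∈ G) :
    ∃ C : Finset I, C.card = m + 1 ∧ (∀ c ∈ C, c ∈ G) ∧ τ {t | ∀ c ∈ C, t < c} ≠ 0 := by
  set G' : Set I := {t | t ∈ G ∧ τ (Set.Iio t) ≠ 0}
  have key : ∃ C : Finset I, (C : Set I) ⊆ G' ∧ C.card = m + 1 := by
    by_contra hno
    have hfin : G'.Finite := by
      by_contra hinf
      obtain ⟨C, hC, hcard⟩ := (show G'.Infinite from hinf).exists_subset_card_eq (m + 1)
      exact hno ⟨C, hC, hcard⟩
    have hcard : hfin.toFinset.card ≤ m := by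
      by_contra hlt
      obtain ⟨C, hC, hcard⟩ := Finset.exists_subset_card_eq (show m + 1 ≤ _ from not_le.1 hlt)
      exact hno ⟨C, fun t ht => hfin.mem_toFinset.1 (hC ht), hcard⟩
    obtain ⟨d, hd⟩ := exists_ae_eq_of_measure_Iio_eq_zero hτ
    -- With at most `m` candidates, almost all mass would sit on them and the one exceptional point
    -- `d`: at most `m + 1` points.
    refine hτ (h.eq_zero_of_finite_support (D := insert d hfin.toFinset)
      ((Finset.card_insert_le _ _).trans (by omega)) ?_)
    filter_upwards [hd, hG] with t ht htG
    by_cases h0 : τ (Set.Iio t) = 0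
    · simp [ht h0]
    · exact Finset.mem_insert_of_mem (hfin.mem_toFinset.2 ⟨htG, h0⟩)
  obtain ⟨C, hC, hcard⟩ := key
  refine ⟨C, hcard, fun c hc => (hC hc).1, ?_⟩
  obtain ⟨c₀, hc₀, hmin⟩ := C.exists_min_image id (Finset.card_pos.1 (by omega))
  have e : {t : I | ∀ c ∈ C, t < c} = Set.Iio c₀ := by
    ext t
    exact ⟨fun ht => ht c₀ hc₀, fun ht c hc => lt_of_lt_of_le ht (hmin c hc)⟩
  rw [e]
  exact (hC hc₀).2

end Nodes

/-! ### Interior continuity of `m`-convex functions -/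

section Continuity

variable {I : Set ℝ} {m : ℕ} {f : I → ℝ}

theorem exists_finset_between (hI : I.OrdConnected) {p q : I} (hpq : p < q) (n : ℕ) :
    ∃ Z : Finset I, Z.card = n ∧ ∀ z ∈ Z, p < z ∧ z < q := by
  have hinf : ((fun t : I => (t : ℝ)) ⁻¹' Set.Ioo (p : ℝ) q).Infinite := by
    refine (Set.Ioo_infinite (show (p : ℝ) < q from hpq)).preimage fun x hx => ?_
    exact ⟨⟨x, hI.out p.2 q.2 ⟨hx.1.le, hx.2.le⟩⟩, rfl⟩
  obtain ⟨Z, hZ, hcard⟩ := hinf.exists_subset_card_eq n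
  exact ⟨Z, hcard, fun z hz => hZ hz⟩

theorem MConvex.dd_insert_le (hf : MConvex (fun t : I => (t : ℝ)) m f) {Z : Finset I}
    (hZ : Z.card = m) {x y : I} (hx : x ∉ Z) (hy : y ∉ Z) (hxy : x ≤ y) :
    dd (fun t : I => (t : ℝ)) (insert x Z) f ≤ dd (fun t : I => (t : ℝ)) (insert y Z) f := by
  rcases hxy.eq_or_lt with rfl | hlt
  · exact le_rfl
  have e := dd_insert_insert (f := f) (v := fun t : I => (t : ℝ)) Subtype.val_injective
    hlt.ne' hy hx
  have h1 : 0 ≤ dd (fun t : I => (t : ℝ)) (insert y (insert x Z)) f := by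
    apply hf
    rw [Finset.card_insert_of_notMem (by simp [hlt.ne', hy]), Finset.card_insert_of_notMem hx, hZ]
  have h2 : (0 : ℝ) ≤ (y : ℝ) - x := sub_nonneg.2 hlt.le
  have := mul_nonneg h2 h1
  linarith

/-- A one-sided comparison function touching an `m`-convex function at `t`. -/
theorem MConvex.exists_comparison (hf : MConvex (fun t : I => (t : ℝ)) m f) {Z : Finset I}
    (hZ : Z.card = m) {t : I} (ht : t ∉ Z) {s : ℝ} (hs : 0 < s * ∏ z ∈ Z, ((t : ℝ) - z)) :
    ∃ g : I → ℝ, Filter.Tendsto g (nhds t) (nhds (f t)) ∧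
      ∀ᶠ y in nhds t, (t ≤ y → s * g y ≤ s * f y) ∧ (y ≤ t → s * f y ≤ s * g y) := by
  set D := dd (fun t : I => (t : ℝ)) (insert t Z) f with hD
  set w : I → ℝ := fun y => ∏ z ∈ Z, ((y : ℝ) - z) with hw
  set R : I → ℝ := fun y => ∑ i ∈ Z, ((i : ℝ) - y)⁻¹ *
    Lagrange.nodalWeight Z (fun t : I => (t : ℝ)) i * f i with hR
  have hwc : Continuous w := by fun_prop
  have hRc : ContinuousAt R t := by
    refine tendsto_finsetSum _ fun i hi => ?_
    have h1 : (i : ℝ) - t ≠ 0 := sub_ne_zero.2 fun h => ht (Subtype.ext h ▸ hi)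
    have h2 : ContinuousAt (fun y : I => ((i : ℝ) - y)⁻¹) t :=
      ContinuousAt.inv₀ (by fun_prop) h1
    exact (h2.mul continuousAt_const).mul continuousAt_const
  -- Solving for `f y` gives `w y * (dd - R y)`, where the difference is monotone in `y`. Freezing
  -- it at its value `D` at `t` gives the comparison function.
  have hexp : ∀ y, y ∉ Z → w y ≠ 0 →
      dd (fun t : I => (t : ℝ)) (insert y Z) f = (w y)⁻¹ * f y + R y := by
    intro y hy _
    rw [dd_insert hy, Finset.prod_inv_distrib]
  have hwt : w t ≠ 0 := fun h0 => by simp only [hw] at h0; simp [h0] at hs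
  refine ⟨fun y => w y * (D - R y), ?_, ?_⟩
  · have h1 : Filter.Tendsto (fun y => w y * (D - R y)) (nhds t) (nhds (w t * (D - R t))) :=
      hwc.continuousAt.mul (continuousAt_const.sub hRc)
    convert h1 using 2
    rw [hD, hexp t ht hwt]
    field_simp
    ring
  · have hopen : ∀ᶠ y in nhds t, 0 < s * w y :=
      (hwc.const_mul s).continuousAt.eventually (lt_mem_nhds hs)
    filter_upwards [hopen] with y hy
    have hwy : w y ≠ 0 := fun h0 => by simp [h0] at hy
    have hyZ : y ∉ Z := fun h => hwy (Finset.prod_eq_zero h (sub_self _))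
    have e : s * f y = s * w y * (dd (fun t : I => (t : ℝ)) (insert y Z) f - R y) := by
      rw [hexp y hyZ hwy]
      field_simp
      ring
    rw [e, ← mul_assoc]
    constructor
    · intro h
      exact mul_le_mul_of_nonneg_left (sub_le_sub_right (hf.dd_insert_le hZ ht hyZ h) _) hy.le
    · intro h
      exact mul_le_mul_of_nonneg_left (sub_le_sub_right (hf.dd_insert_le hZ hyZ ht h) _) hy.le

/-- Two comparison functions through `f t` squeeze `f` on both sides. With all `m` auxiliary nodes
left of `t` the nodal product is positive there; moving one node to the right reverses its sign, and
with it both inequalities. This needs `1 ≤ m`. -/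
theorem MConvex.continuousAt (hI : I.OrdConnected) (hm : 1 ≤ m)
    (hf : MConvex (fun t : I => (t : ℝ)) m f) {p q t : I} (hp : p < t) (hq : t < q) :
    ContinuousAt f t := by
  obtain ⟨Z₁, hZ₁, hZ₁'⟩ := exists_finset_between hI hp m
  obtain ⟨Z₀, hZ₀, hZ₀'⟩ := exists_finset_between hI hp (m - 1)
  have hqZ : q ∉ Z₀ := fun h => lt_asymm hq (hZ₀' q h).2
  have ht₁ : t ∉ Z₁ := fun h => lt_irrefl _ (hZ₁' t h).2
  have ht₂ : t ∉ insert q Z₀ := by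
    rw [Finset.mem_insert, not_or]
    exact ⟨hq.ne, fun h => lt_irrefl _ (hZ₀' t h).2⟩
  obtain ⟨g₁, hg₁, h₁⟩ := hf.exists_comparison hZ₁ ht₁ (s := 1) (by
    rw [one_mul]
    exact Finset.prod_pos fun z hz => sub_pos.2 (hZ₁' z hz).2)
  obtain ⟨g₂, hg₂, h₂⟩ := hf.exists_comparison (Z := insert q Z₀)
    (by rw [Finset.card_insert_of_notMem hqZ]; omega) ht₂ (s := -1) (by
    rw [Finset.prod_insert hqZ]
    have h3 : 0 < ∏ z ∈ Z₀, ((t : ℝ) - z) := Finset.prod_pos fun z hz => sub_pos.2 (hZ₀' z hz).2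
    have h4 : 0 < (q : ℝ) - t := sub_pos.2 hq
    nlinarith)
  have hmin := hg₁.min hg₂
  have hmax := hg₁.max hg₂
  rw [min_self] at hmin
  rw [max_self] at hmax
  refine tendsto_of_tendsto_of_tendsto_of_le_of_le' hmin hmax ?_ ?_
  · filter_upwards [h₁, h₂] with y hy₁ hy₂
    rcases le_total t y with h | h
    · exact (min_le_left _ _).trans (by linarith [hy₁.1 h])
    · exact (min_le_right _ _).trans (by linarith [hy₂.2 h])
  · filter_upwards [h₁, h₂] with y hy₁ hy₂
    rcases le_total t y with h | h
    · exact le_trans (by linarith [hy₂.1 h]) (le_max_right _ _)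
    · exact le_trans (by linarith [hy₁.2 h]) (le_max_left _ _)

end Continuity

/-! ### Nonnegativity of integrals in one dimension -/

section OneDim

variable {I : Set ℝ} {m : ℕ} {τ : Measure I} {σ : I → ℝ} {C : Finset I}

/-- The Lagrange basis function of the node `c ∈ C`. -/
noncomputable def lagr (C : Finset I) (c : I) (t : I) : ℝ :=
  (Lagrange.basis C (fun t : I => (t : ℝ)) c).eval (t : ℝ)

theorem natDegree_basis_le (hC : C.card = m + 1) {c : I} (hc : c ∈ C) :
    (Lagrange.basis C (fun t : I => (t : ℝ)) c).natDegree ≤ m := by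
  rw [Lagrange.natDegree_basis Subtype.val_injective.injOn hc]
  omega

theorem continuous_lagr (c : I) : Continuous (lagr C c) :=
  (Polynomial.continuous _).comp continuous_subtype_val

theorem sum_lagr_mul (g : I → ℝ) {t : I} (ht : t ∈ C) : ∑ c ∈ C, lagr C c t * g c = g t := by
  rw [Finset.sum_eq_single t]
  · rw [lagr, Lagrange.eval_basis_self Subtype.val_injective.injOn ht, one_mul]
  · intro c _ hct
    have : lagr C c t = 0 := Lagrange.eval_basis_of_ne (v := fun t : I => (t : ℝ)) hct ht
    rw [this, zero_mul]
  · exact fun h => absurd ht h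

theorem dd_lagr_eq_zero (hC : C.card = m + 1) {c : I} (hc : c ∈ C) {s : Finset I}
    (hs : s.card = m + 2) : dd (fun t : I => (t : ℝ)) s (lagr C c) = 0 :=
  dd_eval_eq_zero Subtype.val_injective (by have := natDegree_basis_le hC hc; omega)

theorem MConvex.sub_interp {f : I → ℝ} (hf : MConvex (fun t : I => (t : ℝ)) m f)
    (hC : C.card = m + 1) (g : I → ℝ) :
    MConvex (fun t : I => (t : ℝ)) m fun t => f t - ∑ c ∈ C, lagr C c t * g c := by
  intro s hs
  rw [dd_sub, dd_sum, Finset.sum_eq_zero, sub_zero]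
  · exact hf s hs
  · intro c hc
    have := dd_const_mul (v := fun t : I => (t : ℝ)) (s := s) (f := lagr C c) (g c)
    simp only [mul_comm (g c)] at this
    rw [this, dd_lagr_eq_zero hC hc hs, zero_mul]

theorem exists_abs_eval_le (P : Polynomial ℝ) (hP : P.natDegree ≤ m) :
    ∃ K, ∀ t : ℝ, |P.eval t| ≤ K * (1 + |t|) ^ m := by
  refine ⟨∑ k ∈ Finset.range (P.natDegree + 1), |P.coeff k|, fun t => ?_⟩
  rw [Polynomial.eval_eq_sum_range, Finset.sum_mul]
  refine (Finset.abs_sum_le_sum_abs _ _).trans (Finset.sum_le_sum fun k hk => ?_)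
  rw [abs_mul, abs_pow]
  exact mul_le_mul_of_nonneg_left (pow_growth (by have := Finset.mem_range.1 hk; omega) t)
    (abs_nonneg _)

variable [IsFiniteMeasure τ]

theorem integrable_lagr (h : Integrable (fun t : I => |(t : ℝ)| ^ m) τ) (hC : C.card = m + 1)
    {c : I} (hc : c ∈ C) : Integrable (lagr C c) τ := by
  obtain ⟨K, hK⟩ := exists_abs_eval_le _ (natDegree_basis_le hC hc)
  exact integrable_of_growth h (continuous_lagr c).measurable.aestronglyMeasurable
    fun t => hK t

theorem NonnegDensity.integral_lagr (h : NonnegDensity τ σ m) (hC : C.card = m + 1) {c : I}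
    (hc : c ∈ C) : ∫ t, lagr C c t * σ t ∂τ = 0 :=
  h.integral_eval_eq_zero _ (natDegree_basis_le hC hc)

theorem mconvex_zero_iff {f : I → ℝ} : MConvex (fun t : I => (t : ℝ)) 0 f ↔ Monotone f := by
  have e : ∀ x y : I, x < y → ((y : ℝ) - x) * dd (fun t : I => (t : ℝ)) {y, x} f = f y - f x := by
    intro x y hxy
    have := dd_insert_insert (f := f) (s := ∅) (v := fun t : I => (t : ℝ))
      Subtype.val_injective hxy.ne' (by simp) (by simp)
    simpa [dd_singleton] using this
  constructor
  · intro hf x y hxy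
    rcases hxy.eq_or_lt with rfl | hlt
    · exact le_rfl
    have h1 := hf {y, x} (Finset.card_pair hlt.ne')
    have h2 : (0 : ℝ) ≤ (y : ℝ) - x := sub_nonneg.2 hlt.le
    have := mul_nonneg h2 h1
    rw [e x y hlt] at this
    linarith
  · intro hf s hs
    obtain ⟨x, y, hxy, rfl⟩ := Finset.card_eq_two.1 hs
    wlog hlt : y < x generalizing x y
    · have := this y x hxy.symm (by rwa [Finset.pair_comm] at hs)
        (lt_of_le_of_ne (not_lt.1 hlt) hxy)
      rwa [Finset.pair_comm] at this
    have h2 : (0 : ℝ) < (x : ℝ) - y := sub_pos.2 hlt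
    refine nonneg_of_mul_nonneg_right ?_ h2
    rw [e y x hlt]
    exact sub_nonneg.2 (hf hlt.le)

/-- For `m = 0` the truncated powers are indicators of closed rays, and an upper set is a countable
increasing union of these. -/
theorem NonnegDensity.setIntegral_upperSet_nonneg (h : NonnegDensity τ σ 0) {U : Set I}
    (hU : IsUpperSet U) : 0 ≤ ∫ t in U, σ t ∂τ := by
  have hσ : Integrable σ τ := by
    simpa using (integrable_const (1 : ℝ)).mul_sign h.measurable h.abs_eq_one
  rcases U.eq_empty_or_nonempty with rfl | hne
  · simp
  obtain ⟨u, hu, hmono, hcof⟩ := exists_monotone_cofinal_seq (hne.image (fun t : I => -(t : ℝ)))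
  choose x hxU hx using hu
  have hUeq : U = ⋃ k, Set.Ici (x k) := by
    ext t
    simp only [Set.mem_iUnion, Set.mem_Ici]
    constructor
    · intro ht
      obtain ⟨k, hk⟩ := hcof _ ⟨t, ht, rfl⟩
      refine ⟨k, ?_⟩
      have h1 := hx k
      simp only at h1 hk
      have : (x k : ℝ) ≤ t := by linarith
      exact this
    · rintro ⟨k, hk⟩
      exact hU hk (hxU k)
  have hlim := tendsto_setIntegral_of_monotone (μ := τ) (f := σ) (s := fun k => Set.Ici (x k))
    (fun k => measurableSet_Ici) (fun i j hij t ht => by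
      have h1 := hmono hij
      have h2 : (x i : ℝ) ≤ t := ht
      rw [← hx i, ← hx j] at h1
      show (x j : ℝ) ≤ t
      linarith) hσ.integrableOn
  rw [hUeq]
  refine ge_of_tendsto' hlim fun k => ?_
  have := h.truncPow_nonneg (x k)
  rw [← integral_indicator measurableSet_Ici]
  refine this.trans_eq (integral_congr_ae (Filter.Eventually.of_forall fun t => ?_))
  simp only
  by_cases ht : t ∈ Set.Ici (x k)
  · have h1 : (0 : ℝ) ≤ (t : ℝ) - x k := sub_nonneg.2 ht
    rw [Set.indicator_of_mem ht, truncPow, if_pos h1, pow_zero, one_mul]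
  · have h1 : ¬ (0 : ℝ) ≤ (t : ℝ) - x k := fun h => ht (sub_nonneg.1 h)
    rw [Set.indicator_of_notMem ht, truncPow, if_neg h1, zero_mul]

/-- Layer-cake formula: a monotone function is a superposition of indicators of upper sets. -/
theorem NonnegDensity.integral_monotone_nonneg [I.OrdConnected] (h : NonnegDensity τ σ 0)
    {f : I → ℝ} (hf : Monotone f) (hint : Integrable f τ) : 0 ≤ ∫ t, f t * σ t ∂τ := by
  have hfm : Measurable f := hf.measurable
  have hσ : Integrable σ τ := by
    simpa using (integrable_const (1 : ℝ)).mul_sign h.measurable h.abs_eq_one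
  -- Subtracting the indicator of `s ≤ 0` makes the layers integrable in `s`; its own contribution
  -- vanishes because the total signed mass is zero.
  set Φ : I × ℝ → ℝ := fun p => {p : I × ℝ | p.2 ≤ f p.1}.indicator 1 p -
    {p : I × ℝ | p.2 ≤ 0}.indicator 1 p with hΦ
  have hΦm : Measurable Φ :=
    (measurable_one.indicator (measurableSet_le measurable_snd (hfm.comp measurable_fst))).sub
      (measurable_one.indicator (measurableSet_le measurable_snd measurable_const))
  have hsec : ∀ t s, Φ (t, s) = (Set.Ioc 0 (f t)).indicator 1 s -
      (Set.Ioc (f t) 0).indicator 1 s := by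
    intro t s
    simp only [hΦ, Set.indicator_apply, Set.mem_ofPred_eq, Set.mem_Ioc, Pi.one_apply]
    split_ifs <;> first | rfl | (exfalso; grind) | norm_num
  have hi : ∀ a b : ℝ, Integrable ((Set.Ioc a b).indicator (1 : ℝ → ℝ)) volume := fun a b =>
    (integrable_indicator_iff measurableSet_Ioc).2 (integrableOn_const (by simp))
  have hval : ∀ t, ∫ s, Φ (t, s) = f t := by
    intro t
    simp only [hsec]
    rw [integral_sub (hi _ _) (hi _ _), integral_indicator_one measurableSet_Ioc,
      integral_indicator_one measurableSet_Ioc]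
    simp only [Real.volume_real_Ioc]
    rcases le_total 0 (f t) with h0 | h0 <;> simp [h0]
  have habs : ∀ t, ∫ s, ‖Φ (t, s)‖ = |f t| := by
    intro t
    have e : ∀ s, ‖Φ (t, s)‖ = (Set.Ioc 0 (f t)).indicator 1 s +
        (Set.Ioc (f t) 0).indicator 1 s := by
      intro s
      rw [hsec, Real.norm_eq_abs]
      simp only [Set.indicator_apply, Set.mem_Ioc, Pi.one_apply]
      split_ifs <;> first | (exfalso; grind) | norm_num
    simp only [e]
    rw [integral_add (hi _ _) (hi _ _), integral_indicator_one measurableSet_Ioc,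
      integral_indicator_one measurableSet_Ioc]
    simp only [Real.volume_real_Ioc]
    rcases le_total 0 (f t) with h0 | h0 <;> simp [h0, abs_of_nonneg, abs_of_nonpos]
  have hΦi : Integrable Φ (τ.prod volume) := by
    rw [integrable_prod_iff hΦm.aestronglyMeasurable]
    constructor
    · refine Filter.Eventually.of_forall fun t => ?_
      simp only [hsec]
      exact (hi _ _).sub (hi _ _)
    · simp only [habs]
      exact hint.abs
  have hΨi : Integrable (fun p : I × ℝ => Φ p * σ p.1) (τ.prod volume) :=
    hΦi.mul_sign (h.measurable.comp measurable_fst) fun p => h.abs_eq_one _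
  have e1 : ∫ t, f t * σ t ∂τ = ∫ t, ∫ s : ℝ, Φ (t, s) * σ t ∂volume ∂τ := by
    refine integral_congr_ae (Filter.Eventually.of_forall fun t => ?_)
    simp only
    rw [integral_mul_const, hval]
  rw [e1, integral_integral_swap hΨi]
  refine MeasureTheory.integral_nonneg fun s => ?_
  have hσ0 : ∫ t, σ t ∂τ = 0 := by simpa using h.moment 0 le_rfl
  have hup : IsUpperSet {t : I | s ≤ f t} := fun a b hab ha => le_trans ha (hf hab)
  have hmeas : MeasurableSet {t : I | s ≤ f t} := measurableSet_le measurable_const hfm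
  have e2 : ∀ t, Φ (t, s) * σ t = {t : I | s ≤ f t}.indicator σ t -
      (if s ≤ 0 then (1 : ℝ) else 0) * σ t := by
    intro t
    simp only [hΦ, Set.indicator_apply, Set.mem_ofPred_eq, Pi.one_apply]
    split_ifs <;> ring
  simp only [Pi.zero_apply, e2]
  rw [integral_sub (hσ.indicator hmeas) (hσ.const_mul _), integral_const_mul, hσ0, mul_zero,
    sub_zero, integral_indicator hmeas]
  exact h.setIntegral_upperSet_nonneg hup

/-- Nonnegative integrals against the truncated powers imply nonnegative integrals against all
`m`-convex functions. -/
theorem NonnegDensity.integral_nonneg (hI : I.OrdConnected) (h : NonnegDensity τ σ m) {f : I → ℝ}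
    (hf : MConvex (fun t : I => (t : ℝ)) m f) (hint : Integrable f τ) :
    0 ≤ ∫ t, f t * σ t ∂τ := by
  -- A monotone function may jump inside `I`, where Bernstein approximants need not converge to it;
  -- hence the separate case.
  rcases Nat.eq_zero_or_pos m with rfl | hm
  · exact h.integral_monotone_nonneg (mconvex_zero_iff.1 hf) hint
  by_cases hτ : τ = 0
  · simp [hτ]
  obtain ⟨C, hC, -, hleft⟩ := h.exists_nodes hτ (G := Set.univ) (by simp)
  set g : I → ℝ := fun t => f t - ∑ c ∈ C, lagr C c t * f c with hg
  have hgconv : MConvex (fun t : I => (t : ℝ)) m g := hf.sub_interp hC f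
  have hlag : ∀ c ∈ C, Integrable (fun t => lagr C c t * f c) τ := fun c hc =>
    (integrable_lagr h.integrable_pow hC hc).mul_const _
  have hgint : Integrable g τ := hint.sub (integrable_finsetSum _ hlag)
  have hgC : ∀ c ∈ C, g c = 0 := fun c hc => by simp only [hg, sum_lagr_mul f hc, sub_self]
  have hgcont : ∀ t, ContinuousAt g t ∨ (∀ s : I, s ≤ t) ∨ ∀ s : I, t ≤ s := by
    intro t
    by_cases h1 : ∀ s : I, s ≤ t
    · exact Or.inr (Or.inl h1)
    by_cases h2 : ∀ s : I, t ≤ s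
    · exact Or.inr (Or.inr h2)
    push Not at h1 h2
    obtain ⟨q, hq⟩ := h1
    obtain ⟨p, hp⟩ := h2
    exact Or.inl (hgconv.continuousAt hI hm hp hq)
  have e : ∫ t, g t * σ t ∂τ = ∫ t, f t * σ t ∂τ := by
    simp only [hg, sub_mul, Finset.sum_mul]
    have hi : ∀ c ∈ C, Integrable (fun t => lagr C c t * f c * σ t) τ := fun c hc =>
      (hlag c hc).mul_sign h.measurable h.abs_eq_one
    rw [integral_sub (hint.mul_sign h.measurable h.abs_eq_one) (integrable_finsetSum _ hi),
      integral_finsetSum _ hi, Finset.sum_eq_zero, sub_zero]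
    intro c hc
    have : ∀ t, lagr C c t * f c * σ t = f c * (lagr C c t * σ t) := fun t => by ring
    simp only [this]
    rw [integral_const_mul, h.integral_lagr hC hc, mul_zero]
  rw [← e]
  refine le_of_forall_pos_le_add fun ε hε => ?_
  -- A one-point parameter space turns the estimate for families into one for `g` alone.
  obtain ⟨S, x, α, hpos, -, happ⟩ := exists_discrete_approx (μ := Measure.dirac ())
    (F := fun _ : Unit => g) (ψ := fun _ => 1) hI h hC hleft (fun _ => Or.inl hgconv)
    (fun _ => hgC) (fun _ => aestronglyMeasurable_const)
    (hgint.comp_snd _) (fun _ => hgcont) measurable_const (by simp) hε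
  have e2 : ∫ p : Unit × I, g p.2 * (1 * σ p.2) ∂((Measure.dirac ()).prod τ) =
      ∫ t, g t * σ t ∂τ := by
    rw [Measure.dirac_prod, integral_map (by fun_prop)]
    · simp
    · have := (hgint.mul_sign h.measurable h.abs_eq_one).comp_snd (Measure.dirac ())
      rw [Measure.dirac_prod] at this
      simpa using this.1
  rw [e2] at happ
  simp only [integral_dirac, mul_one] at happ
  have := hpos g hgconv
  have := (abs_le.1 happ).1
  linarith

end OneDim

/-! ### Multiple divided differences -/

section MultiDividedDifferences

variable {d : ℕ} {I : Fin d → Set ℝ} {n : Fin d → ℕ}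

/-- The weight of the point `p` in the multiple divided difference at the nodes `S i`. -/
noncomputable def mweight (S : (i : Fin d) → Finset (I i)) (p : (i : Fin d) → I i) : ℝ :=
  ∏ i, Lagrange.nodalWeight (S i) (fun t : I i => (t : ℝ)) (p i)

/-- The multiple divided difference at the nodes `S i` in Lagrange form. -/
noncomputable def mdd (S : (i : Fin d) → Finset (I i)) (f : ((i : Fin d) → I i) → ℝ) : ℝ :=
  ∑ p ∈ Fintype.piFinset S, mweight S p * f p

variable {S : (i : Fin d) → Finset (I i)} {f g : ((i : Fin d) → I i) → ℝ}

theorem mdd_sub : mdd S (fun p => f p - g p) = mdd S f - mdd S g := by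
  simp [mdd, mul_sub, Finset.sum_sub_distrib]

theorem mdd_const_mul (c : ℝ) : mdd S (fun p => c * f p) = c * mdd S f := by
  simp only [mdd, Finset.mul_sum]
  exact Finset.sum_congr rfl fun i _ => by ring

theorem mdd_sum {β : Type*} (t : Finset β) (F : β → ((i : Fin d) → I i) → ℝ) :
    mdd S (fun p => ∑ b ∈ t, F b p) = ∑ b ∈ t, mdd S (F b) := by
  simp only [mdd, Finset.mul_sum]
  exact Finset.sum_comm

theorem mdd_prod (φ : (i : Fin d) → I i → ℝ) :
    mdd S (fun p => ∏ i, φ i (p i)) = ∏ i, dd (fun t : I i => (t : ℝ)) (S i) (φ i) := by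
  simp only [mdd, dd, mweight, ← Finset.prod_mul_distrib]
  exact (Finset.prod_univ_sum S fun i t =>
    Lagrange.nodalWeight (S i) (fun t : I i => (t : ℝ)) t * φ i t).symm

theorem mdd_eq_of_eq_zero_off {y : (i : Fin d) → I i} (hy : ∀ i, y i ∈ S i)
    (hf : ∀ p, p ≠ y → (∀ i, p i ∈ S i) → f p = 0) : mdd S f = mweight S y * f y := by
  refine Finset.sum_eq_single y (fun p hp hpy => ?_) fun h => absurd (Fintype.mem_piFinset.2 hy) h
  rw [hf p hpy (Fintype.mem_piFinset.1 hp), mul_zero]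

theorem mweight_ne_zero {y : (i : Fin d) → I i} (hy : ∀ i, y i ∈ S i) : mweight S y ≠ 0 :=
  Finset.prod_ne_zero_iff.2 fun i _ =>
    Lagrange.nodalWeight_ne_zero Subtype.val_injective.injOn (hy i)

/-- A function that depends on the `i`-th variable only through a factor annihilated by the
divided difference in that variable is annihilated by the multiple divided difference. -/
theorem mdd_eq_zero_of_factor {i : Fin d} {l : I i → ℝ} (hne : (S i).Nonempty)
    (hl : dd (fun t : I i => (t : ℝ)) (S i) l = 0)
    (hg : ∀ p t, g (Function.update p i t) = g p) : mdd S (fun p => l (p i) * g p) = 0 := by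
  set A : ((i : Fin d) → I i) → ℝ := fun p => mweight S p * (l (p i) * g p)
  set R : ((i : Fin d) → I i) → ℝ := fun p =>
    (∏ j ∈ Finset.univ.erase i, Lagrange.nodalWeight (S j) (fun t : I j => (t : ℝ)) (p j)) * g p
  have hA : ∀ p t, A (Function.update p i t) =
      Lagrange.nodalWeight (S i) (fun t : I i => (t : ℝ)) t * l t * R p := by
    intro p t
    have : ∏ j ∈ Finset.univ.erase i,
        Lagrange.nodalWeight (S j) (fun t : I j => (t : ℝ)) (Function.update p i t j) =
        ∏ j ∈ Finset.univ.erase i,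
        Lagrange.nodalWeight (S j) (fun t : I j => (t : ℝ)) (p j) :=
      Finset.prod_congr rfl fun j hj => by
        rw [Function.update_of_ne (Finset.ne_of_mem_erase hj)]
    simp only [A, R, mweight, hg, Function.update_self]
    rw [← Finset.mul_prod_erase _ _ (Finset.mem_univ i), this, Function.update_self]
    ring
  have h1 : ∑ q ∈ Fintype.piFinset S ×ˢ S i, A (Function.update q.1 i q.2) = 0 := by
    rw [Finset.sum_product]
    refine Finset.sum_eq_zero fun p _ => ?_
    simp only [hA, ← Finset.sum_mul]
    rw [show ∑ t ∈ S i, Lagrange.nodalWeight (S i) (fun t : I i => (t : ℝ)) t * l t = 0 from hl,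
      zero_mul]
  -- Exchanging the `i`-th coordinate of `p` with `t` is an involution, so the vanishing sum also
  -- equals `(S i).card` times the multiple divided difference.
  have h2 : ∑ q ∈ Fintype.piFinset S ×ˢ S i, A (Function.update q.1 i q.2) =
      ∑ q ∈ Fintype.piFinset S ×ˢ S i, A q.1 := by
    refine Finset.sum_nbij' (fun q => (Function.update q.1 i q.2, q.1 i))
      (fun q => (Function.update q.1 i q.2, q.1 i)) ?_ ?_ ?_ ?_ ?_
    · rintro ⟨p, t⟩ hq
      simp only [Finset.mem_product, Fintype.mem_piFinset] at hq ⊢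
      refine ⟨fun j => ?_, hq.1 i⟩
      rcases eq_or_ne j i with rfl | hj
      · simpa using hq.2
      · simpa [hj] using hq.1 j
    · rintro ⟨p, t⟩ hq
      simp only [Finset.mem_product, Fintype.mem_piFinset] at hq ⊢
      refine ⟨fun j => ?_, hq.1 i⟩
      rcases eq_or_ne j i with rfl | hj
      · simpa using hq.2
      · simpa [hj] using hq.1 j
    · rintro ⟨p, t⟩ _
      simp
    · rintro ⟨p, t⟩ _
      simp
    · rintro ⟨p, t⟩ _
      rfl
  rw [h1, Finset.sum_product, Finset.sum_comm] at h2
  simp only [Finset.sum_const] at h2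
  rw [eq_comm, smul_eq_zero] at h2
  exact h2.resolve_left (Finset.card_pos.2 hne).ne'

theorem mdd_snoc {d : ℕ} {I : Fin (d + 1) → Set ℝ} (S : (i : Fin (d + 1)) → Finset (I i))
    (f : ((i : Fin (d + 1)) → I i) → ℝ) :
    mdd S f = dd (fun t : I (Fin.last d) => (t : ℝ)) (S (Fin.last d)) fun t =>
      mdd (I := fun i : Fin d => I i.castSucc) (fun i => S i.castSucc)
        fun y => f (Fin.snoc (α := fun i => I i) y t) := by
  simp only [mdd, dd, Finset.mul_sum]
  rw [← Finset.sum_product']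
  refine (Finset.sum_nbij' (fun q => Fin.snoc (α := fun i => I i) q.2 q.1)
    (fun p => (p (Fin.last d), Fin.init p)) ?_ ?_ ?_ ?_ ?_).symm
  · rintro ⟨t, y⟩ hq
    simp only [Finset.mem_product, Fintype.mem_piFinset] at hq ⊢
    refine Fin.lastCases ?_ fun i => ?_
    · simpa using hq.1
    · simpa using hq.2 i
  · intro p hp
    simp only [Finset.mem_product, Fintype.mem_piFinset] at hp ⊢
    exact ⟨hp _, fun i => hp _⟩
  · rintro ⟨t, y⟩ _
    simp
  · intro p _
    simp
  · rintro ⟨t, y⟩ _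
    simp only [mweight, Fin.prod_univ_castSucc, Fin.snoc_castSucc, Fin.snoc_last]
    ring

theorem multiDividedDiff_eq_mdd {d : ℕ} (I : Fin d → Set ℝ) (n : Fin d → ℕ)
    (x : (i : Fin d) → Fin (n i + 1) → I i) (hx : ∀ i, Function.Injective (x i))
    (f : ((i : Fin d) → I i) → ℝ) :
    multiDividedDiff I n x f = mdd (fun i => Finset.univ.image (x i)) f := by
  induction d with
  | zero =>
    have : ∀ p : (i : Fin 0) → I i, p = fun i => i.elim0 := fun p => funext fun i => i.elim0
    rw [mdd_eq_of_eq_zero_off (y := fun i => i.elim0) (fun i => i.elim0)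
      fun p hp => absurd (this p) hp]
    simp [multiDividedDiff, mweight]
  | succ d ih =>
    rw [multiDividedDiff, mdd_snoc, dividedDiff_eq_dd _ _ _ (hx _)]
    congr 1
    funext t
    exact ih _ _ _ (fun i => hx _) _

theorem isBoxConvex_iff : IsBoxConvex I n f ↔
    ∀ S : (i : Fin d) → Finset (I i), (∀ i, (S i).card = n i + 1) → 0 ≤ mdd S f := by
  constructor
  · intro h S hS
    choose x hx hxS using fun i => exists_image_eq (S i) (hS i)
    have := h x hx
    rw [multiDividedDiff_eq_mdd _ _ _ hx] at this
    simpa only [hxS] using this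
  · intro h x hx
    rw [multiDividedDiff_eq_mdd _ _ _ hx]
    exact h _ fun i => by simp [Finset.card_image_of_injective _ (hx i)]

/-- Fixing nodes in all but the last variable leaves ordinary convexity in the last one; this lets a
one-variable functional act on `f` and keep box-convexity. -/
theorem IsBoxConvex.mconvex_mdd_snoc {d : ℕ} {I : Fin (d + 1) → Set ℝ} {n : Fin (d + 1) → ℕ}
    {f : ((i : Fin (d + 1)) → I i) → ℝ} (hf : IsBoxConvex I n f) {m : ℕ}
    (hm : n (Fin.last d) = m + 1) {S : (i : Fin d) → Finset (I i.castSucc)}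
    (hS : ∀ i, (S i).card = n i.castSucc + 1) :
    MConvex (fun t : I (Fin.last d) => (t : ℝ)) m fun t =>
      mdd (I := fun i : Fin d => I i.castSucc) S
        fun y => f (Fin.snoc (α := fun i => I i) y t) := by
  intro T hT
  have := isBoxConvex_iff.1 hf (Fin.snoc (α := fun i => Finset (I i)) S T)
    (Fin.lastCases (by simp [hT, hm]) fun i => by simpa using hS i)
  rw [mdd_snoc] at this
  simpa using this

end MultiDividedDifferences

/-! ### Induction on the dimension for functions vanishing at nodes -/

section Vanishing

theorem measurable_snoc {d : ℕ} {X : Fin (d + 1) → Type*} [∀ i, MeasurableSpace (X i)] :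
    Measurable fun p : ((i : Fin d) → X i.castSucc) × X (Fin.last d) =>
      Fin.snoc (α := X) p.1 p.2 := by
  refine measurable_pi_iff.2 (Fin.lastCases ?_ fun i => ?_)
  · simpa using measurable_snd
  · simpa [Function.comp_def] using (measurable_pi_apply i).comp measurable_fst

theorem map_snoc_prod_pi {d : ℕ} {X : Fin (d + 1) → Type*} [∀ i, MeasurableSpace (X i)]
    (τ : (i : Fin (d + 1)) → Measure (X i)) [∀ i, SigmaFinite (τ i)] :
    Measure.map (fun p : ((i : Fin d) → X i.castSucc) × X (Fin.last d) =>
      Fin.snoc (α := X) p.1 p.2)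
      ((Measure.pi fun i : Fin d => τ i.castSucc).prod (τ (Fin.last d))) = Measure.pi τ := by
  refine (Measure.pi_eq fun s hs => ?_).symm
  have : (fun p : ((i : Fin d) → X i.castSucc) × X (Fin.last d) =>
      Fin.snoc (α := X) p.1 p.2) ⁻¹' Set.univ.pi s =
      (Set.univ.pi fun i : Fin d => s i.castSucc) ×ˢ s (Fin.last d) := by
    ext p
    simp only [Set.mem_preimage, Set.mem_pi, Set.mem_univ, true_implies, Set.mem_prod]
    constructor
    · exact fun h => ⟨fun i => by simpa using h i.castSucc, by simpa using h (Fin.last d)⟩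
    · rintro ⟨h1, h2⟩
      exact Fin.lastCases (by simpa using h2) fun i => by simpa using h1 i
  rw [Measure.map_apply measurable_snoc (MeasurableSet.univ_pi hs), this, Measure.prod_prod,
    Measure.pi_pi, Fin.prod_univ_castSucc]

theorem measurable_prod_apply {d : ℕ} {X : Fin d → Type*} [∀ i, MeasurableSpace (X i)]
    {σ : (i : Fin d) → X i → ℝ} (hσ : ∀ i, Measurable (σ i)) :
    Measurable fun x : (i : Fin d) → X i => ∏ i, σ i (x i) :=
  Finset.measurable_prod _ fun i _ => (hσ i).comp (measurable_pi_apply i)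

theorem abs_prod_apply {d : ℕ} {X : Fin d → Type*} {σ : (i : Fin d) → X i → ℝ}
    (hσ : ∀ i t, |σ i t| = 1) (x : (i : Fin d) → X i) : |∏ i, σ i (x i)| = 1 := by
  rw [Finset.abs_prod]
  exact Finset.prod_eq_one fun i _ => hσ i _

/-- Adjoin `y i` to `C i`: every grid point other than `y` has a coordinate in some `C i`, so the
multiple divided difference is a nonzero weight times the section. The sign of the weight depends on
`y`. If some `y i` is itself a node, the section is zero. -/
theorem IsBoxConvex.mconvexUpToSign {d : ℕ} {I : Fin (d + 1) → Set ℝ} {m : Fin (d + 1) → ℕ}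
    {f : ((i : Fin (d + 1)) → I i) → ℝ} (hf : IsBoxConvex I (fun i => m i + 1) f)
    {C : (i : Fin (d + 1)) → Finset (I i)} (hC : ∀ i, (C i).card = m i + 1)
    (h0 : ∀ x i, x i ∈ C i → f x = 0) (y : (i : Fin d) → I i.castSucc) :
    MConvexUpToSign (m (Fin.last d)) fun t => f (Fin.snoc (α := fun i => I i) y t) := by
  by_cases hy : ∃ i, y i ∈ C i.castSucc
  · obtain ⟨i, hi⟩ := hy
    left
    intro s _
    have : ∀ t, f (Fin.snoc (α := fun i => I i) y t) = 0 := fun t =>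
      h0 _ i.castSucc (by simpa using hi)
    simp [this, dd]
  push Not at hy
  set S : (i : Fin d) → Finset (I i.castSucc) := fun i => insert (y i) (C i.castSucc)
  have hyS : ∀ i, y i ∈ S i := fun i => Finset.mem_insert_self _ _
  have hw : mweight (I := fun i : Fin d => I i.castSucc) S y ≠ 0 := mweight_ne_zero hyS
  have h1 := hf.mconvex_mdd_snoc (m := m (Fin.last d)) rfl (S := S)
    fun i => by simp only [S]; rw [Finset.card_insert_of_notMem (hy i), hC]
  have h2 : ∀ t, mdd (I := fun i : Fin d => I i.castSucc) S
      (fun y => f (Fin.snoc (α := fun i => I i) y t)) =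
      mweight (I := fun i : Fin d => I i.castSucc) S y * f (Fin.snoc (α := fun i => I i) y t) := by
    intro t
    refine mdd_eq_of_eq_zero_off (I := fun i : Fin d => I i.castSucc) hyS fun p hp hpS => ?_
    obtain ⟨i, hi⟩ := Function.ne_iff.1 hp
    refine h0 _ i.castSucc ?_
    simpa using (Finset.mem_insert.1 (hpS i)).resolve_left hi
  simp only [h2] at h1
  set w := mweight (I := fun i : Fin d => I i.castSucc) S y
  have h3 : ∀ s : Finset (I (Fin.last d)), s.card = m (Fin.last d) + 2 →
      0 ≤ w * dd (fun t : I (Fin.last d) => (t : ℝ)) s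
        fun t => f (Fin.snoc (α := fun i => I i) y t) := by
    intro s hs
    rw [← dd_const_mul]
    exact h1 s hs
  rcases lt_or_gt_of_ne hw with hneg | hpos
  · right
    intro s hs
    rw [dd_neg]
    nlinarith [h3 s hs]
  · left
    intro s hs
    exact nonneg_of_mul_nonneg_right (h3 s hs) hpos

/-- Replace the last integration by a discrete functional nonnegative on `m`-convex functions, up to
`ε`; the result is an integral of the same kind in one dimension fewer. -/
theorem integral_nonneg_of_vanishing {d : ℕ} {I : Fin d → Set ℝ} (hI : ∀ i, (I i).OrdConnected)
    {m : Fin d → ℕ} {τ : (i : Fin d) → Measure (I i)} [∀ i, IsFiniteMeasure (τ i)]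
    {σ : (i : Fin d) → I i → ℝ} (h : ∀ i, NonnegDensity (τ i) (σ i) (m i))
    {C : (i : Fin d) → Finset (I i)} (hC : ∀ i, (C i).card = m i + 1)
    (hleft : ∀ i, τ i {t | ∀ c ∈ C i, t < c} ≠ 0)
    {f : ((i : Fin d) → I i) → ℝ} (hfc : Continuous f)
    (hf : IsBoxConvex I (fun i => m i + 1) f) (hint : Integrable f (Measure.pi τ))
    (h0 : ∀ x i, x i ∈ C i → f x = 0) :
    0 ≤ ∫ x, f x * ∏ i, σ i (x i) ∂Measure.pi τ := by
  induction d with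
  | zero =>
    have hf0 := isBoxConvex_iff.1 hf (fun i => i.elim0) fun i => i.elim0
    have : ∀ p : (i : Fin 0) → I i, p = fun i => i.elim0 := fun p => funext fun i => i.elim0
    rw [mdd_eq_of_eq_zero_off (y := fun i => i.elim0) (fun i => i.elim0)
      fun p hp => absurd (this p) hp] at hf0
    refine MeasureTheory.integral_nonneg fun x => ?_
    rw [this x]
    simpa [mweight] using hf0
  | succ d ih =>
    set μ := Measure.pi fun i : Fin d => τ i.castSucc
    set ψ : ((i : Fin d) → I i.castSucc) → ℝ := fun y => ∏ i, σ i.castSucc (y i) with hψdef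
    have hψ : Measurable ψ := measurable_prod_apply fun i => (h i.castSucc).measurable
    have hψ1 : ∀ y, |ψ y| = 1 := abs_prod_apply fun i => (h i.castSucc).abs_eq_one
    have hsn : Continuous fun p : ((i : Fin d) → I i.castSucc) × I (Fin.last d) =>
        Fin.snoc (α := fun i => I i) p.1 p.2 := 
      Continuous.finSnoc (A := fun i => I i) continuous_fst continuous_snd
    have hint' : Integrable (fun p : ((i : Fin d) → I i.castSucc) × I (Fin.last d) =>
        f (Fin.snoc (α := fun i => I i) p.1 p.2)) (μ.prod (τ (Fin.last d))) := by
      rw [← map_snoc_prod_pi τ] at hint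
      exact hint.comp_measurable measurable_snoc
    have hval : ∫ x, f x * ∏ i, σ i (x i) ∂Measure.pi τ =
        ∫ p : ((i : Fin d) → I i.castSucc) × I (Fin.last d),
          f (Fin.snoc (α := fun i => I i) p.1 p.2) * (ψ p.1 * σ (Fin.last d) p.2)
          ∂(μ.prod (τ (Fin.last d))) := by
      rw [← map_snoc_prod_pi τ, 
        integral_map (measurable_snoc (X := fun i => I i)).aemeasurable]
      · simp [Fin.prod_univ_castSucc, hψdef, μ]
      · exact (hfc.measurable.mul
          (measurable_prod_apply fun i => (h i).measurable)).aestronglyMeasurable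
    refine le_of_forall_pos_le_add fun ε hε => ?_
    obtain ⟨S, x, α, hpos, hS, happ⟩ := exists_discrete_approx (μ := μ)
      (F := fun y t => f (Fin.snoc (α := fun i => I i) y t)) (hI (Fin.last d)) (h (Fin.last d))
      (hC _) (hleft _) (hf.mconvexUpToSign hC h0)
      (fun y c hc => h0 _ (Fin.last d) (by simpa using hc))
      (fun t => (hfc.comp (hsn.comp (Continuous.prodMk_left t))).measurable.aestronglyMeasurable)
      hint' (fun y t => Or.inl (hfc.comp (hsn.comp (Continuous.prodMk_right y))).continuousAt)
      hψ hψ1 hε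
    -- The combination of slices inherits the zeros. Its multiple divided differences are the
    -- discrete functional applied to an `m`-convex function, hence nonnegative.
    have hg : 0 ≤ ∫ y, (∑ k ∈ S, α k * f (Fin.snoc (α := fun i => I i) y (x k))) * ψ y ∂μ := by
      refine ih (I := fun i => I i.castSucc) (fun i => hI _) (fun i => h _) (C := fun i => C i.castSucc)
        (fun i => hC _) (fun i => hleft _)
        (f := fun y => ∑ k ∈ S, α k * f (Fin.snoc (α := fun i => I i) y (x k)))
        ?_ ?_ ?_ ?_
      · exact continuous_finsetSum _ fun k _ => continuous_const.mul
          (hfc.comp (hsn.comp (Continuous.prodMk_left (x k))))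
      · refine isBoxConvex_iff.2 fun T hT => ?_
        rw [mdd_sum]
        simp only [mdd_const_mul]
        exact hpos _ (hf.mconvex_mdd_snoc rfl hT)
      · exact integrable_finsetSum _ fun k hk => (hS k hk).const_mul _
      · intro y i hi
        refine Finset.sum_eq_zero fun k _ => ?_
        rw [h0 _ i.castSucc (by simpa using hi), mul_zero]
    rw [hval]
    linarith [(abs_le.1 happ).1]

end Vanishing

/-! ### Fubini by resampling one coordinate -/

section Update

/-- Overwriting coordinate `i` by an independent sample reproduces the product measure up to the
total mass of `τ i`, giving Fubini in one coordinate without splitting the index set. -/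
theorem map_update_prod_pi {d : ℕ} {X : Fin d → Type*} [∀ i, MeasurableSpace (X i)]
    (τ : (i : Fin d) → Measure (X i)) [∀ i, IsFiniteMeasure (τ i)] (i : Fin d) (hi : τ i ≠ 0) :
    (τ i Set.univ)⁻¹ • Measure.map (fun p : ((j : Fin d) → X j) × X i =>
      Function.update p.1 i p.2) ((Measure.pi τ).prod (τ i)) = Measure.pi τ := by
  have hc : τ i Set.univ ≠ 0 := by simpa using hi
  refine (Measure.pi_eq fun s hs => ?_).symm
  have : (fun p : ((j : Fin d) → X j) × X i => Function.update p.1 i p.2) ⁻¹' Set.univ.pi s =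
      (Set.univ.pi (Function.update s i Set.univ)) ×ˢ s i := by
    ext p
    simp only [Set.mem_preimage, Set.mem_pi, Set.mem_univ, true_implies, Set.mem_prod]
    constructor
    · refine fun h => ⟨fun j => ?_, by simpa using h i⟩
      rcases eq_or_ne j i with rfl | hj
      · simp
      · simpa [hj] using h j
    · rintro ⟨h1, h2⟩ j
      rcases eq_or_ne j i with rfl | hj
      · simpa using h2
      · simpa [hj] using h1 j
  rw [Measure.smul_apply, Measure.map_apply measurable_update' (MeasurableSet.univ_pi hs), this,
    Measure.prod_prod, Measure.pi_pi, ← Finset.mul_prod_erase _ _ (Finset.mem_univ i),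
    ← Finset.mul_prod_erase _ (fun j => τ j (s j)) (Finset.mem_univ i), Function.update_self,
    Finset.prod_congr rfl fun j hj => by
      rw [Function.update_of_ne (Finset.ne_of_mem_erase hj)], smul_eq_mul, mul_assoc, ← mul_assoc,
    ENNReal.inv_mul_cancel hc (measure_ne_top _ _), one_mul, mul_comm]

variable {d : ℕ} {X : Fin d → Type*} [∀ i, MeasurableSpace (X i)]
  {τ : (i : Fin d) → Measure (X i)} [∀ i, IsFiniteMeasure (τ i)] {i : Fin d}

theorem integrable_update (hi : τ i ≠ 0) {f : ((j : Fin d) → X j) → ℝ}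
    (hf : Integrable f (Measure.pi τ)) :
    ∀ᵐ t ∂τ i, Integrable (fun x => f (Function.update x i t)) (Measure.pi τ) := by
  rw [← map_update_prod_pi τ i hi, integrable_smul_measure
    (ENNReal.inv_ne_zero.2 (measure_ne_top _ _)) (ENNReal.inv_ne_top.2 (by simpa using hi))] at hf
  exact (hf.comp_measurable measurable_update').prod_left_ae

theorem integrable_mul_of_update (hi : τ i ≠ 0) {l : X i → ℝ} {g : ((j : Fin d) → X j) → ℝ}
    (hl : Integrable l (τ i)) (hg : Integrable g (Measure.pi τ)) (hlm : Measurable l)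
    (hgm : Measurable g) (hgu : ∀ x t, g (Function.update x i t) = g x) :
    Integrable (fun x => l (x i) * g x) (Measure.pi τ) := by
  have hm : Measurable fun x : (j : Fin d) → X j => l (x i) * g x :=
    (hlm.comp (measurable_pi_apply i)).mul hgm
  rw [← map_update_prod_pi τ i hi]
  refine Integrable.smul_measure ?_ (ENNReal.inv_ne_top.2 (by simpa using hi))
  rw [integrable_map_measure hm.aestronglyMeasurable
    measurable_update'.aemeasurable]
  simpa [Function.comp_def, hgu, mul_comm] using hg.mul_prod hl

theorem integral_mul_of_update (hi : τ i ≠ 0) {l : X i → ℝ} {g : ((j : Fin d) → X j) → ℝ}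
    (hl : ∫ t, l t ∂τ i = 0) (hlm : Measurable l)
    (hgm : Measurable g) (hgu : ∀ x t, g (Function.update x i t) = g x) :
    ∫ x, l (x i) * g x ∂Measure.pi τ = 0 := by
  have hm : Measurable fun x : (j : Fin d) → X j => l (x i) * g x :=
    (hlm.comp (measurable_pi_apply i)).mul hgm
  rw [← map_update_prod_pi τ i hi, integral_smul_measure,
    integral_map measurable_update'.aemeasurable hm.aestronglyMeasurable]
  simp only [Function.update_self, hgu, mul_comm (l _)]
  rw [integral_prod_mul, hl, mul_zero, smul_zero]

end Update

/-! ### Reduction to functions vanishing at nodes -/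

section Main

variable {d : ℕ} {I : Fin d → Set ℝ} {m : Fin d → ℕ} {τ : (i : Fin d) → Measure (I i)}
  [∀ i, IsFiniteMeasure (τ i)] {σ : (i : Fin d) → I i → ℝ}

/-- Induction on the set of coordinates not yet normalized: subtracting the interpolant in `x i`
preserves box-convexity and the integral, and creates the zeros in that coordinate. -/
theorem integral_nonneg_of_vanishing_off (hI : ∀ i, (I i).OrdConnected)
    (h : ∀ i, NonnegDensity (τ i) (σ i) (m i)) (hτ : ∀ i, τ i ≠ 0) (s : Finset (Fin d)) :
    ∀ f : ((i : Fin d) → I i) → ℝ, Continuous f → IsBoxConvex I (fun i => m i + 1) f →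
      Integrable f (Measure.pi τ) →
      (∀ i ∉ s, ∃ C : Finset (I i), C.card = m i + 1 ∧ τ i {t | ∀ c ∈ C, t < c} ≠ 0 ∧
        ∀ x, x i ∈ C → f x = 0) →
      0 ≤ ∫ x, f x * ∏ i, σ i (x i) ∂Measure.pi τ := by
  induction s using Finset.induction_on with
  | empty =>
    intro f hfc hf hint hs
    choose C hC hleft h0 using fun i => hs i (by simp)
    exact integral_nonneg_of_vanishing hI h hC hleft hfc hf hint fun x i => h0 i x
  | insert i s hi ih =>
    intro f hfc hf hint hs
    -- The nodes are chosen where the slice of `f` is integrable, so that the interpolant is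
    -- integrable.
    obtain ⟨C, hC, hCG, hleft⟩ := (h i).exists_nodes (hτ i) (integrable_update (hτ i) hint)
    have hlc : ∀ c, Continuous fun x : (j : Fin d) → I j => lagr C c (x i) := fun c =>
      (continuous_lagr c).comp (continuous_apply i)
    have hgc : ∀ c, Continuous fun x : (j : Fin d) → I j => f (Function.update x i c) := fun c =>
      hfc.comp (continuous_id.update i continuous_const)
    have hgu : ∀ (c : I i) (x : (j : Fin d) → I j) (t : I i),
        f (Function.update (Function.update x i t) i c) = f (Function.update x i c) :=
      fun c x t => by rw [Function.update_idem]
    have hprod : Integrable (fun x => f x * ∏ i, σ i (x i)) (Measure.pi τ) :=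
      hint.mul_sign (measurable_prod_apply fun i => (h i).measurable)
        (abs_prod_apply fun i => (h i).abs_eq_one)
    have hterm : ∀ c ∈ C, Integrable
        (fun x : (j : Fin d) → I j => lagr C c (x i) * f (Function.update x i c))
        (Measure.pi τ) := fun c hc =>
      integrable_mul_of_update (hτ i) (integrable_lagr (h i).integrable_pow hC hc) (hCG c hc)
        (continuous_lagr c).measurable (hgc c).measurable (hgu c)
    have hterm' : ∀ c ∈ C, Integrable (fun x : (j : Fin d) → I j =>
        lagr C c (x i) * f (Function.update x i c) * ∏ j, σ j (x j)) (Measure.pi τ) :=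
      fun c hc => (hterm c hc).mul_sign (measurable_prod_apply fun i => (h i).measurable)
        (abs_prod_apply fun i => (h i).abs_eq_one)
    have hzero : ∀ c ∈ C, ∫ x : (j : Fin d) → I j,
        lagr C c (x i) * f (Function.update x i c) * ∏ j, σ j (x j) ∂Measure.pi τ = 0 := by
      intro c hc
      have := integral_mul_of_update (hτ i) (l := fun t => lagr C c t * σ i t)
        (g := fun x => f (Function.update x i c) * ∏ j ∈ Finset.univ.erase i, σ j (x j))
        ((h i).integral_lagr hC hc) ((continuous_lagr c).measurable.mul (h i).measurable)
        ((hgc c).measurable.mul (Finset.measurable_prod _ fun j _ =>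
          (h j).measurable.comp (measurable_pi_apply j)))
        (fun x t => by
          rw [hgu]
          congr 1
          exact Finset.prod_congr rfl fun j hj => by
            rw [Function.update_of_ne (Finset.ne_of_mem_erase hj)])
      rw [← this]
      congr 1
      funext x
      rw [← Finset.mul_prod_erase _ _ (Finset.mem_univ i)]
      ring
    have key := ih (fun x => f x - ∑ c ∈ C, lagr C c (x i) * f (Function.update x i c))
      (hfc.sub (continuous_finsetSum _ fun c _ => (hlc c).mul (hgc c))) ?_
      (hint.sub (integrable_finsetSum _ hterm)) ?_
    · simp only [sub_mul, Finset.sum_mul] at key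
      rwa [integral_sub hprod (integrable_finsetSum _ hterm'), integral_finsetSum _ hterm',
        Finset.sum_eq_zero hzero, sub_zero] at key
    · refine isBoxConvex_iff.2 fun S hS => ?_
      rw [mdd_sub, mdd_sum, Finset.sum_eq_zero, sub_zero]
      · exact isBoxConvex_iff.1 hf S hS
      · intro c hc
        exact mdd_eq_zero_of_factor (Finset.card_pos.1 (by rw [hS]; omega))
          (dd_lagr_eq_zero hC hc (hS i)) (hgu c)
    · intro j hj
      rcases eq_or_ne j i with rfl | hji
      · refine ⟨C, hC, hleft, fun x hx => ?_⟩
        rw [sum_lagr_mul (fun c => f (Function.update x j c)) hx, Function.update_eq_self, sub_self]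
      -- Updating coordinate `i` leaves `x j` alone, so zeros obtained earlier survive.
      · obtain ⟨D, hD, hDl, hD0⟩ := hs j (by simp [hji, hj])
        refine ⟨D, hD, hDl, fun x hx => ?_⟩
        rw [hD0 x hx, Finset.sum_eq_zero, sub_zero]
        intro c _
        rw [hD0 _ (by rwa [Function.update_of_ne hji]), mul_zero]

/-- Integrals of continuous box-convex functions against products of nonnegative densities are
nonnegative. -/
theorem integral_pi_nonneg (hI : ∀ i, (I i).OrdConnected)
    (h : ∀ i, NonnegDensity (τ i) (σ i) (m i)) (hτ : ∀ i, τ i ≠ 0)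
    {f : ((i : Fin d) → I i) → ℝ} (hfc : Continuous f)
    (hf : IsBoxConvex I (fun i => m i + 1) f) (hint : Integrable f (Measure.pi τ)) :
    0 ≤ ∫ x, f x * ∏ i, σ i (x i) ∂Measure.pi τ :=
  integral_nonneg_of_vanishing_off hI h hτ Finset.univ f hfc hf hint fun i hi =>
    absurd (Finset.mem_univ i) hi

end Main

/-! ### Signed measures as sign densities of their variation -/

section SignDensity

variable {X : Type*} [MeasurableSpace X]

/-- `σ` is the sign of the signed measure `γ`: a measurable function with values `±1` that is the
density of `γ` with respect to its variation. -/
structure IsSignDensity (γ : SignedMeasure X) (σ : X → ℝ) : Prop where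
  measurable : Measurable σ
  abs_eq_one : ∀ t, |σ t| = 1
  eq_withDensity : γ = γ.variation.withDensityᵥ σ

instance (γ : SignedMeasure X) : IsFiniteMeasure γ.variation := by
  rw [← SignedMeasure.totalVariation_eq_variation]
  infer_instance

theorem integrable_of_abs_eq_one {τ : Measure X} [IsFiniteMeasure τ] {σ : X → ℝ}
    (hσ : Measurable σ) (h1 : ∀ t, |σ t| = 1) : Integrable σ τ := by
  simpa using (integrable_const (1 : ℝ)).mul_sign hσ h1

theorem variation_withDensity_sign {τ : Measure X} [IsFiniteMeasure τ] {σ : X → ℝ}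
    (hσ : Measurable σ) (h1 : ∀ t, |σ t| = 1) : (τ.withDensityᵥ σ).variation = τ := by
  rw [Measure.variation_withDensityᵥ (integrable_of_abs_eq_one hσ h1)]
  have : (fun x => ‖σ x‖ₑ) = 1 := by
    funext x
    rw [← ofReal_norm, Real.norm_eq_abs, h1]
    simp
  rw [this, withDensity_one]

theorem exists_isSignDensity (γ : SignedMeasure X) : ∃ σ, IsSignDensity γ σ := by
  obtain ⟨S, hS, -, -, hpos, hneg⟩ := γ.toJordanDecomposition.exists_compl_positive_negative
  set p := γ.toJordanDecomposition.posPart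
  set q := γ.toJordanDecomposition.negPart
  set σ : X → ℝ := fun t => Sᶜ.indicator 1 t - S.indicator 1 t with hσdef
  have hσ : Measurable σ :=
    (measurable_one.indicator hS.compl).sub (measurable_one.indicator hS)
  have h1 : ∀ t, |σ t| = 1 := by
    intro t
    by_cases ht : t ∈ S <;> simp [hσdef, ht]
  refine ⟨σ, hσ, h1, ?_⟩
  have hvar : γ.variation = p + q := by
    rw [← SignedMeasure.totalVariation_eq_variation]; rfl
  ext A hA
  rw [withDensityᵥ_apply (integrable_of_abs_eq_one hσ h1) hA, hvar, Measure.restrict_add,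
    integral_add_measure (integrable_of_abs_eq_one hσ h1) (integrable_of_abs_eq_one hσ h1),
    γ.apply_eq_posPart_real_sub_negPart_real hA]
  have hp : σ =ᵐ[p.restrict A] fun _ => 1 := by
    refine ae_restrict_of_ae ?_
    filter_upwards [measure_eq_zero_iff_ae_notMem.1 hpos] with t ht
    simp [hσdef, ht]
  have hq : σ =ᵐ[q.restrict A] fun _ => -1 := by
    refine ae_restrict_of_ae ?_
    filter_upwards [measure_eq_zero_iff_ae_notMem.1 hneg] with t ht
    have : t ∈ S := by simpa using ht
    simp [hσdef, this]
  rw [integral_congr_ae hp, integral_congr_ae hq]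
  simp [p, q, sub_eq_add_neg]

/-- Splitting along `σ = 1` and `σ = -1` reduces the vector-measure integral to Bochner integrals
against positive measures. -/
theorem integral_withDensity_sign {τ : Measure X} [IsFiniteMeasure τ] {σ : X → ℝ}
    (hσ : Measurable σ) (h1 : ∀ t, |σ t| = 1) {f : X → ℝ} (hf : Integrable f τ) :
    ∫ᵛ x, f x ∂•(τ.withDensityᵥ σ) = ∫ x, f x * σ x ∂τ := by
  set P := σ ⁻¹' {1}
  have hP : MeasurableSet P := hσ (measurableSet_singleton 1)
  have hσP : ∀ t ∈ P, σ t = 1 := fun t ht => ht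
  have hσP' : ∀ t ∈ Pᶜ, σ t = -1 := fun t ht =>
    ((abs_eq zero_le_one).1 (h1 t)).resolve_left ht
  have hσi := integrable_of_abs_eq_one (τ := τ) hσ h1
  have hflip : ∀ μ : Measure X, ∀ _ : IsFiniteMeasure μ,
      ∫ᵛ x, f x ∂•μ.toSignedMeasure = ∫ x, f x ∂μ := by
    intro μ _
    rw [← VectorMeasure.integral_toSignedMeasure]
    congr 1
    ext
    simp
  have heq : τ.withDensityᵥ σ =
      (τ.restrict P).toSignedMeasure - (τ.restrict Pᶜ).toSignedMeasure := by
    ext A hA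
    rw [withDensityᵥ_apply hσi hA, Measure.toSignedMeasure_sub_apply hA, measureReal_restrict_apply hA,
      measureReal_restrict_apply hA, ← integral_add_compl hP hσi.integrableOn,
      Measure.restrict_restrict hP, Measure.restrict_restrict hP.compl,
      setIntegral_congr_fun (hP.inter hA) (g := fun _ => 1) fun t ht => hσP t ht.1,
      setIntegral_congr_fun (hP.compl.inter hA) (g := fun _ => -1) fun t ht => hσP' t ht.1]
    simp [Set.inter_comm, sub_eq_add_neg]
  rw [heq, VectorMeasure.integral_sub_vectorMeasure, hflip _ inferInstance, hflip _ inferInstance,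
    ← integral_add_compl hP (hf.mul_sign hσ h1),
    setIntegral_congr_fun hP (f := fun t => f t * σ t) (g := f) fun t ht => by
      simp only [hσP t ht, mul_one],
    setIntegral_congr_fun hP.compl (f := fun t => f t * σ t) (g := fun t => -f t) fun t ht => by
      simp only [hσP' t ht, mul_neg_one], integral_neg, sub_eq_add_neg]
  · simpa only [VectorMeasure.Integrable, Measure.variation_toSignedMeasure] using hf.restrict
  · simpa only [VectorMeasure.Integrable, Measure.variation_toSignedMeasure] using hf.restrict

theorem IsSignDensity.integral_eq {γ : SignedMeasure X} {σ : X → ℝ} (h : IsSignDensity γ σ)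
    {f : X → ℝ} (hf : γ.Integrable f) : ∫ᵛ x, f x ∂•γ = ∫ x, f x * σ x ∂γ.variation := by
  conv_lhs => rw [h.eq_withDensity]
  exact integral_withDensity_sign h.measurable h.abs_eq_one hf

end SignDensity

/-! ### The product signed measure -/

section Pi

variable {d : ℕ} {X : Fin d → Type*} [∀ i, MeasurableSpace (X i)]
  {γ : (i : Fin d) → SignedMeasure (X i)} {σ : (i : Fin d) → X i → ℝ}

/-- Both sides agree on measurable boxes, a generating π-system. Hence the variation of the product
is the product of the variations. -/
theorem signedPi_eq_withDensity (h : ∀ i, IsSignDensity (γ i) (σ i)) :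
    signedPi γ = (Measure.pi fun i => (γ i).variation).withDensityᵥ fun x => ∏ i, σ i (x i) := by
  have hbox : ∀ t : (i : Fin d) → Set (X i), (∀ i, MeasurableSet (t i)) →
      signedPi γ (Set.univ.pi t) = (Measure.pi fun i => (γ i).variation).withDensityᵥ
        (fun x => ∏ i, σ i (x i)) (Set.univ.pi t) := by
    intro t ht
    rw [signedPi_apply_pi γ t ht, withDensityᵥ_apply
      (integrable_of_abs_eq_one (measurable_prod_apply fun i => (h i).measurable)
        (abs_prod_apply fun i => (h i).abs_eq_one)) (MeasurableSet.univ_pi ht),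
      Measure.restrict_pi_pi, integral_fintype_prod_eq_prod]
    refine Finset.prod_congr rfl fun i _ => ?_
    conv_lhs => rw [(h i).eq_withDensity]
    exact withDensityᵥ_apply (integrable_of_abs_eq_one (h i).measurable (h i).abs_eq_one) (ht i)
  refine VectorMeasure.ext_of_generateFrom _ ?_ generateFrom_pi.symm isPiSystem_pi ?_
  · rintro _ ⟨t, ht, rfl⟩
    exact hbox t fun i => ht i (Set.mem_univ i)
  · simpa using hbox (fun _ => Set.univ) fun _ => MeasurableSet.univ

theorem variation_signedPi : (signedPi γ).variation = Measure.pi fun i => (γ i).variation := by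
  choose σ h using fun i => exists_isSignDensity (γ i)
  rw [signedPi_eq_withDensity h]
  exact variation_withDensity_sign (measurable_prod_apply fun i => (h i).measurable)
    (abs_prod_apply fun i => (h i).abs_eq_one)

theorem integral_signedPi (h : ∀ i, IsSignDensity (γ i) (σ i)) {f : ((i : Fin d) → X i) → ℝ}
    (hf : Integrable f (Measure.pi fun i => (γ i).variation)) :
    ∫ᵛ x, f x ∂•(signedPi γ) =
      ∫ x, f x * ∏ i, σ i (x i) ∂(Measure.pi fun i => (γ i).variation) := by
  rw [signedPi_eq_withDensity h]
  exact integral_withDensity_sign (measurable_prod_apply fun i => (h i).measurable)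
    (abs_prod_apply fun i => (h i).abs_eq_one) hf

theorem integrable_signedPi_prod {φ : (i : Fin d) → X i → ℝ} (hφ : ∀ i, (γ i).Integrable (φ i)) :
    (signedPi γ).Integrable fun x => ∏ i, φ i (x i) := by
  simpa only [VectorMeasure.Integrable, variation_signedPi] using Integrable.fintype_prod_dep hφ

theorem integral_signedPi_prod {φ : (i : Fin d) → X i → ℝ} (hφ : ∀ i, (γ i).Integrable (φ i)) :
    ∫ᵛ x, ∏ i, φ i (x i) ∂•(signedPi γ) = ∏ i, ∫ᵛ x, φ i x ∂•(γ i) := by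
  choose σ h using fun i => exists_isSignDensity (γ i)
  rw [integral_signedPi h (Integrable.fintype_prod_dep hφ)]
  simp only [← Finset.prod_mul_distrib]
  rw [integral_fintype_prod_eq_prod fun i t => φ i t * σ i t]
  exact Finset.prod_congr rfl fun i _ => ((h i).integral_eq (hφ i)).symm

end Pi

/-! ### Divided differences of `(x - u) g` -/

section Recurrence

variable {ι : Type*} [DecidableEq ι] {v : ι → ℝ} {s : Finset ι}

theorem dd_sub_node_mul (hv : Function.Injective v) {b : ι} (hb : b ∈ s) (g : ι → ℝ) :
    dd v s (fun i => (v i - v b) * g i) = dd v (s.erase b) g := by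
  conv_lhs => rw [← Finset.insert_erase hb]
  rw [dd_insert (Finset.notMem_erase b s), sub_self, zero_mul, mul_zero, zero_add, dd]
  refine Finset.sum_congr rfl fun i hi => ?_
  have : v i - v b ≠ 0 := sub_ne_zero.2 (hv.ne (Finset.ne_of_mem_erase hi))
  field_simp

/-- From `(b - a)(x - u) = (b - u)(x - a) + (u - a)(x - b)`, each linear factor on the right
removing one node. -/
theorem mul_dd_sub_mul (hv : Function.Injective v) {a b : ι} (ha : a ∈ s) (hb : b ∈ s) (u : ℝ)
    (g : ι → ℝ) : (v b - v a) * dd v s (fun i => (v i - u) * g i) =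
      (v b - u) * dd v (s.erase a) g + (u - v a) * dd v (s.erase b) g := by
  rw [← dd_sub_node_mul hv ha, ← dd_sub_node_mul hv hb, ← dd_const_mul, ← dd_const_mul,
    ← dd_const_mul, ← dd_add]
  congr 1
  funext i
  ring

theorem truncPow_succ (m : ℕ) (y : ℝ) : truncPow (m + 1) y = y * truncPow m y := by
  unfold truncPow
  split_ifs
  · rw [pow_succ']
  · rw [mul_zero]

end Recurrence

/-! ### Truncated powers are `m`-convex -/

section TestFunctions

variable {I : Set ℝ} {m : ℕ}

/-- Induction by the B-spline recurrence. For a knot between the extreme nodes, `mul_dd_sub_mul` has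
nonnegative coefficients; for a knot outside, the function is a low-degree polynomial or zero on the
nodes. -/
theorem mconvex_truncPow (m : ℕ) (u : ℝ) :
    MConvex (fun t : I => (t : ℝ)) m fun t => truncPow m ((t : ℝ) - u) := by
  induction m with
  | zero =>
    refine mconvex_zero_iff.2 fun x y hxy => ?_
    have : (x : ℝ) ≤ y := hxy
    simp only [truncPow, pow_zero]
    split_ifs <;> linarith
  | succ m ih =>
    intro s hs
    have hne : s.Nonempty := Finset.card_pos.1 (by omega)
    obtain ⟨a, ha, hmin⟩ := s.exists_min_image id hne
    obtain ⟨b, hb, hmax⟩ := s.exists_max_image id hne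
    have hmin' : ∀ t ∈ s, (a : ℝ) ≤ t := fun t ht => hmin t ht
    have hmax' : ∀ t ∈ s, (t : ℝ) ≤ b := fun t ht => hmax t ht
    rcases lt_or_ge u a with hua | hua
    · have : dd (fun t : I => (t : ℝ)) s (fun t => truncPow (m + 1) ((t : ℝ) - u)) =
          dd (fun t : I => (t : ℝ)) s
            fun t => ((Polynomial.X - Polynomial.C u) ^ (m + 1)).eval (t : ℝ) :=
        dd_congr fun t ht => by
          rw [truncPow, if_pos (by linarith [hmin' t ht])]
          simp
      rw [this, dd_eval_eq_zero Subtype.val_injective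
        (by rw [Polynomial.natDegree_pow, Polynomial.natDegree_X_sub_C]; omega)]
    rcases lt_or_ge (b : ℝ) u with hbu | hbu
    · have : dd (fun t : I => (t : ℝ)) s (fun t => truncPow (m + 1) ((t : ℝ) - u)) =
          dd (fun t : I => (t : ℝ)) s fun t => 0 :=
        dd_congr fun t ht => by rw [truncPow, if_neg (by linarith [hmax' t ht])]
      rw [this]
      simp [dd]
    have hab : (a : ℝ) < b := by
      obtain ⟨x, hx, y, hy, hxy⟩ := Finset.one_lt_card.1 (show 1 < s.card by omega)
      refine lt_of_le_of_ne (hmin' b hb) fun h => hxy (Subtype.ext ?_)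
      linarith [hmin' x hx, hmin' y hy, hmax' x hx, hmax' y hy]
    have h1 := mul_dd_sub_mul (v := fun t : I => (t : ℝ)) Subtype.val_injective ha hb u
      fun t => truncPow m ((t : ℝ) - u)
    have h2 := ih (s.erase a) (by rw [Finset.card_erase_of_mem ha]; omega)
    have h3 := ih (s.erase b) (by rw [Finset.card_erase_of_mem hb]; omega)
    simp only [truncPow_succ]
    refine nonneg_of_mul_nonneg_right ?_ (sub_pos.2 hab)
    rw [h1]
    exact add_nonneg (mul_nonneg (sub_nonneg.2 hbu) h2) (mul_nonneg (sub_nonneg.2 hua) h3)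

theorem dd_mul_pow_eq_zero {k : ℕ} (hk : k ≤ m) (c : ℝ) {s : Finset I} (hs : s.card = m + 2) :
    dd (fun t : I => (t : ℝ)) s (fun t => c * (t : ℝ) ^ k) = 0 := by
  rw [dd_const_mul, dd_pow_eq_zero Subtype.val_injective (by omega), mul_zero]

end TestFunctions

/-! ### Moments and truncated powers determine the measure -/

section Uniqueness

variable {I : Set ℝ} {τ : Measure I} [IsFiniteMeasure τ] {σ : I → ℝ} {m : ℕ}

/-- Differentiating in the knot may leave `I`. Beyond `I` on the right the truncated power vanishes;
on the left it is a polynomial of degree `m`, killed by the moments. -/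
theorem NonnegDensity.integral_truncPow_eq_zero_of_real (hI : I.OrdConnected)
    (h : NonnegDensity τ σ m) (h0 : ∀ u : I, ∫ t, truncPow m ((t : ℝ) - u) * σ t ∂τ = 0) (u : ℝ) :
    ∫ t : I, truncPow m ((t : ℝ) - u) * σ t ∂τ = 0 := by
  by_cases hu : u ∈ I
  · exact h0 ⟨u, hu⟩
  by_cases hlo : ∃ t : I, (t : ℝ) < u
  · obtain ⟨t, ht⟩ := hlo
    have : ∀ s : I, (s : ℝ) < u := fun s => by
      by_contra! hs
      exact hu (hI.out t.2 s.2 ⟨ht.le, hs⟩)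
    simp [truncPow, fun s : I => not_le.2 (this s)]
  · push Not at hlo
    rw [← h.integral_eval_eq_zero ((Polynomial.X - Polynomial.C u) ^ m)
      (by rw [Polynomial.natDegree_pow, Polynomial.natDegree_X_sub_C, mul_one])]
    congr 1
    funext t
    rw [truncPow, if_pos (sub_nonneg.2 (hlo t))]
    simp

theorem tendsto_truncPow_slope (m : ℕ) (y : ℝ) :
    Filter.Tendsto (fun k : ℕ => ((k : ℝ) + 1) *
      (truncPow (m + 1) (y + 1 / ((k : ℝ) + 1)) - truncPow (m + 1) y)) Filter.atTop
      (nhds ((m + 1) * truncPow m y)) := by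
  have hδ : Filter.Tendsto (fun k : ℕ => 1 / ((k : ℝ) + 1)) Filter.atTop (nhds 0) :=
    tendsto_one_div_add_atTop_nhds_zero_nat
  rcases lt_or_ge y 0 with hy | hy
  · refine tendsto_const_nhds.congr' ?_
    filter_upwards [hδ.eventually_lt_const (neg_pos.2 hy)] with k hk
    rw [truncPow, truncPow, truncPow, if_neg (not_le.2 hy), if_neg (by linarith),
      if_neg (not_le.2 hy)]
    ring
  · have hd := (hasDerivAt_pow (m + 1) y).tendsto_slope_zero
    have hδ' : Filter.Tendsto (fun k : ℕ => 1 / ((k : ℝ) + 1)) Filter.atTop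
        (nhdsWithin 0 {0}ᶜ) :=
      tendsto_nhdsWithin_iff.2 ⟨hδ, Filter.Eventually.of_forall fun k => by
        simpa using (by positivity : (k : ℝ) + 1 ≠ 0)⟩
    have := hd.comp hδ'
    simp only [truncPow, if_pos hy]
    convert this using 2 with k
    · have : 0 ≤ y + 1 / ((k : ℝ) + 1) := by positivity
      rw [if_pos this]
      simp
    · simp

theorem abs_truncPow_slope_le (m : ℕ) (y : ℝ) {δ : ℝ} (hδ : 0 < δ) (hδ1 : δ ≤ 1) :
    |truncPow (m + 1) (y + δ) - truncPow (m + 1) y| ≤ δ * ((m + 1) * (1 + |y|) ^ m) := by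
  have h0 : 0 ≤ δ * ((m + 1) * (1 + |y|) ^ m) := by positivity
  rcases lt_or_ge y 0 with hy | hy
  · rw [truncPow, truncPow, if_neg (not_le.2 hy), sub_zero]
    split_ifs with h1
    · rw [abs_of_nonneg (by positivity), pow_succ']
      have h2 : (y + δ) ^ m ≤ (m + 1) * (1 + |y|) ^ m := by
        have h3 : (y + δ) ^ m ≤ (1 + |y|) ^ m :=
          pow_le_pow_left₀ h1 (by linarith [abs_nonneg y]) m
        have h4 : 0 ≤ m * (1 + |y|) ^ m := by positivity
        linarith
      exact mul_le_mul (by linarith) h2 (by positivity) hδ.le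
    · simpa using h0
  · rw [truncPow, truncPow, if_pos hy, if_pos (by positivity)]
    refine (abs_pow_sub_pow_le ..).trans ?_
    rw [Nat.add_sub_cancel, add_sub_cancel_left, abs_of_pos hδ, abs_of_nonneg hy,
      abs_of_nonneg (by positivity), max_eq_left (by linarith), mul_assoc]
    push_cast
    refine mul_le_mul_of_nonneg_left (mul_le_mul_of_nonneg_left
      (pow_le_pow_left₀ (by positivity) (by linarith) m) (by positivity)) hδ.le

/-- Adding `τ` to `σ • τ` makes it positive, so uniqueness theorems for positive measures apply.
Equality forces `σ = 0` almost everywhere, against `|σ| = 1`. -/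
theorem measure_eq_zero_of_withDensity_one_add (hσ : Measurable σ) (h1 : ∀ t, |σ t| = 1)
    (heq : (τ.withDensity fun t => ENNReal.ofReal (1 + σ t)) = τ) : τ = 0 := by
  conv_rhs at heq => rw [← withDensity_one (μ := τ)]
  have hF : ∀ᵐ t ∂τ, False := by
    filter_upwards [(withDensity_eq_iff_of_sigmaFinite
      (measurable_const.add hσ).ennreal_ofReal.aemeasurable
      measurable_one.aemeasurable).1 heq] with t ht
    have h2 : 1 + σ t = 1 := by simpa using ht
    have := h1 t
    simp [show σ t = 0 by linarith] at this
  simpa using hF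

/-- A density that is orthogonal to all powers `xᵏ` with `k ≤ m` and to all truncated powers
`(x - u)₊ᵐ` is trivial. -/
theorem NonnegDensity.measure_eq_zero (hI : I.OrdConnected) (h : NonnegDensity τ σ m)
    (h0 : ∀ u : I, ∫ t, truncPow m ((t : ℝ) - u) * σ t ∂τ = 0) : τ = 0 := by
  induction m with
  | zero =>
    have hσ : Integrable σ τ := integrable_of_abs_eq_one h.measurable h.abs_eq_one
    set ν := τ.withDensity fun t => ENNReal.ofReal (1 + σ t) with hν
    have hσ1 : ∀ t, 0 ≤ 1 + σ t := fun t => by linarith [(abs_le.1 (h.abs_eq_one t).le).1]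
    have hadd : Integrable (fun t => 1 + σ t) τ := (integrable_const 1).add hσ
    have key : ∀ s, MeasurableSet s → ν s = ENNReal.ofReal (τ.real s + ∫ t in s, σ t ∂τ) := by
      intro s hs
      rw [hν, withDensity_apply _ hs, ← ofReal_integral_eq_lintegral_ofReal
        hadd.restrict (Filter.Eventually.of_forall hσ1),
        integral_add (integrable_const 1).restrict hσ.restrict]
      simp
    have hord : OrderTopology I := inferInstance
    have heq : τ = ν := by
      -- Closed rays determine a finite measure, and truncated powers of order zero are their
      -- indicators.
      refine Measure.ext_of_Ici _ _ fun u => ?_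
      rw [key _ measurableSet_Ici, ← integral_indicator measurableSet_Ici]
      have : ∫ t, (Set.Ici u).indicator σ t ∂τ = 0 := by
        rw [← h0 u]
        congr 1
        funext t
        by_cases ht : u ≤ t
        · have : (0 : ℝ) ≤ (t : ℝ) - u := sub_nonneg.2 ht
          simp [truncPow, ht]
        · simp [truncPow, ht]
      rw [this, add_zero, ofReal_measureReal]
    exact measure_eq_zero_of_withDensity_one_add h.measurable h.abs_eq_one heq.symm
  | succ m ih =>
    have hpow : Integrable (fun t : I => |(t : ℝ)| ^ m) τ := by
      simpa only [abs_pow] using (integrable_pow_of_le h.integrable_pow (Nat.le_succ m)).abs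
    have hz := h.integral_truncPow_eq_zero_of_real hI h0
    have hz' : ∀ u : I, ∫ t, truncPow m ((t : ℝ) - u) * σ t ∂τ = 0 := by
      intro u
      have hi : ∀ w : ℝ, Integrable (fun t : I => truncPow (m + 1) ((t : ℝ) - w) * σ t) τ :=
        fun w => (integrable_truncPow h.integrable_pow le_rfl w).mul_sign h.measurable h.abs_eq_one
      -- Difference quotients in the knot, moved left by `1 / (k + 1)`, converge to `(m + 1) (x -
      -- u)₊ᵐ`; this lowers the order by one.
      have hlim := tendsto_integral_of_dominated_convergence (μ := τ)
        (F := fun (k : ℕ) (t : I) => ((k : ℝ) + 1) * (truncPow (m + 1) ((t - u : ℝ) +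
          1 / ((k : ℝ) + 1)) - truncPow (m + 1) ((t : ℝ) - u)) * σ t)
        (f := fun t => (m + 1) * truncPow m ((t : ℝ) - u) * σ t)
        (fun t => (m + 1) * ((1 + |(u : ℝ)|) ^ m * (1 + |(t : ℝ)|) ^ m))
        (fun k => (((((measurable_truncPow (m + 1)).comp (by fun_prop)).sub
          ((measurable_truncPow (m + 1)).comp (by fun_prop))).const_mul _).mul
            h.measurable).aestronglyMeasurable)
        (((integrable_one_add_abs_pow hpow).const_mul _).const_mul _)
        (fun k => Filter.Eventually.of_forall fun t => ?_)
        (Filter.Eventually.of_forall fun t =>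
          (tendsto_truncPow_slope m ((t : ℝ) - u)).mul_const _)
      · have hF0 : ∀ k : ℕ, ∫ t : I, ((k : ℝ) + 1) * (truncPow (m + 1) ((t - u : ℝ) +
            1 / ((k : ℝ) + 1)) - truncPow (m + 1) ((t : ℝ) - u)) * σ t ∂τ = 0 := by
          intro k
          have h1 := hz ((u : ℝ) - 1 / ((k : ℝ) + 1))
          have h2 := hi ((u : ℝ) - 1 / ((k : ℝ) + 1))
          simp only [sub_sub_eq_add_sub, add_sub_right_comm] at h1 h2
          simp only [mul_assoc, sub_mul]
          rw [integral_const_mul, integral_sub h2 (hi u), h1, hz u, sub_zero, mul_zero]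
        simp only [hF0] at hlim
        have := tendsto_nhds_unique hlim tendsto_const_nhds
        simp only [mul_assoc] at this
        rw [integral_const_mul] at this
        exact (mul_eq_zero.1 this).resolve_left (by positivity)
      · have hk : (0 : ℝ) < 1 / ((k : ℝ) + 1) := by positivity
        have hk1 : 1 / ((k : ℝ) + 1) ≤ 1 := by
          rw [div_le_one (by positivity)]
          linarith [(Nat.cast_nonneg k : (0 : ℝ) ≤ k)]
        rw [Real.norm_eq_abs, abs_mul, h.abs_eq_one, mul_one, abs_mul,
          abs_of_pos (by positivity : (0 : ℝ) < (k : ℝ) + 1)]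
        have h1 := mul_le_mul_of_nonneg_left (abs_truncPow_slope_le m ((t : ℝ) - u) hk hk1)
          (by positivity : (0 : ℝ) ≤ (k : ℝ) + 1)
        rw [← mul_assoc ((k : ℝ) + 1), mul_one_div_cancel (by positivity), one_mul] at h1
        refine h1.trans ?_
        rw [← mul_pow]
        refine mul_le_mul_of_nonneg_left (pow_le_pow_left₀ (by positivity) ?_ m) (by positivity)
        have := abs_sub (t : ℝ) u
        nlinarith [abs_nonneg (u : ℝ), abs_nonneg (t : ℝ)]
    exact ih ⟨h.measurable, h.abs_eq_one, hpow, fun k hk => h.moment k (by omega),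
      fun u => (hz' u).ge⟩ hz'

end Uniqueness

/-! ### The convex and concave orders in one dimension -/

section SignedOneDim

variable {I : Set ℝ} {γ : SignedMeasure I} {σ : I → ℝ} {m : ℕ}

theorem IsSignDensity.neg (h : IsSignDensity γ σ) : IsSignDensity (-γ) fun t => -σ t where
  measurable := h.measurable.neg
  abs_eq_one t := by rw [abs_neg, h.abs_eq_one]
  eq_withDensity := by
    rw [VectorMeasure.variation_neg, withDensityᵥ_neg', ← h.eq_withDensity]

theorem cvNonneg_iff_cxNonneg_neg : CvNonneg m γ ↔ CxNonneg m (-γ) := by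
  have key : ∀ f : I → ℝ, ∫ᵛ x, -f x ∂•(-γ) = ∫ᵛ x, f x ∂•γ := fun f => by
    rw [VectorMeasure.integral_neg_vectorMeasure, VectorMeasure.integral_fun_neg, neg_neg]
  have hint : ∀ f : I → ℝ, (-γ).Integrable f ↔ γ.Integrable f := fun f => by
    simp only [VectorMeasure.Integrable, VectorMeasure.variation_neg]
  constructor
  · intro h f hf hfi
    have := h (fun x => -f x) (by
      rw [isNConcave_iff]
      simpa using (isNConvex_iff m f).1 hf) (((hint f).1 hfi).neg)
    rw [← key] at this
    simpa using this
  · intro h f hf hfi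
    have := h (fun x => -f x) ((isNConvex_iff m _).2 ((isNConcave_iff m f).1 hf))
      ((hint _).2 hfi.neg)
    rwa [key] at this

/-- Both signs of `xᵏ` with `k ≤ m`, and all truncated powers, are admissible test functions;
conversely they suffice by `NonnegDensity.integral_nonneg`. -/
theorem IsSignDensity.cxNonneg_iff (hI : I.OrdConnected) (h : IsSignDensity γ σ)
    (hpow : γ.Integrable fun t : I => |(t : ℝ)| ^ m) :
    CxNonneg m γ ↔ NonnegDensity γ.variation σ m := by
  constructor
  · intro hcx
    refine ⟨h.measurable, h.abs_eq_one, hpow, fun k hk => ?_, fun u => ?_⟩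
    · have key : ∀ c : ℝ, 0 ≤ c * ∫ t, (t : ℝ) ^ k * σ t ∂γ.variation := fun c => by
        have hi : γ.Integrable fun t : I => c * (t : ℝ) ^ k :=
          (integrable_pow_of_le hpow hk).const_mul c
        have := hcx _ ((isNConvex_iff m _).2 fun s hs => (dd_mul_pow_eq_zero hk c hs).ge) hi
        rw [h.integral_eq hi] at this
        simpa only [mul_assoc, integral_const_mul] using this
      linarith [key 1, key (-1)]
    · have hi : γ.Integrable fun t : I => truncPow m ((t : ℝ) - u) :=
        integrable_truncPow hpow le_rfl u
      have := hcx _ ((isNConvex_iff m _).2 (mconvex_truncPow m u)) hi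
      rwa [h.integral_eq hi] at this
  · intro hd f hf hfi
    rw [h.integral_eq hfi]
    exact hd.integral_nonneg hI ((isNConvex_iff m f).1 hf) hfi

theorem IsSignDensity.cvNonneg_iff (hI : I.OrdConnected) (h : IsSignDensity γ σ)
    (hpow : γ.Integrable fun t : I => |(t : ℝ)| ^ m) :
    CvNonneg m γ ↔ NonnegDensity γ.variation (fun t => -σ t) m := by
  rw [cvNonneg_iff_cxNonneg_neg, h.neg.cxNonneg_iff hI, VectorMeasure.variation_neg]
  simpa only [VectorMeasure.Integrable, VectorMeasure.variation_neg] using hpow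

theorem IsSignDensity.variation_ne_zero (h : IsSignDensity γ σ) (hγ : γ ≠ 0) :
    γ.variation ≠ 0 := by
  intro h0
  refine hγ (VectorMeasure.ext fun s hs => ?_)
  rw [h.eq_withDensity, withDensityᵥ_apply (integrable_of_abs_eq_one h.measurable h.abs_eq_one) hs,
    h0]
  simp

/-- Bounded continuous functions separate finite measures. Such a `g` fills the other slots of a
product test function with a nonzero factor. -/
theorem exists_integral_ne_zero (hγ : γ ≠ 0) :
    ∃ g : I → ℝ, Continuous g ∧ γ.Integrable g ∧ ∫ᵛ x, g x ∂•γ ≠ 0 := by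
  obtain ⟨σ, h⟩ := exists_isSignDensity γ
  by_contra! hno
  have hσ1 : ∀ t, 0 ≤ 1 + σ t := fun t => by linarith [(abs_le.1 (h.abs_eq_one t).le).1]
  have hσ : Integrable σ γ.variation := integrable_of_abs_eq_one h.measurable h.abs_eq_one
  have hfin : IsFiniteMeasure (γ.variation.withDensity fun t => ENNReal.ofReal (1 + σ t)) :=
    isFiniteMeasure_withDensity_ofReal ((integrable_const (1 : ℝ)).add hσ).2
  have heq : (γ.variation.withDensity fun t => ENNReal.ofReal (1 + σ t)) = γ.variation := by
    refine ext_of_forall_integral_eq_of_IsFiniteMeasure fun g => ?_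
    have hg : Integrable g γ.variation := g.integrable _
    have := hno g g.continuous hg
    rw [h.integral_eq hg] at this
    rw [integral_withDensity_eq_integral_toReal_smul
      (show Measurable fun t => ENNReal.ofReal (1 + σ t) from
        (measurable_const.add h.measurable).ennreal_ofReal)
      (Filter.Eventually.of_forall fun t => ENNReal.ofReal_lt_top)]
    simp only [ENNReal.toReal_ofReal (hσ1 _), smul_eq_mul, add_mul, one_mul]
    rw [integral_add hg (by simpa only [mul_comm] using hg.mul_sign h.measurable h.abs_eq_one)]
    simp only [mul_comm (σ _), this, add_zero]
  exact h.variation_ne_zero hγ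
    (measure_eq_zero_of_withDensity_one_add h.measurable h.abs_eq_one heq)

end SignedOneDim

/-! ### Continuous approximations of truncated powers -/

section Approximation

variable {I : Set ℝ} {m : ℕ}

/-- Continuous `m`-convex functions that converge to the truncated power `(x - u)₊ᵐ`. -/
noncomputable def truncPowApprox (m : ℕ) (u : ℝ) (k : ℕ) (x : ℝ) : ℝ :=
  -- Only the jump at order zero needs smoothing, by a monotone ramp that ends at `u` with value
  -- `1`, as the convention `0⁰ = 1` requires.
  if m = 0 then max 0 (min 1 (1 + (k + 1) * (x - u))) else truncPow m (x - u)

theorem continuous_truncPowApprox (m : ℕ) (u : ℝ) (k : ℕ) : Continuous (truncPowApprox m u k) := by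
  unfold truncPowApprox
  by_cases hm : m = 0
  · simp only [hm, if_true]
    fun_prop
  · simp only [hm, if_false]
    have : (fun x : ℝ => truncPow m (x - u)) = fun x => (max 0 (x - u)) ^ m := by
      funext x
      unfold truncPow
      split_ifs with h
      · rw [max_eq_right h]
      · rw [max_eq_left (not_le.1 h).le, zero_pow hm]
    rw [this]
    fun_prop

theorem mconvex_truncPowApprox (m : ℕ) (u : ℝ) (k : ℕ) :
    MConvex (fun t : I => (t : ℝ)) m fun t => truncPowApprox m u k t := by
  unfold truncPowApprox
  rcases Nat.eq_zero_or_pos m with rfl | hm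
  · simp only [if_true]
    refine mconvex_zero_iff.2 fun x y hxy => ?_
    have : (x : ℝ) ≤ y := hxy
    gcongr
  · simp only [hm.ne', if_false]
    exact mconvex_truncPow m u

theorem abs_truncPowApprox_le (m : ℕ) (u : ℝ) (k : ℕ) (x : ℝ) :
    |truncPowApprox m u k x| ≤ (1 + |u|) ^ m * (1 + |x|) ^ m := by
  unfold truncPowApprox
  split_ifs with hm
  · simp only [hm, pow_zero, mul_one]
    rw [abs_of_nonneg (le_max_left _ _)]
    exact max_le zero_le_one (min_le_left _ _)
  · refine (abs_truncPow_le m _).trans ?_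
    rw [← mul_pow]
    refine pow_le_pow_left₀ (abs_nonneg _) ?_ m
    have := abs_sub x u
    nlinarith [abs_nonneg u, abs_nonneg x]

theorem tendsto_truncPowApprox (m : ℕ) (u x : ℝ) :
    Filter.Tendsto (fun k => truncPowApprox m u k x) Filter.atTop (nhds (truncPow m (x - u))) := by
  unfold truncPowApprox
  by_cases hm : m = 0
  · simp only [hm, if_true, truncPow, pow_zero]
    split_ifs with h
    · refine tendsto_const_nhds.congr fun k => ?_
      have : 0 ≤ ((k : ℝ) + 1) * (x - u) := by positivity
      rw [min_eq_left (by linarith), max_eq_right zero_le_one]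
    · refine tendsto_const_nhds.congr' ?_
      have hpos : 0 < u - x := by linarith [not_le.1 h]
      filter_upwards [Filter.eventually_ge_atTop ⌈1 / (u - x)⌉₊] with k hk
      have h1 : 1 / (u - x) ≤ k := Nat.ceil_le.1 hk
      rw [div_le_iff₀ hpos] at h1
      have h2 : 1 + ((k : ℝ) + 1) * (x - u) ≤ 0 := by nlinarith
      rw [max_eq_left ((min_le_right _ _).trans h2)]
  · simp only [hm, if_false]
    exact tendsto_const_nhds

end Approximation

/-! ### The implications between the three conditions -/

section Implications

variable {d : ℕ} {I : Fin d → Set ℝ} {m : Fin d → ℕ} {γ : (i : Fin d) → SignedMeasure (I i)}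

theorem prod_integral_nonneg
    (h : ∀ f : ((i : Fin d) → I i) → ℝ, Continuous f → IsBoxConvex I (fun i => m i + 1) f →
      (signedPi γ).Integrable f → 0 ≤ ∫ᵛ x, f x ∂•(signedPi γ))
    {φ : (i : Fin d) → I i → ℝ} (hc : ∀ i, Continuous (φ i)) (hint : ∀ i, (γ i).Integrable (φ i))
    (hdd : ∀ S : (i : Fin d) → Finset (I i), (∀ i, (S i).card = m i + 2) →
      0 ≤ ∏ i, dd (fun t : I i => (t : ℝ)) (S i) (φ i)) :
    0 ≤ ∏ i, ∫ᵛ x, φ i x ∂•(γ i) := by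
  rw [← integral_signedPi_prod hint]
  refine h _ (continuous_finsetProd _ fun i _ => (hc i).comp (continuous_apply i)) ?_
    (integrable_signedPi_prod hint)
  refine isBoxConvex_iff.2 fun S hS => ?_
  rw [mdd_prod]
  exact hdd S hS

/-- A power `xᵏ` with `k ≤ m i` in slot `i` kills the multiple divided difference, so both signs of
the product are box-convex and the product of the integrals is zero; the other factors are nonzero
by choice. -/
theorem integral_pow_eq_zero_of_integral_nonneg (hγ : ∀ i, γ i ≠ 0)
    (hpow : ∀ i, (γ i).Integrable fun t : I i => |(t : ℝ)| ^ m i)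
    (h : ∀ f : ((i : Fin d) → I i) → ℝ, Continuous f → IsBoxConvex I (fun i => m i + 1) f →
      (signedPi γ).Integrable f → 0 ≤ ∫ᵛ x, f x ∂•(signedPi γ))
    (i : Fin d) {k : ℕ} (hk : k ≤ m i) : ∫ᵛ x, (x : ℝ) ^ k ∂•(γ i) = 0 := by
  choose g hgc hgi hg0 using fun j => exists_integral_ne_zero (hγ j)
  have key : ∀ c : ℝ, 0 ≤ c * ((∫ᵛ x, (x : ℝ) ^ k ∂•(γ i)) *
      ∏ j ∈ Finset.univ.erase i, ∫ᵛ x, g j x ∂•(γ j)) := by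
    intro c
    have := prod_integral_nonneg h (φ := Function.update g i fun t => c * (t : ℝ) ^ k)
      (fun j => ?_) (fun j => ?_) fun S hS => ?_
    · rw [← Finset.mul_prod_erase _ _ (Finset.mem_univ i), Function.update_self,
        Finset.prod_congr rfl fun j hj => by
          rw [Function.update_of_ne (Finset.ne_of_mem_erase hj)]] at this
      have hc : ∫ᵛ x, c * (x : ℝ) ^ k ∂•(γ i) = c * ∫ᵛ x, (x : ℝ) ^ k ∂•(γ i) :=
        VectorMeasure.integral_fun_smul (c := c) (f := fun x : I i => (x : ℝ) ^ k) ..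
      rwa [hc, mul_assoc] at this
    · rcases eq_or_ne j i with rfl | hj
      · rw [Function.update_self]
        fun_prop
      · rw [Function.update_of_ne hj]
        exact hgc j
    · rcases eq_or_ne j i with rfl | hj
      · rw [Function.update_self]
        exact (integrable_pow_of_le (hpow j) hk).const_mul c
      · rw [Function.update_of_ne hj]
        exact hgi j
    · refine (Finset.prod_eq_zero (Finset.mem_univ i) ?_).ge
      rw [Function.update_self]
      exact dd_mul_pow_eq_zero hk c (hS i)
  have h0 : (∫ᵛ x, (x : ℝ) ^ k ∂•(γ i)) *
      ∏ j ∈ Finset.univ.erase i, ∫ᵛ x, g j x ∂•(γ j) = 0 := by linarith [key 1, key (-1)]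
  exact (mul_eq_zero.1 h0).resolve_right (Finset.prod_ne_zero_iff.2 fun j _ => hg0 j)

theorem prod_truncPow_nonneg_of_integral_nonneg
    (hpow : ∀ i, (γ i).Integrable fun t : I i => |(t : ℝ)| ^ m i)
    (h : ∀ f : ((i : Fin d) → I i) → ℝ, Continuous f → IsBoxConvex I (fun i => m i + 1) f →
      (signedPi γ).Integrable f → 0 ≤ ∫ᵛ x, f x ∂•(signedPi γ))
    (u : (i : Fin d) → I i) : 0 ≤ ∏ j, ∫ᵛ x, truncPow (m j) ((x : ℝ) - u j) ∂•(γ j) := by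
  have hmeas : ∀ j k, AEStronglyMeasurable
      (fun t : I j => truncPowApprox (m j) (u j) k t) (γ j).variation := fun j k =>
    ((continuous_truncPowApprox (m j) (u j) k).comp
      continuous_subtype_val).measurable.aestronglyMeasurable
  have hlim : Filter.Tendsto
      (fun k => ∏ j, ∫ᵛ x, truncPowApprox (m j) (u j) k (x : ℝ) ∂•(γ j)) Filter.atTop
      (nhds (∏ j, ∫ᵛ x, truncPow (m j) ((x : ℝ) - u j) ∂•(γ j))) := by
    refine tendsto_finsetProd _ fun j _ => ?_
    exact VectorMeasure.tendsto_integral_of_dominated_convergence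
      (fun t : I j => (1 + |(u j : ℝ)|) ^ m j * (1 + |(t : ℝ)|) ^ m j) (hmeas j)
      ((integrable_one_add_abs_pow (hpow j)).const_mul _)
      (fun k => Filter.Eventually.of_forall fun t => abs_truncPowApprox_le _ _ k _)
      (Filter.Eventually.of_forall fun t => tendsto_truncPowApprox _ _ _)
  refine ge_of_tendsto' hlim fun k => prod_integral_nonneg h
    (φ := fun j t => truncPowApprox (m j) (u j) k t)
    (fun j => (continuous_truncPowApprox _ _ k).comp continuous_subtype_val)
    (fun j => integrable_of_growth (hpow j) (hmeas j k) fun t => abs_truncPowApprox_le _ _ k _)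
    fun S hS => Finset.prod_nonneg fun j _ => mconvex_truncPowApprox _ _ k _ (hS j)

theorem even_card_filter_neg_of_prod_pos {ι : Type*} [Fintype ι] [DecidableEq ι] {a : ι → ℝ}
    (ha : 0 < ∏ i, a i) : Even (Finset.univ.filter fun i => a i < 0).card := by
  have h1 : ∏ i, a i = (-1) ^ (Finset.univ.filter fun i => a i < 0).card * ∏ i, |a i| := by
    rw [← Finset.prod_const, Finset.prod_filter, ← Finset.prod_mul_distrib]
    refine Finset.prod_congr rfl fun i _ => ?_
    split_ifs with h
    · rw [abs_of_neg h]; ring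
    · rw [abs_of_nonneg (not_lt.1 h), one_mul]
  by_contra hodd
  rw [Nat.not_even_iff_odd] at hodd
  rw [h1, hodd.neg_one_pow] at ha
  have : 0 ≤ ∏ i, |a i| := Finset.prod_nonneg fun i _ => abs_nonneg _
  linarith

/-- The product inequality fixes the sign of each factor as its own knot varies, once the remaining
factors are held at nonzero values. -/
theorem cxNonneg_or_cvNonneg_and_even (hI : ∀ i, (I i).OrdConnected) (hγ : ∀ i, γ i ≠ 0)
    (hpow : ∀ i, (γ i).Integrable fun t : I i => |(t : ℝ)| ^ m i)
    (hmom : ∀ i, ∀ k ≤ m i, ∫ᵛ x, (x : ℝ) ^ k ∂•(γ i) = 0)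
    (hprod : ∀ u : (i : Fin d) → I i,
      0 ≤ ∏ j, ∫ᵛ x, truncPow (m j) ((x : ℝ) - u j) ∂•(γ j)) :
    (∀ j, CxNonneg (m j) (γ j) ∨ CvNonneg (m j) (γ j)) ∧
      Even {j : Fin d | CvNonneg (m j) (γ j)}.ncard := by
  choose σ hσ using fun i => exists_isSignDensity (γ i)
  set H : (j : Fin d) → I j → ℝ := fun j u => ∫ᵛ x, truncPow (m j) ((x : ℝ) - u) ∂•(γ j) with hH
  have hHeq : ∀ j u, H j u = ∫ t, truncPow (m j) ((t : ℝ) - u) * σ j t ∂(γ j).variation :=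
    fun j u => (hσ j).integral_eq (integrable_truncPow (hpow j) le_rfl u)
  have hmom' : ∀ j, ∀ k ≤ m j, ∫ t, (t : ℝ) ^ k * σ j t ∂(γ j).variation = 0 := fun j k hk => by
    rw [← (hσ j).integral_eq (integrable_pow_of_le (hpow j) hk)]
    exact hmom j k hk
  have hcx : ∀ j, (∀ u, 0 ≤ H j u) → NonnegDensity (γ j).variation (σ j) (m j) := fun j hj =>
    ⟨(hσ j).measurable, (hσ j).abs_eq_one, hpow j, hmom' j, fun u => by rw [← hHeq]; exact hj u⟩
  have hcv : ∀ j, (∀ u, H j u ≤ 0) → NonnegDensity (γ j).variation (fun t => -σ j t) (m j) :=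
    fun j hj => ⟨(hσ j).measurable.neg, fun t => by rw [abs_neg, (hσ j).abs_eq_one], hpow j,
      fun k hk => by simp only [mul_neg, integral_neg, hmom' j k hk, neg_zero],
      fun u => by simpa only [mul_neg, integral_neg, ← hHeq, neg_nonneg] using hj u⟩
  have hne : ∀ j, ∃ w, H j w ≠ 0 := by
    intro j
    by_contra! h0
    exact (hσ j).variation_ne_zero (hγ j) ((hcx j fun u => (h0 u).ge).measure_eq_zero (hI j)
      fun u => by rw [← hHeq, h0])
  choose w hw using hne
  -- Multiply the inequalities at `w` and at `w` with coordinate `j` changed: the common remaining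
  -- factor appears squared and is nonzero.
  have hsign : ∀ j u, 0 ≤ H j u * H j (w j) := by
    intro j u
    have h1 := hprod (Function.update w j u)
    have h2 := hprod w
    rw [← Finset.mul_prod_erase _ _ (Finset.mem_univ j)] at h1 h2
    rw [Function.update_self, Finset.prod_congr rfl fun i hi => by
      rw [Function.update_of_ne (Finset.ne_of_mem_erase hi)]] at h1
    set P := ∏ i ∈ Finset.univ.erase j, ∫ᵛ x, truncPow (m i) ((x : ℝ) - w i) ∂•(γ i)
    have hP : P ≠ 0 := Finset.prod_ne_zero_iff.2 fun i _ => hw i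
    have h3 : 0 ≤ (H j u * H j (w j)) * (P * P) := by
      have := mul_nonneg h1 h2
      calc 0 ≤ (H j u * P) * (H j (w j) * P) := this
        _ = _ := by ring
    exact nonneg_of_mul_nonneg_left h3 (mul_self_pos.2 hP)
  have hpos : ∀ j, 0 < H j (w j) → CxNonneg (m j) (γ j) := fun j hj =>
    ((hσ j).cxNonneg_iff (hI j) (hpow j)).2
      (hcx j fun u => nonneg_of_mul_nonneg_left (hsign j u) hj)
  -- The concave order forces `H j ≤ 0`; as `H j (w j) ≠ 0`, counting concave indices is counting
  -- negative factors at `w`.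
  have hneg : ∀ j, CvNonneg (m j) (γ j) ↔ H j (w j) < 0 := by
    intro j
    constructor
    · intro h
      have := (((hσ j).cvNonneg_iff (hI j) (hpow j)).1 h).truncPow_nonneg (w j)
      simp only [mul_neg, integral_neg, ← hHeq, neg_nonneg] at this
      exact lt_of_le_of_ne this (hw j)
    · intro h
      exact ((hσ j).cvNonneg_iff (hI j) (hpow j)).2
        (hcv j fun u => by nlinarith [hsign j u])
  refine ⟨fun j => ?_, ?_⟩
  · rcases lt_or_gt_of_ne (hw j) with h | h
    · exact Or.inr ((hneg j).2 h)
    · exact Or.inl (hpos j h)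
  · have : {j : Fin d | CvNonneg (m j) (γ j)} =
        ((Finset.univ.filter fun j => H j (w j) < 0 : Finset (Fin d)) : Set (Fin d)) := by
      ext j
      simp [hneg j]
    rw [this, Set.ncard_coe_finset]
    exact even_card_filter_neg_of_prod_pos
      (lt_of_le_of_ne (hprod w) (Finset.prod_ne_zero_iff.2 fun j _ => hw j).symm)

/-- Flip the sign density of every concave-ordered factor. The flips multiply to `1` by parity, so
the integral is unchanged and `integral_pi_nonneg` applies. -/
theorem integral_signedPi_nonneg (hI : ∀ i, (I i).OrdConnected) (hγ : ∀ i, γ i ≠ 0)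
    (hpow : ∀ i, (γ i).Integrable fun t : I i => |(t : ℝ)| ^ m i)
    (hor : ∀ j, CxNonneg (m j) (γ j) ∨ CvNonneg (m j) (γ j))
    (heven : Even {j : Fin d | CvNonneg (m j) (γ j)}.ncard)
    {f : ((i : Fin d) → I i) → ℝ} (hfc : Continuous f) (hf : IsBoxConvex I (fun i => m i + 1) f)
    (hint : (signedPi γ).Integrable f) : 0 ≤ ∫ᵛ x, f x ∂•(signedPi γ) := by
  classical
  choose σ hσ using fun i => exists_isSignDensity (γ i)
  have hint' : Integrable f (Measure.pi fun i => (γ i).variation) := by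
    simpa only [VectorMeasure.Integrable, variation_signedPi] using hint
  set s : Fin d → ℝ := fun j => if CvNonneg (m j) (γ j) then -1 else 1 with hs
  have hcard : (Finset.univ.filter fun j => CvNonneg (m j) (γ j)).card =
      {j : Fin d | CvNonneg (m j) (γ j)}.ncard := by
    rw [← Set.ncard_coe_finset]
    congr 1
    ext j
    simp
  have hprod : ∏ j, s j = 1 := by
    rw [hs, ← Finset.prod_filter, Finset.prod_const, hcard, heven.neg_one_pow]
  have hd : ∀ j, NonnegDensity (γ j).variation (fun t => s j * σ j t) (m j) := by
    intro j
    by_cases h : CvNonneg (m j) (γ j)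
    · simpa only [hs, h, if_true, neg_one_mul] using
        ((hσ j).cvNonneg_iff (hI j) (hpow j)).1 h
    · simpa only [hs, h, if_false, one_mul] using
        ((hσ j).cxNonneg_iff (hI j) (hpow j)).1 ((hor j).resolve_right h)
  have := integral_pi_nonneg hI hd (fun j => (hσ j).variation_ne_zero (hγ j)) hfc hf hint'
  simp only [Finset.prod_mul_distrib, hprod, one_mul] at this
  rwa [integral_signedPi hσ hint']

end Implications

end BoxConvexity

theorem mainTheorem9 (d : ℕ) (I : Fin d → Set ℝ) (hI : ∀ i, (I i).OrdConnected)
    (n : Fin d → ℕ) (hn : ∀ i, 1 ≤ n i)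
    (γ : (i : Fin d) → SignedMeasure (I i)) (hγ : ∀ i, γ i ≠ 0)
    (hmom : ∀ i, (γ i).Integrable (fun x : I i => |(x : ℝ)| ^ (n i - 1))) :
    ((∀ f : ((i : Fin d) → I i) → ℝ, Continuous f → BoxConvexity.IsBoxConvex I n f →
          (BoxConvexity.signedPi γ).Integrable f →
          0 ≤ ∫ᵛ x, f x ∂•(BoxConvexity.signedPi γ)) ↔
        ((∀ j, BoxConvexity.CxNonneg (n j - 1) (γ j) ∨ BoxConvexity.CvNonneg (n j - 1) (γ j)) ∧
          Even {j : Fin d | BoxConvexity.CvNonneg (n j - 1) (γ j)}.ncard)) ∧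
    ((∀ f : ((i : Fin d) → I i) → ℝ, Continuous f → BoxConvexity.IsBoxConvex I n f →
          (BoxConvexity.signedPi γ).Integrable f →
          0 ≤ ∫ᵛ x, f x ∂•(BoxConvexity.signedPi γ)) ↔
        ((∀ i, ∀ k ∈ Finset.range (n i), ∫ᵛ x, (x : ℝ) ^ k ∂•(γ i) = 0) ∧
          ∀ u : (i : Fin d) → I i,
            0 ≤ ∏ j, ∫ᵛ x, BoxConvexity.truncPow (n j - 1) ((x : ℝ) - (u j : ℝ)) /
              ((n j - 1).factorial : ℝ) ∂•(γ j))) := by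
  obtain ⟨m, rfl⟩ : ∃ m : Fin d → ℕ, n = fun i => m i + 1 :=
    ⟨fun i => n i - 1, funext fun i => (Nat.sub_add_cancel (hn i)).symm⟩
  simp only [Nat.add_sub_cancel, Finset.mem_range, Nat.lt_succ_iff] at hmom ⊢
  have hfac : ∀ u : (i : Fin d) → I i,
      0 ≤ ∏ j, ∫ᵛ x, BoxConvexity.truncPow (m j) ((x : ℝ) - (u j : ℝ)) /
        ((m j).factorial : ℝ) ∂•(γ j) ↔
      0 ≤ ∏ j, ∫ᵛ x, BoxConvexity.truncPow (m j) ((x : ℝ) - (u j : ℝ)) ∂•(γ j) := by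
    intro u
    have hsmul : ∀ j, ∫ᵛ x, BoxConvexity.truncPow (m j) ((x : ℝ) - (u j : ℝ)) /
        ((m j).factorial : ℝ) ∂•(γ j) = ((m j).factorial : ℝ)⁻¹ *
        ∫ᵛ x, BoxConvexity.truncPow (m j) ((x : ℝ) - (u j : ℝ)) ∂•(γ j) := by
      intro j
      simp only [div_eq_inv_mul]
      exact VectorMeasure.integral_fun_smul (c := ((m j).factorial : ℝ)⁻¹)
        (f := fun x : I j => BoxConvexity.truncPow (m j) ((x : ℝ) - (u j : ℝ))) ..
    simp only [hsmul, Finset.prod_mul_distrib]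
    exact mul_nonneg_iff_of_pos_left (Finset.prod_pos fun j _ => by positivity)
  simp only [hfac]
  -- These are 2 ⇒ 1 and 3 ⇒ 2; with 1 ⇒ 3 they close the cycle.
  have h21 := BoxConvexity.integral_signedPi_nonneg hI hγ hmom
  have h32 := BoxConvexity.cxNonneg_or_cvNonneg_and_even hI hγ hmom
  refine ⟨⟨fun h => h32 (fun i k hk =>
      BoxConvexity.integral_pow_eq_zero_of_integral_nonneg hγ hmom h i hk)
      (BoxConvexity.prod_truncPow_nonneg_of_integral_nonneg hmom h),
    fun h f hfc hf hint => h21 h.1 h.2 hfc hf hint⟩,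
    ⟨fun h => ⟨fun i k hk =>
      BoxConvexity.integral_pow_eq_zero_of_integral_nonneg hγ hmom h i hk,
      BoxConvexity.prod_truncPow_nonneg_of_integral_nonneg hmom h⟩,
    fun h f hfc hf hint => ?_⟩⟩
  have h2 := h32 h.1 h.2
  exact h21 h2.1 h2.2 hfc hf hint
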